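/- Let $\mathcal{C}$ be a complete Segal space (CSS), i.e. a Reedy fibrant simplicial space satisfying the Segal and the completeness condition. Assume that $\mathcal{C}$ is \emph{stable}: it has all finite limits and colimits, it has an object that is both initial and final, and a commutative square in $\mathcal{C}$ is a pullback square if and only if it is a pushout square. A map $f\colon x\to y$ of $\mathcal{C}$ is \emph{$(-1)$-truncated} if for every object $g$ of the over-category $\mathcal{C}_{/y}$ the mapping space $\mathrm{map}_{/y}(g,f)$ is empty or contractible. A \emph{simplicial object} of $\mathcal{C}$ is a map $W\colon \Delta^{op}\to\mathcal{C}$ from the (discrete) nerve of $\Delta^{op}$. It is a \emph{Segal object} if $W_n$ is, via the spine maps, the limit $W_1\times_{W_0}\cdots\times_{W_0}W_1$ for every $n\ge 2$. Its \emph{object of equivalences} is the pullback $W_{hoequiv}$ of $$W_1\xrightarrow{(s_0d_0,\,\mathrm{id},\,s_0d_1)} Z(3)\xleftarrow{(d_1d_3,\,d_0d_3,\,d_1d_0)} W_3,$$ where $Z(3)$ is the limit of $W_1\xrightarrow{t}W_0\xleftarrow{t}W_1\xrightarrow{s}W_0\xleftarrow{s}W_1$ with $s=d_1$, $t=d_0$.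 A Segal object is a \emph{complete Segal object} (CSO) if the map $s_0\colon W_0\to W_{hoequiv}$ is an equivalence in $\mathcal{C}$. A simplicial object is \emph{trivial} if it is equivalent, as a simplicial object (levelwise), to a constant one. Then: 1. every $(-1)$-truncated map of $\mathcal{C}$ is an equivalence; 2. for every complete Segal object $W$ in $\mathcal{C}$, the map $s_0\colon W_0\to W_1$ is $(-1)$-truncated and an equivalence, and $W$ is trivial. -/

import Mathlib

universe u

/-- Simplicial spaces (bisimplicial sets): the space in categorical degree `n` is `X.obj n`, and its
set of `l`-simplices is `(X.obj n).obj l`. -/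
abbrev SimplicialSpace : Type (u + 1) := CategoryTheory.Functor SimplexCategoryᵒᵖ SSet.{u}

namespace SimplicialSpace

/-- The shape of the diagram in which the object of equivalences `T_hoequiv = T_1 ×_{Z(3)} T_3` is
formed. The vertices `1, 2` and edges `02, 12, 13` of `Δ[3]` form the zigzag
`T_1 → T_0 ← T_1 → T_0 ← T_1` with limit `Z(3)`. -/
inductive EquivShape : Type
  | W₀ | hoequiv | T₃ | T₁ | Z₃ | e₀₂ | e₁₂ | e₁₃ | v₂ | v₁
  deriving DecidableEq

namespace EquivShape

instance : Fintype EquivShape where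
  elems := {W₀, hoequiv, T₃, T₁, Z₃, e₀₂, e₁₂, e₁₃, v₂, v₁}
  complete q := by cases q <;> decide

/-- The order: `W₀ < hoequiv < T₃, T₁ < Z₃ < e₀₂, e₁₂, e₁₃`, with `e₀₂, e₁₂ < v₂` and
`e₁₂, e₁₃ < v₁`. -/
def leBool : EquivShape → EquivShape → Bool
  | W₀, _ => true
  | hoequiv, q => q != W₀
  | T₃, q => q != W₀ && q != hoequiv && q != T₁
  | T₁, q => q != W₀ && q != hoequiv && q != T₃
  | Z₃, q => q != W₀ && q != hoequiv && q != T₃ && q != T₁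
  | e₀₂, q => q == e₀₂ || q == v₂
  | e₁₂, q => q == e₁₂ || q == v₂ || q == v₁
  | e₁₃, q => q == e₁₃ || q == v₁
  | v₂, q => q == v₂
  | v₁, q => q == v₁

instance : PartialOrder EquivShape where
  le p q := leBool p q = true
  le_refl := by decide
  le_trans := by decide
  le_antisymm := by decide

instance : DecidableLE EquivShape := fun p q ↦ inferInstanceAs (Decidable (leBool p q = true))

/-- The objects that are given by the simplicial object. -/
abbrev Core : Type := {q : EquivShape // q ≠ hoequiv ∧ q ≠ Z₃}

/-- The object `q` of `Core` is sent to the simplex `[dim q]`. -/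
def dim : EquivShape → ℕ
  | T₃ => 3
  | T₁ | e₀₂ | e₁₂ | e₁₃ => 1
  | _ => 0

/-- The vertices of `[dim q]` as vertices of `[3]` (those of `T₁` are the vertices of the edge
`12`). -/
def toThree : (q : EquivShape) → Fin (dim q + 1) → Fin 4
  | T₃ => ![0, 1, 2, 3]
  | T₁ => ![1, 2]
  | e₀₂ => ![0, 2]
  | e₁₂ => ![1, 2]
  | e₁₃ => ![1, 3]
  | v₂ => ![2]
  | v₁ => ![1]
  | W₀ | hoequiv | Z₃ => ![0]

/-- Maps backwards. On `T₁`, it makes the edges `02` and `13` of `[3]` degenerate. -/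
def ofThree : (q : EquivShape) → Fin 4 → Fin (dim q + 1)
  | T₃ => ![0, 1, 2, 3]
  | T₁ => ![1, 0, 1, 0]
  | e₀₂ => ![0, 0, 1, 1]
  | e₁₂ => ![0, 0, 1, 1]
  | e₁₃ => ![0, 0, 1, 1]
  | v₂ | v₁ | W₀ | hoequiv | Z₃ => fun _ ↦ 0

end EquivShape

noncomputable section

open CategoryTheory Simplicial Opposite MonoidalCategory CartesianMonoidalCategory

/-- The unique map `[0] → l` of the opposite simplex category (it induces degeneracies). -/
def fromZero (l : SimplexCategoryᵒᵖ) : op ⦋0⦌ ⟶ l := (l.unop.const ⦋0⦌ 0).op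

/-- Any two maps out of `[0]` in the opposite simplex category agree. -/
lemma fromZero_comp {l l' : SimplexCategoryᵒᵖ} (g : l ⟶ l') : fromZero l ≫ g = fromZero l' :=
  Quiver.Hom.unop_inj (SimplexCategory.isTerminalZero.hom_ext _ _)

lemma fromZero_zero : fromZero (op ⦋0⦌) = 𝟙 _ :=
  Quiver.Hom.unop_inj (SimplexCategory.isTerminalZero.hom_ext _ _)

/-- The simplicial set obtained from `X` by fixing the space direction `l`. A map `K ⟶ X.row 0`
from a simplicial set `K` is the same as a map `K → X` of simplicial spaces, where `K` is regarded
as a discrete simplicial space; these are the diagrams of shape `K` in `X`. -/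
abbrev row (X : SimplicialSpace.{u}) (l : SimplexCategoryᵒᵖ) : SSet.{u} := X.flip.obj l

/-- The simplicial set underlying `X`: vertices are the objects of `X`, edges are its maps. -/
abbrev base (X : SimplicialSpace.{u}) : SSet.{u} := X.row (op ⦋0⦌)

/-- The maps of `X`. -/
abbrev Arr (X : SimplicialSpace.{u}) : Type u := X.base _⦋1⦌

/-- Degenerating a point of a space to an `l`-simplex, on rows. -/
abbrev baseTo (X : SimplicialSpace.{u}) (l : SimplexCategoryᵒᵖ) : X.base ⟶ X.row l :=
  X.flip.map (fromZero l)

/-- The mapping space `Map(K, X)` from a discrete simplicial space `K`. Its `l`-simplices are the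
maps `K × Δ[l] → X` of simplicial spaces, that is, the maps of simplicial sets `K ⟶ X.row l`. -/
def mapSpaceFrom (X : SimplicialSpace.{u}) : SSet.{u}ᵒᵖ ⥤ SSet.{u} :=
  coyoneda ⋙ (Functor.whiskeringLeft _ _ _).obj X.flip

/-- Reedy fibrancy: each matching map `X_n = Map(F(n), X) → Map(∂F(n), X)` is a Kan fibration. -/
def IsReedyFibrant (X : SimplicialSpace.{u}) : Prop :=
  ∀ n : ℕ, SSet.modelCategoryQuillen.J.rlp (X.mapSpaceFrom.map (∂Δ[n].ι).op)

/-- The spine `G(n)` of `Δ[n]`: the union of the edges `i → i + 1`. -/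
def spine (n : ℕ) : (Δ[n] : SSet.{u}).Subcomplex where
  obj m := {α | ∀ i j : Fin (m.unop.len + 1),
    ((SSet.stdSimplex.objEquiv α).toOrderHom j : ℕ) ≤
      (SSet.stdSimplex.objEquiv α).toOrderHom i + 1}
  map _ _ h _ _ := h _ _

/-- The Segal condition: `X_n → Map(G(n), X) = X_1 ×_{X_0} ⋯ ×_{X_0} X_1` is an equivalence for
`n ≥ 2`. For Reedy fibrant `X` this is a Kan fibration, so that it is an equivalence if and only if
it is a trivial Kan fibration. -/
def IsSegal (X : SimplicialSpace.{u}) : Prop :=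
  ∀ n : ℕ, 2 ≤ n → SSet.modelCategoryQuillen.I.rlp (X.mapSpaceFrom.map (spine n).ι.op)

/-- The completeness condition: `Map(E(1), X) → Map(F(0), X) = X_0` is a trivial Kan fibration,
where `E(1)` is the free invertible arrow. -/
def IsComplete (X : SimplicialSpace.{u}) : Prop :=
  SSet.modelCategoryQuillen.I.rlp
    (X.mapSpaceFrom.map (SSet.const SSet.coherentIso.x₀ : Δ[0] ⟶ SSet.coherentIso.{u}).op)

/-- Complete Segal spaces. -/
structure IsCompleteSegalSpace (X : SimplicialSpace.{u}) : Prop where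
  reedyFibrant : X.IsReedyFibrant
  segal : X.IsSegal
  complete : X.IsComplete

/-- The map `f` (an edge of the underlying simplicial set) is an equivalence: it has a left inverse
and a right inverse, as witnessed by `2`-simplices. -/
def IsEquivalence (X : SimplicialSpace.{u}) (f : X.base _⦋1⦌) : Prop :=
  (∃ σ : X.base _⦋2⦌, X.base.δ 2 σ = f ∧ X.base.δ 1 σ = X.base.σ 0 (X.base.δ 1 f)) ∧
  (∃ τ : X.base _⦋2⦌, X.base.δ 0 τ = f ∧ X.base.δ 1 τ = X.base.σ 0 (X.base.δ 0 f))

/-- The mapping space `map_X(y, z)`: the fiber of `(s, t) : X_1 → X_0 × X_0` over `(y, z)`. -/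
def mappingSpace (X : SimplicialSpace.{u}) (y z : X.base _⦋0⦌) : SSet.{u} where
  obj l := {w : (X.row l) _⦋1⦌ //
    (X.row l).δ 1 w = (X.baseTo l).app _ y ∧ (X.row l).δ 0 w = (X.baseTo l).app _ z}
  map {l l'} g := ↾fun w ↦ ⟨(X.flip.map g).app _ w.1, by
    obtain ⟨w, h₁, h₀⟩ := w
    have key : ∀ x : X.base _⦋0⦌, (X.flip.map g).app _ ((X.baseTo l).app _ x) =
        (X.baseTo l').app _ x := fun x ↦ by
      rw [baseTo, baseTo, ← fromZero_comp g, CategoryTheory.Functor.map_comp]; rfl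
    have e₁ := congrArg (fun x ↦ (X.flip.map g).app (op ⦋0⦌) x) h₁
    have e₀ := congrArg (fun x ↦ (X.flip.map g).app (op ⦋0⦌) x) h₀
    exact ⟨(ConcreteCategory.congr_hom
        ((X.flip.map g).naturality (SimplexCategory.δ 1).op) w).symm.trans (e₁.trans (key y)),
      (ConcreteCategory.congr_hom
        ((X.flip.map g).naturality (SimplexCategory.δ 0).op) w).symm.trans (e₀.trans (key z))⟩⟩
  map_id l := by
    ext w
    change (X.flip.map (𝟙 l)).app _ w.1 = w.1
    rw [CategoryTheory.Functor.map_id]; rfl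
  map_comp g h := by
    ext w
    change (X.flip.map (g ≫ h)).app _ w.1 = _
    rw [CategoryTheory.Functor.map_comp]; rfl

/-- A space is contractible: every sphere `∂Δ[n]` in it can be filled (for `n = 0`: it is
nonempty). It is applied to Kan complexes only. -/
def IsContractible (S : SSet.{u}) : Prop :=
  ∀ (n : ℕ) (φ : (∂Δ[n] : SSet.{u}) ⟶ S), ∃ ψ : Δ[n] ⟶ S, ∂Δ[n].ι ≫ ψ = φ

/-- Final objects. -/
def IsFinal (X : SimplicialSpace.{u}) (z : X.base _⦋0⦌) : Prop :=
  ∀ y : X.base _⦋0⦌, IsContractible (X.mappingSpace y z)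

/-- Initial objects. -/
def IsInitial (X : SimplicialSpace.{u}) (z : X.base _⦋0⦌) : Prop :=
  ∀ y : X.base _⦋0⦌, IsContractible (X.mappingSpace z y)

/-- The inclusion of `K` as `K × {e}` in `K × Δ[1]`, for `e = 0, 1`. -/
def endIncl (e : Fin 2) (K : SSet.{u}) : K ⟶ K ⊗ Δ[1] :=
  lift (𝟙 K) (SSet.const (SSet.stdSimplex.obj₀Equiv.symm e))

/-- A simplex of bidegree `(n, l)` of the simplicial space of cones over (`e = 1`) or cocones under
(`e = 0`) the diagram `f`: an `n`-simplex `apex` of `X.row l`, with a map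
`K × F(1) × F(n) → X.row l` that is `f` (independently of `F(n)`) on `K × {e}`
and `apex` (independently of `K`) on the other end. -/
@[ext]
structure ConeSimplex (X : SimplicialSpace.{u}) (e : Fin 2) {K : SSet.{u}} (f : K ⟶ X.base)
    (n l : SimplexCategoryᵒᵖ) : Type u where
  apex : SSet.stdSimplex.obj n.unop ⟶ X.row l
  homotopy : (K ⊗ Δ[1]) ⊗ SSet.stdSimplex.obj n.unop ⟶ X.row l
  at_diagram : endIncl e K ▷ _ ≫ homotopy = fst _ _ ≫ f ≫ X.baseTo l
  at_apex : endIncl (1 - e) K ▷ _ ≫ homotopy = snd _ _ ≫ apex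

/-- Action of the operators of the categorical direction. -/
def ConeSimplex.restrict {X : SimplicialSpace.{u}} {e : Fin 2} {K : SSet.{u}} {f : K ⟶ X.base}
    {n n' l : SimplexCategoryᵒᵖ} (g : n ⟶ n') (c : ConeSimplex X e f n l) :
    ConeSimplex X e f n' l where
  apex := SSet.stdSimplex.map g.unop ≫ c.apex
  homotopy := (_ ◁ SSet.stdSimplex.map g.unop) ≫ c.homotopy
  at_diagram := by
    rw [← whisker_exchange_assoc, c.at_diagram, whiskerLeft_fst_assoc]
  at_apex := by
    rw [← whisker_exchange_assoc, c.at_apex, whiskerLeft_snd_assoc]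

/-- Action of the operators of the space direction. -/
def ConeSimplex.push {X : SimplicialSpace.{u}} {e : Fin 2} {K : SSet.{u}} {f : K ⟶ X.base}
    {n l l' : SimplexCategoryᵒᵖ} (g : l ⟶ l') (c : ConeSimplex X e f n l) :
    ConeSimplex X e f n l' where
  apex := c.apex ≫ X.flip.map g
  homotopy := c.homotopy ≫ X.flip.map g
  at_diagram := by
    rw [← Category.assoc, c.at_diagram, Category.assoc, Category.assoc, baseTo, baseTo,
      ← fromZero_comp g, CategoryTheory.Functor.map_comp]
  at_apex := by
    rw [← Category.assoc, c.at_apex, Category.assoc]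

section

variable {X : SimplicialSpace.{u}} {e : Fin 2} {K : SSet.{u}} {f : K ⟶ X.base}

lemma ConeSimplex.restrict_id {n l : SimplexCategoryᵒᵖ} (c : ConeSimplex X e f n l) :
    c.restrict (𝟙 n) = c := by
  have h : SSet.stdSimplex.{u}.map (𝟙 n.unop) = 𝟙 _ :=
    CategoryTheory.Functor.map_id (C := SimplexCategory) (D := SSet.{u}) _ _
  apply ConeSimplex.ext
  · exact (congrArg (· ≫ c.apex) h).trans (Category.id_comp _)
  · refine (congrArg (fun t ↦ (_ ◁ t) ≫ c.homotopy) h).trans ?_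
    rw [whiskerLeft_id, Category.id_comp]

lemma ConeSimplex.restrict_comp {n n' n'' l : SimplexCategoryᵒᵖ} (g : n ⟶ n') (h : n' ⟶ n'')
    (c : ConeSimplex X e f n l) : c.restrict (g ≫ h) = (c.restrict g).restrict h := by
  have H : SSet.stdSimplex.{u}.map (h.unop ≫ g.unop) =
      SSet.stdSimplex.map h.unop ≫ SSet.stdSimplex.map g.unop :=
    CategoryTheory.Functor.map_comp (C := SimplexCategory) (D := SSet.{u}) _ _ _
  apply ConeSimplex.ext
  · exact (congrArg (· ≫ c.apex) H).trans (Category.assoc _ _ _)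
  · refine (congrArg (fun t ↦ (_ ◁ t) ≫ c.homotopy) H).trans ?_
    rw [whiskerLeft_comp, Category.assoc]
    rfl

end

/-- The simplicial space of cones over (`e = 1`) or cocones under (`e = 0`) the diagram `f`. For
`e = 1` it is `X ×_{X^K} X^{K × F(1)} ×_{X^K} {f}`, the over-category `X_{/f}`. -/
def coneSpace (X : SimplicialSpace.{u}) (e : Fin 2) {K : SSet.{u}} (f : K ⟶ X.base) :
    SimplicialSpace.{u} where
  obj n :=
    { obj := fun l ↦ ConeSimplex X e f n l
      map := fun g ↦ ↾(ConeSimplex.push g)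
      map_id := fun l ↦ by
        refine ConcreteCategory.hom_ext _ _ fun c ↦ ?_
        apply ConeSimplex.ext <;> simp [ConeSimplex.push]
      map_comp := fun g h ↦ by
        refine ConcreteCategory.hom_ext _ _ fun c ↦ ?_
        apply ConeSimplex.ext <;> simp [ConeSimplex.push] }
  map g :=
    { app := fun l ↦ ↾(ConeSimplex.restrict g)
      naturality := fun l l' h ↦ by
        refine ConcreteCategory.hom_ext _ _ fun c ↦ ?_
        apply ConeSimplex.ext <;> simp [ConeSimplex.push, ConeSimplex.restrict] }
  map_id _ := SSet.hom_ext fun _ ↦ ConcreteCategory.hom_ext _ _ ConeSimplex.restrict_id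
  map_comp g h := SSet.hom_ext fun _ ↦ ConcreteCategory.hom_ext _ _
    (ConeSimplex.restrict_comp g h)

/-- All finite diagrams have a limit. -/
def HasFiniteLimits (X : SimplicialSpace.{u}) : Prop :=
  ∀ (K : SSet.{u}) [K.Finite] (f : K ⟶ X.base), ∃ c, (X.coneSpace 1 f).IsFinal c

/-- All finite diagrams have a colimit. -/
def HasFiniteColimits (X : SimplicialSpace.{u}) : Prop :=
  ∀ (K : SSet.{u}) [K.Finite] (f : K ⟶ X.base), ∃ c, (X.coneSpace 0 f).IsInitial c

/-- The nerve of a small category, as a simplicial set in the universe `u`. -/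
abbrev N (J : Type) [SmallCategory J] : SSet.{u} := SSet.uliftFunctor.{u}.obj (nerve J)

/-- The nerve of a functor. -/
abbrev Nmap {J J' : Type} [SmallCategory J] [SmallCategory J'] (F : J ⥤ J') : N.{u} J ⟶ N J' :=
  SSet.uliftFunctor.{u}.map (nerveMap F)

/-- An object of `J` as a vertex of the nerve. -/
abbrev vertex {J : Type} [SmallCategory J] (j : J) : (N.{u} J) _⦋0⦌ :=
  ULift.up (ComposableArrows.mk₀ j)

/-- A map of `J` as an edge of the nerve. -/
abbrev arrow {J : Type} [SmallCategory J] {j j' : J} (g : j ⟶ j') : (N.{u} J) _⦋1⦌ :=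
  ULift.up (ComposableArrows.mk₁ g)

section Posets

variable (Q : Type) [PartialOrder Q]

/-- The poset `Q` without its least element. -/
abbrev NonBot [OrderBot Q] : Type := {q : Q // q ≠ ⊥}

/-- The poset `Q` without its greatest element. -/
abbrev NonTop [OrderTop Q] : Type := {q : Q // q ≠ ⊤}

/-- The inclusion of posets, on nerves. -/
abbrev subtypeIncl (P : Q → Prop) : N.{u} {q : Q // P q} ⟶ N Q :=
  Nmap (Subtype.mono_coe P).functor

/-- The canonical cone `N(Q \ {⊥}) × Δ[1] ⟶ N(Q)`, `(q, 0) ↦ ⊥`, `(q, 1) ↦ q`. -/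
def coneMap [OrderBot Q] : N.{u} (NonBot Q) ⊗ Δ[1] ⟶ N Q where
  app m := ↾fun x ↦ ULift.up (Monotone.functor
    (f := fun i ↦ if (SSet.stdSimplex.objEquiv x.2).toOrderHom i = 0 then (⊥ : Q)
      else (x.1.down.obj i).1) (by
        intro i j hij
        have h := (SSet.stdSimplex.objEquiv x.2).toOrderHom.monotone hij
        dsimp only
        split_ifs with h₁ h₂ h₂
        · exact le_rfl
        · exact bot_le
        · exact absurd (le_antisymm (h.trans h₂.le) (Fin.zero_le _)) h₁
        · exact leOfHom (x.1.down.map (homOfLE hij))))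
  naturality m m' g := by
    ext x
    exact congrArg ULift.up (CategoryTheory.Functor.ext (fun _ ↦ rfl) (fun _ _ _ ↦ Subsingleton.elim _ _))

/-- The canonical cocone `N(Q \ {⊤}) × Δ[1] ⟶ N(Q)`, `(q, 0) ↦ q`, `(q, 1) ↦ ⊤`. -/
def coconeMap [OrderTop Q] : N.{u} (NonTop Q) ⊗ Δ[1] ⟶ N Q where
  app m := ↾fun x ↦ ULift.up (Monotone.functor
    (f := fun i ↦ if (SSet.stdSimplex.objEquiv x.2).toOrderHom i = 0 then (x.1.down.obj i).1
      else (⊤ : Q)) (by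
        intro i j hij
        have h := (SSet.stdSimplex.objEquiv x.2).toOrderHom.monotone hij
        dsimp only
        split_ifs with h₁ h₂ h₂
        · exact leOfHom (x.1.down.map (homOfLE hij))
        · exact le_top
        · exact absurd (le_antisymm (h.trans h₂.le) (Fin.zero_le _)) h₁
        · exact le_rfl))
  naturality m m' g := by
    ext x
    exact congrArg ULift.up (CategoryTheory.Functor.ext (fun _ ↦ rfl) (fun _ _ _ ↦ Subsingleton.elim _ _))

lemma endIncl_one_coneMap [OrderBot Q] :
    endIncl 1 _ ≫ coneMap.{u} Q = subtypeIncl Q (· ≠ ⊥) := by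
  ext m x
  exact congrArg ULift.up (CategoryTheory.Functor.ext (fun _ ↦ rfl) (fun _ _ _ ↦ Subsingleton.elim _ _))

lemma endIncl_zero_coneMap [OrderBot Q] :
    endIncl 0 _ ≫ coneMap.{u} Q = SSet.const (vertex ⊥) := by
  ext m x
  exact congrArg ULift.up (CategoryTheory.Functor.ext (fun _ ↦ rfl) (fun _ _ _ ↦ Subsingleton.elim _ _))

lemma endIncl_zero_coconeMap [OrderTop Q] :
    endIncl 0 _ ≫ coconeMap.{u} Q = subtypeIncl Q (· ≠ ⊤) := by
  ext m x
  exact congrArg ULift.up (CategoryTheory.Functor.ext (fun _ ↦ rfl) (fun _ _ _ ↦ Subsingleton.elim _ _))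

lemma endIncl_one_coconeMap [OrderTop Q] :
    endIncl 1 _ ≫ coconeMap.{u} Q = SSet.const (vertex ⊤) := by
  ext m x
  exact congrArg ULift.up (CategoryTheory.Functor.ext (fun _ ↦ rfl) (fun _ _ _ ↦ Subsingleton.elim _ _))

lemma baseTo_zero (X : SimplicialSpace.{u}) : X.baseTo (op ⦋0⦌) = 𝟙 _ := by
  rw [baseTo, fromZero_zero, CategoryTheory.Functor.map_id]

variable {Q}

/-- A diagram `D` on `N(Q)`, where `Q` has a least element, regarded as a cone
over its restriction to `Q \ {⊥}`. -/
def coneOf (X : SimplicialSpace.{u}) [OrderBot Q] (D : N.{u} Q ⟶ X.base) :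
    (X.coneSpace 1 (subtypeIncl Q (· ≠ ⊥) ≫ D)).base _⦋0⦌ where
  apex := SSet.const (D.app _ (vertex ⊥))
  homotopy := fst _ _ ≫ coneMap Q ≫ D
  at_diagram := by
    rw [whiskerRight_fst_assoc, ← endIncl_one_coneMap]
    simp only [Category.assoc, baseTo_zero, Category.comp_id]
  at_apex := by
    rw [whiskerRight_fst_assoc, sub_self, ← Category.assoc (endIncl 0 _), endIncl_zero_coneMap,
      SSet.const_comp, SSet.comp_const, SSet.comp_const]

/-- A diagram `D` on `N(Q)`, where `Q` has a greatest element, regarded as a cocone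
under its restriction to `Q \ {⊤}`. -/
def coconeOf (X : SimplicialSpace.{u}) [OrderTop Q] (D : N.{u} Q ⟶ X.base) :
    (X.coneSpace 0 (subtypeIncl Q (· ≠ ⊤) ≫ D)).base _⦋0⦌ where
  apex := SSet.const (D.app _ (vertex ⊤))
  homotopy := fst _ _ ≫ coconeMap Q ≫ D
  at_diagram := by
    rw [whiskerRight_fst_assoc, ← endIncl_zero_coconeMap]
    simp only [Category.assoc, baseTo_zero, Category.comp_id]
  at_apex := by
    rw [whiskerRight_fst_assoc, sub_zero, ← Category.assoc (endIncl 1 _), endIncl_one_coconeMap,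
      SSet.const_comp, SSet.comp_const, SSet.comp_const]

/-- `D` is a limit cone over its restriction to `Q \ {⊥}`. -/
def IsLimitCone (X : SimplicialSpace.{u}) [OrderBot Q] (D : N.{u} Q ⟶ X.base) : Prop :=
  (X.coneSpace 1 (subtypeIncl Q (· ≠ ⊥) ≫ D)).IsFinal (X.coneOf D)

/-- `D` is a colimit cocone under its restriction to `Q \ {⊤}`. -/
def IsColimitCocone (X : SimplicialSpace.{u}) [OrderTop Q] (D : N.{u} Q ⟶ X.base) : Prop :=
  (X.coneSpace 0 (subtypeIncl Q (· ≠ ⊤) ≫ D)).IsInitial (X.coconeOf D)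

end Posets

/-- The shape of commutative squares, with the order of a product. -/
abbrev Square : Type := Fin 2 × Fin 2

/-- The nerve of a poset; for `Square` it is `F(1) × F(1)`. -/
abbrev posetN (Q : Type) [PartialOrder Q] : SSet.{u} := N Q

/-- The nerve of a monotone map. -/
abbrev posetNmap {P Q : Type} [PartialOrder P] [PartialOrder Q] (f : P →o Q) :
    posetN.{u} P ⟶ posetN Q :=
  Nmap f.monotone.functor

/-- A commutative square is a pullback square. -/
def IsPullbackSquare (X : SimplicialSpace.{u}) (S : posetN.{u} Square ⟶ X.base) : Prop :=
  X.IsLimitCone S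

/-- A commutative square is a pushout square. -/
def IsPushoutSquare (X : SimplicialSpace.{u}) (S : posetN.{u} Square ⟶ X.base) : Prop :=
  X.IsColimitCocone S

/-- Stable complete Segal spaces. -/
structure IsStable (X : SimplicialSpace.{u}) : Prop where
  completeSegalSpace : X.IsCompleteSegalSpace
  finiteLimits : X.HasFiniteLimits
  finiteColimits : X.HasFiniteColimits
  pointed : ∃ z, X.IsInitial z ∧ X.IsFinal z
  pullback_iff_pushout : ∀ S : posetN.{u} Square ⟶ X.base,
    X.IsPullbackSquare S ↔ X.IsPushoutSquare S

/-- A map `f : x → y`, as an object of the over-category `X_{/y}`. -/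
def overMk (X : SimplicialSpace.{u}) (f : X.base _⦋1⦌) :
    (X.coneSpace 1 (SSet.const (X.base.δ 0 f) : Δ[0] ⟶ X.base)).base _⦋0⦌ where
  apex := SSet.const (X.base.δ 1 f)
  homotopy := fst _ _ ≫ snd _ _ ≫ SSet.yonedaEquiv.symm f
  at_diagram := by
    rw [whiskerRight_fst_assoc, baseTo_zero, Category.comp_id, endIncl, lift_snd_assoc,
      SSet.const_comp]
    congr 2
    have h : SimplexCategory.const ⦋0⦌ ⦋1⦌ 1 = SimplexCategory.δ 0 := by ext k; fin_cases k; rfl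
    change X.base.map (SimplexCategory.const ⦋0⦌ ⦋1⦌ 1).op f = X.base.map (SimplexCategory.δ 0).op f
    rw [h]
  at_apex := by
    rw [whiskerRight_fst_assoc, sub_self, endIncl, lift_snd_assoc,
      SSet.const_comp, SSet.comp_const, SSet.comp_const]
    congr 1
    have h : SimplexCategory.const ⦋0⦌ ⦋1⦌ 0 = SimplexCategory.δ 1 := by ext k; fin_cases k; rfl
    change X.base.map (SimplexCategory.const ⦋0⦌ ⦋1⦌ 0).op f = X.base.map (SimplexCategory.δ 1).op f
    rw [h]

/-- The map `f : x → y` is `(-1)`-truncated: for every object `g : w → y` of the over-category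
`X_{/y}`, the space of maps from `g` to `f` over `y` is empty or contractible. -/
def IsNegOneTruncated (X : SimplicialSpace.{u}) (f : X.base _⦋1⦌) : Prop :=
  ∀ g : (X.coneSpace 1 (SSet.const (X.base.δ 0 f) : Δ[0] ⟶ X.base)).base _⦋0⦌,
    IsEmpty (((X.coneSpace 1 _).mappingSpace g (X.overMk f)) _⦋0⦌) ∨
      IsContractible ((X.coneSpace 1 _).mappingSpace g (X.overMk f))

/-- Simplicial objects of `X`: maps of simplicial spaces from the nerve of the opposite
simplex category to `X`. -/
abbrev SimplicialObj (X : SimplicialSpace.{u}) : Type u := N.{u} SimplexCategoryᵒᵖ ⟶ X.base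

namespace SimplicialObj

variable {X : SimplicialSpace.{u}}

/-- The map `W_m → W_n` of `X` induced by a map `θ : [n] → [m]` of the simplex category. -/
def structureMap (W : X.SimplicialObj) {n m : SimplexCategory} (θ : n ⟶ m) : X.base _⦋1⦌ :=
  W.app _ (arrow θ.op)

/-- The degeneracy `s_0 : W_0 → W_1`. -/
def s₀ (W : X.SimplicialObj) : X.base _⦋1⦌ :=
  W.structureMap (SimplexCategory.σ 0 : ⦋1⦌ ⟶ ⦋0⦌)

/-- `H` restricts to `V` at `0` and to `W` at `1`, and is an equivalence levelwise. -/
structure IsLevelwiseEquivalence (V W : X.SimplicialObj)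
    (H : N.{u} SimplexCategoryᵒᵖ ⊗ Δ[1] ⟶ X.base) : Prop where
  source : endIncl 0 _ ≫ H = V
  target : endIncl 1 _ ≫ H = W
  level : ∀ n : SimplexCategoryᵒᵖ,
    X.IsEquivalence (H.app _ ((arrow (𝟙 n), SSet.stdSimplex.objEquiv.symm (𝟙 _)) :
      (N.{u} SimplexCategoryᵒᵖ ⊗ Δ[1] : SSet.{u}) _⦋1⦌))

/-- `W` is trivial: it is equivalent to a constant simplicial object. -/
def IsTrivial (W : X.SimplicialObj) : Prop :=
  ∃ (x : X.base _⦋0⦌) (H : N.{u} SimplexCategoryᵒᵖ ⊗ Δ[1] ⟶ X.base),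
    IsLevelwiseEquivalence (SSet.const x) W H

end SimplicialObj

/-- The category `cg(n)`: its objects are the pairs `(i, j)` with `i ≤ j ≤ i + 1`, except `(0, 0)`
and `(n, n)`, and the cone point `(0, n)`. They stand for intervals of `[n]`, ordered by reverse
inclusion. -/
structure ConeG (n : ℕ) where
  fst : Fin (n + 1)
  snd : Fin (n + 1)
  mem : (fst = 0 ∧ snd = Fin.last n) ∨
    ((fst : ℕ) ≤ snd ∧ (snd : ℕ) ≤ fst + 1 ∧ ¬ (snd : ℕ) = 0 ∧ ¬ (fst : ℕ) = n)

namespace ConeG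

variable {n : ℕ}

lemma fst_le_snd (p : ConeG n) : (p.fst : ℕ) ≤ p.snd := by
  obtain ⟨i, j, ⟨rfl, rfl⟩ | h⟩ := p
  · simp
  · exact h.1

instance : PartialOrder (ConeG n) where
  le p q := p.fst ≤ q.fst ∧ q.snd ≤ p.snd
  le_refl _ := ⟨le_rfl, le_rfl⟩
  le_trans p q r h h' := ⟨h.1.trans h'.1, h'.2.trans h.2⟩
  le_antisymm p q h h' := by
    obtain ⟨i, j, _⟩ := p
    obtain ⟨i', j', _⟩ := q
    obtain rfl : i = i' := le_antisymm h.1 h'.1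
    obtain rfl : j = j' := le_antisymm h'.2 h.2
    rfl

lemma le_def (p q : ConeG n) : p ≤ q ↔ p.fst ≤ q.fst ∧ q.snd ≤ p.snd := Iff.rfl

instance : OrderBot (ConeG n) where
  bot := ⟨0, Fin.last n, Or.inl ⟨rfl, rfl⟩⟩
  bot_le p := ⟨Fin.zero_le _, Fin.le_last _⟩

/-- The inclusion of the interval `q` in the interval `p`, for `p ≤ q`, where the interval `(i, j)`
is identified with `[j - i]`. -/
def incl {p q : ConeG n} (h : p ≤ q) :
    ⦋(q.snd : ℕ) - q.fst⦌ ⟶ ⦋(p.snd : ℕ) - p.fst⦌ :=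
  SimplexCategory.mkHom
    { toFun := fun k ↦ ⟨k + (q.fst - p.fst), by
        have h₁ : (p.fst : ℕ) ≤ q.fst := h.1
        have h₂ : (q.snd : ℕ) ≤ p.snd := h.2
        have := q.fst_le_snd
        have := k.2
        omega⟩
      monotone' := fun k k' hk ↦ by
        have : (k : ℕ) ≤ k' := hk
        exact Fin.mk_le_mk.2 (by omega) }

/-- The diagram shape of the Segal condition: intervals in `[n]`, as objects of the opposite
simplex category. -/
def toSimplexOp (n : ℕ) : ConeG n ⥤ SimplexCategoryᵒᵖ where
  obj p := Opposite.op ⦋(p.snd : ℕ) - p.fst⦌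
  map f := (incl (leOfHom f)).op
  map_id _ := by
    refine Quiver.Hom.unop_inj (SimplexCategory.Hom.ext _ _ (OrderHom.ext _ _
      (funext fun k ↦ Fin.ext ?_)))
    simp [incl]
  map_comp {p q r} f g := by
    refine Quiver.Hom.unop_inj ?_
    have h₁ : (p.fst : ℕ) ≤ q.fst := (leOfHom f).1
    have h₂ : (q.fst : ℕ) ≤ r.fst := (leOfHom g).1
    refine SimplexCategory.Hom.ext _ _ (OrderHom.ext _ _ (funext fun k ↦ Fin.ext ?_))
    change (k : ℕ) + (r.fst - p.fst) = k + (r.fst - q.fst) + (q.fst - p.fst)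
    omega

end ConeG

namespace EquivShape

/-- The map `[dim q] → [dim p]`, for `p ≤ q`. -/
def vertexMap (p q : EquivShape) (i : Fin (dim q + 1)) : Fin (dim p + 1) := ofThree p (toThree q i)

lemma vertexMap_monotone : ∀ p q : EquivShape, p ≤ q → Monotone (vertexMap p q) := by
  decide

lemma vertexMap_self : ∀ q : EquivShape, ∀ i, vertexMap q q i = i := by
  decide

lemma vertexMap_comp : ∀ p q r : EquivShape, p ≤ q → q ≤ r → q ≠ hoequiv ∧ q ≠ Z₃ →
    ∀ i, vertexMap p q (vertexMap q r i) = vertexMap p r i := by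
  decide

/-- The diagram shape on `Core`, as a diagram in the opposite simplex category: for a simplicial
object `T` it gives the maps `(d_1 d_3, d_0 d_3, d_1 d_0)` from `T_3` and `(s_0 d_0, id, s_0 d_1)`
from `T_1` to the zigzag `T_1 → T_0 ← T_1 → T_0 ← T_1`, the maps of which are `t, t, s, s`, and the
degeneracies from `T_0`. -/
def coreToSimplexOp : Core ⥤ SimplexCategoryᵒᵖ where
  obj q := op ⦋dim q.1⦌
  map {p q} f := (SimplexCategory.mkHom ⟨vertexMap p.1 q.1, vertexMap_monotone _ _ (leOfHom f)⟩).op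
  map_id q := by
    refine Quiver.Hom.unop_inj (SimplexCategory.Hom.ext _ _ (OrderHom.ext _ _ (funext fun i ↦ ?_)))
    exact vertexMap_self q.1 i
  map_comp {p q r} f g := by
    refine Quiver.Hom.unop_inj (SimplexCategory.Hom.ext _ _ (OrderHom.ext _ _ (funext fun i ↦ ?_)))
    exact (vertexMap_comp p.1 q.1 r.1 (leOfHom f) (leOfHom g) q.2 i).symm

/-- The square with corners `T_hoequiv`, `T_3`, `T_1` and `Z(3)`. -/
def square : Square →o EquivShape where
  toFun
    | (0, 0) => hoequiv
    | (1, 0) => T₃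
    | (0, 1) => T₁
    | (1, 1) => Z₃
  monotone' := by decide

end EquivShape

namespace SimplicialObj

variable {X : SimplicialSpace.{u}}

/-- Segal objects: `W_n` is the limit `W_1 ×_{W_0} ⋯ ×_{W_0} W_1` for `n ≥ 2`. -/
def IsSegalObject (W : X.SimplicialObj) : Prop :=
  ∀ n : ℕ, 2 ≤ n → X.IsLimitCone (Nmap (ConeG.toSimplexOp n) ≫ W)

/-- A diagram `G` that exhibits the object of equivalences of `W`: it extends the diagram given by
`W` by a limit `Z(3)` of the zigzag `W_1 → W_0 ← W_1 → W_0 ← W_1` and by a pullback `W_hoequiv`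
of `W_1 → Z(3) ← W_3`. (It contains the induced map `s_0 : W_0 → W_hoequiv`.) -/
structure IsEquivalencesDiagram (W : X.SimplicialObj) (G : posetN.{u} EquivShape ⟶ X.base) :
    Prop where
  core : subtypeIncl EquivShape _ ≫ G = Nmap EquivShape.coreToSimplexOp ≫ W
  limit : X.IsLimitCone (subtypeIncl EquivShape (· ∈ Set.Ici EquivShape.Z₃) ≫ G)
  pullback : X.IsPullbackSquare (posetNmap EquivShape.square ≫ G)

/-- Complete Segal objects: Segal objects such that `s_0 : W_0 → W_hoequiv` is an equivalence.
(If `X` has finite limits, a diagram exhibiting `W_hoequiv` exists and is essentially unique.) -/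
def IsCompleteSegalObject (W : X.SimplicialObj) : Prop :=
  W.IsSegalObject ∧ ∃ G : posetN.{u} EquivShape ⟶ X.base, W.IsEquivalencesDiagram G ∧
    X.IsEquivalence (G.app _ (arrow (homOfLE
      (by decide : EquivShape.W₀ ≤ EquivShape.hoequiv))))

end SimplicialObj

end

end SimplicialSpace

namespace SimplicialSpace

/-! ### Gluing maps of simplicial sets, and lifting properties -/

noncomputable section

open CategoryTheory Simplicial Opposite MonoidalCategory CartesianMonoidalCategory

/-! Everything is expressed through cones. For a diagram `D` on a poset and subsets `R' ⊆ R`,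
`TrivOn 1 D R R'` means that for every apex the restriction of cones from `R` to `R'` is a trivial
fibration; `TrivOn 0` is the same for cocones. Such statements compose and cancel, satisfy excision
(`trivOn_sup`), and hold whenever `R` deforms into `R'`, downwards for cones and upwards for cocones
(`trivOn_of_isDeformation`). Limit cones and colimit cocones have this form (`isLimitCone_iff`,
`isColimitCocone_iff`), and so has the condition `EquivTriv` that a map induces equivalences on maps
into it or out of it. Arguments about limits thus become finite combinatorics of posets. The
homotopical input is that a Reedy fibrant Segal space is local for inner anodyne maps, and that an
outer horn with a degenerate edge can be filled as well.

Let `f : x → y` be (-1)-truncated. The square with corners `x, x, x, y` whose maps are identities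
and two copies of `f` is a pullback (`IsNegOneTruncated.isPullback`), so by stability it is a
pushout. A cobase change of an identity is an equivalence, so `f` is one as seen by maps out of it.
Then the square with `x` in the initial corner and `y` in the others is a pushout, hence a pullback,
and `f`, as a base change of an identity, is an equivalence as seen by maps into it
(`EquivTriv.equivTriv_one`). One-sided inverses on both sides follow.

Let `W` be a Segal object. The square from `W_1` to `W_2` and from `W_0` to `W_1` given by
degeneracies, over the last edge of `[2]`, is a base change of the Segal square, so it is a pullback
and a pushout. Pasting it with the faces that retract these degeneracies gives that an outer Segal
square is a pushout, hence a pullback (`SegalShape.pasting`): in a stable setting, every Segal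
object is a groupoid object. It follows that `W_3` is the limit of the zigzag that defines `Z(3)`
(`finTriv_zigzag`), so that `W_3 → Z(3)` and its base change `W_hoequiv → W_1` are equivalences.
Completeness then makes `s_0` an equivalence, the Segal condition propagates this to all
degeneracies `W_0 → W_n`, and these form a levelwise equivalence from a constant simplicial object
to `W`. -/

lemma app_congr {S T : SSet.{u}} {f g : S ⟶ T} (h : f = g) {n : SimplexCategoryᵒᵖ} (x : S.obj n) :
    f.app n x = g.app n x := by rw [h]

lemma ext_app {S T : SSet.{u}} {f g : S ⟶ T} (h : ∀ n (x : S.obj n), f.app n x = g.app n x) :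
    f = g :=
  SSet.hom_ext fun n ↦ ConcreteCategory.hom_ext _ _ (h n)

lemma app_map {S T : SSet.{u}} (f : S ⟶ T) {n m : SimplexCategoryᵒᵖ} (g : n ⟶ m) (x : S.obj n) :
    f.app m (S.map g x) = T.map g (f.app n x) :=
  ConcreteCategory.congr_hom (f.naturality g) x

section Glue
variable {ι : Type} {A : ι → SSet.{u}} {B Y : SSet.{u}} (i : ∀ s, A s ⟶ B) (h : ∀ s, A s ⟶ Y)

/-- The union of the images of a family of maps. -/
def unionRange : B.Subcomplex := ⨆ s, SSet.Subcomplex.range (i s)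

lemma mem_unionRange {n} (x : B.obj n) : x ∈ (unionRange i).obj n ↔ ∃ s a, (i s).app n a = x := by
  simp [unionRange]

/-- The maps `h s` are compatible, so that they define a map on the union of the images. -/
def Compatible : Prop := ∀ s t n (a : (A s).obj n) (b : (A t).obj n),
  (i s).app n a = (i t).app n b → (h s).app n a = (h t).app n b

/-- The factorization through the union of the images. -/
def toUnion (s : ι) : A s ⟶ (unionRange i : SSet) :=
  SSet.Subcomplex.lift (i s) (le_iSup (fun s ↦ SSet.Subcomplex.range (i s)) s)

lemma toUnion_ι (s : ι) : toUnion i s ≫ (unionRange i).ι = i s := rfl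

lemma unionRange_hom_ext {f g : (unionRange i : SSet) ⟶ Y}
    (H : ∀ s, toUnion i s ≫ f = toUnion i s ≫ g) : f = g := by
  refine ext_app fun n ⟨x, hx⟩ ↦ ?_
  obtain ⟨s, a, rfl⟩ := (mem_unionRange i x).1 hx
  exact app_congr (H s) a

variable {i h}

/-- The map on the union of the images. -/
def glue (H : Compatible i h) : (unionRange i : SSet) ⟶ Y where
  app n := ↾fun x ↦ (h ((mem_unionRange i x.1).1 x.2).choose).app n
    ((mem_unionRange i x.1).1 x.2).choose_spec.choose
  naturality n m g := by
    refine ConcreteCategory.hom_ext _ _ fun x ↦ ?_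
    have hx := (mem_unionRange i x.1).1 x.2
    have hy := (mem_unionRange i _).1 ((unionRange i : SSet).map g x).2
    refine (H _ hx.choose m hy.choose_spec.choose ((A _).map g hx.choose_spec.choose) ?_).trans
      (ConcreteCategory.congr_hom ((h hx.choose).naturality g) hx.choose_spec.choose)
    refine hy.choose_spec.choose_spec.trans ?_
    refine (congrArg (B.map g) hx.choose_spec.choose_spec.symm).trans ?_
    exact (ConcreteCategory.congr_hom ((i hx.choose).naturality g) _).symm

lemma toUnion_glue (H : Compatible i h) (s : ι) : toUnion i s ≫ glue H = h s := by
  refine SSet.hom_ext fun n ↦ ConcreteCategory.hom_ext _ _ fun a ↦ ?_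
  have hx := (mem_unionRange i _).1 ((toUnion i s).app n a).2
  exact H _ s n hx.choose_spec.choose a hx.choose_spec.choose_spec

end Glue

/-- Kan fibrations. -/
abbrev KanFib {S T : SSet.{u}} (p : S ⟶ T) : Prop := SSet.modelCategoryQuillen.J.rlp p
/-- Trivial Kan fibrations. -/
abbrev TrivFib {S T : SSet.{u}} (p : S ⟶ T) : Prop := SSet.modelCategoryQuillen.I.rlp p

lemma exists_lift_of {A B S T : SSet.{u}} (i : A ⟶ B) (p : S ⟶ T) [HasLiftingProperty i p]
    {f : A ⟶ S} {g : B ⟶ T} (w : f ≫ p = i ≫ g) : ∃ l : B ⟶ S, i ≫ l = f ∧ l ≫ p = g :=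
  ⟨(CommSq.mk w).lift, (CommSq.mk w).fac_left, (CommSq.mk w).fac_right⟩

/-- Boundary inclusions generate all monomorphisms, so that lifting against the former gives lifting
against the latter. -/
lemma TrivFib.hasLift {S T : SSet.{u}} {p : S ⟶ T} (hp : TrivFib p) {A B : SSet.{u}} (i : A ⟶ B)
    [Mono i] : HasLiftingProperty i p := by
  have : (MorphismProperty.monomorphisms SSet.{u}).rlp p := by
    rw [SSet.rlp_monomorphisms]; exact hp
  exact this i (MorphismProperty.monomorphisms.infer_property i)

lemma TrivFib.lift {S T : SSet.{u}} {p : S ⟶ T} (hp : TrivFib p) {A B : SSet.{u}} (i : A ⟶ B)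
    [Mono i] {f : A ⟶ S} {g : B ⟶ T} (w : f ≫ p = i ≫ g) :
    ∃ l : B ⟶ S, i ≫ l = f ∧ l ≫ p = g :=
  have := hp.hasLift i; exists_lift_of i p w

lemma KanFib.lift {S T : SSet.{u}} {p : S ⟶ T} (hp : KanFib p) {A B : SSet.{u}} {i : A ⟶ B}
    (hi : SSet.anodyneExtensions i) {f : A ⟶ S} {g : B ⟶ T} (w : f ≫ p = i ≫ g) :
    ∃ l : B ⟶ S, i ≫ l = f ∧ l ≫ p = g :=
  have : HasLiftingProperty i p := hi _ hp
  exists_lift_of i p w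

lemma trivFib_iff {S T : SSet.{u}} {p : S ⟶ T} :
    TrivFib p ↔ ∀ n : ℕ, HasLiftingProperty (∂Δ[n].ι) p := by
  constructor
  · intro hp n; exact hp.hasLift _
  · rintro h _ _ _ ⟨n⟩; exact h n

lemma TrivFib.kanFib {S T : SSet.{u}} {p : S ⟶ T} (hp : TrivFib p) : KanFib p := by
  intro A B i hi
  have : Mono i := by
    simp only [SSet.modelCategoryQuillen.J, MorphismProperty.iSup_iff] at hi
    obtain ⟨m, ⟨k⟩⟩ := hi
    infer_instance
  exact hp.hasLift i

/-- Extension problems are posed on pieces: a compatible family is one map on the union of the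
images, so only the inclusion of that union has to be understood. -/
lemma unionRange_lift {ι : Type} {A : ι → SSet.{u}} {B S T : SSet.{u}} {i : ∀ s, A s ⟶ B}
    {h : ∀ s, A s ⟶ S} (H : Compatible i h) {p : S ⟶ T}
    (hp : HasLiftingProperty (unionRange i).ι p) (g : B ⟶ T) (w : ∀ s, h s ≫ p = i s ≫ g) :
    ∃ l : B ⟶ S, (∀ s, i s ≫ l = h s) ∧ l ≫ p = g := by
  obtain ⟨l, hl, hl'⟩ := exists_lift_of (unionRange i).ι p (f := glue H) (g := g)
    (unionRange_hom_ext i fun s ↦ by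
      rw [← Category.assoc, toUnion_glue, w, ← Category.assoc, toUnion_ι])
  refine ⟨l, fun s ↦ ?_, hl'⟩
  rw [← toUnion_ι i s, Category.assoc, hl, toUnion_glue]

lemma endIncl_fst (e : Fin 2) (K : SSet.{u}) : endIncl e K ≫ fst _ _ = 𝟙 K := lift_fst _ _

instance (e : Fin 2) (K : SSet.{u}) : Mono (endIncl e K) :=
  mono_of_mono_fac (endIncl_fst e K)

lemma endIncl_natural (e : Fin 2) {K L : SSet.{u}} (f : K ⟶ L) :
    f ≫ endIncl e L = endIncl e K ≫ f ▷ _ := by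
  rfl

/-- The sources of `cylFamily`. -/
def cylSource (A B : SSet.{u}) : Bool → SSet.{u} := fun s ↦ match s with
  | true => A ⊗ Δ[1]
  | false => B

/-- The cylinder `A × Δ[1]` and an end of the cylinder `B × Δ[1]`. -/
def cylFamily (ε : Fin 2) {A B : SSet.{u}} (i : A ⟶ B) (s : Bool) :
    cylSource A B s ⟶ B ⊗ Δ[1] := match s with
  | true => i ▷ Δ[1]
  | false => endIncl ε B

/-- The only face in this horn is the one opposite to `1 - ε`, which is the vertex `ε` itself. -/
lemma mem_horn_one (ε : Fin 2) {n} (t : (Δ[1] : SSet.{u}).obj n) :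
    t ∈ (Λ[1, ε] : (Δ[1] : SSet.{u}).Subcomplex).obj n ↔ t = SSet.stdSimplex.const 1 ε n := by
  induction n using Opposite.rec with | op n =>
  induction n using SimplexCategory.rec with | _ n =>
  rw [SSet.mem_horn_iff_notMem_range]
  constructor
  · rintro ⟨j, hj, h⟩
    refine SSet.stdSimplex.ext _ _ fun k ↦ ?_
    have : t k ≠ j := fun h' ↦ h ⟨k, h'⟩
    change t k = ε
    generalize t k = a at this
    omega
  · rintro rfl
    refine ⟨1 - ε, by fin_cases ε <;> decide, ?_⟩
    rintro ⟨k, hk⟩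
    have : ε = 1 - ε := hk
    revert this; fin_cases ε <;> decide

/-- The union is the pushout product of the image of `i` with the one-vertex horn of `Δ[1]`, and
pushout products with anodyne maps are anodyne. -/
lemma anodyne_cylFamily (ε : Fin 2) {A B : SSet.{u}} (i : A ⟶ B) :
    SSet.anodyneExtensions (unionRange (cylFamily ε i)).ι := by
  have : unionRange (cylFamily ε i) = (SSet.Subcomplex.range i).unionProd Λ[1, ε] := by
    ext n ⟨x, t⟩
    refine (mem_unionRange (cylFamily ε i) _).trans
      (Iff.trans ?_ (SSet.Subcomplex.mem_unionProd_iff _ _ _).symm)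
    rw [mem_horn_one]
    constructor
    · rintro ⟨_ | _, a, h⟩
      · exact Or.inl (congrArg Prod.snd h).symm
      · exact Or.inr ⟨a.1, congrArg Prod.fst h⟩
    · rintro (h | ⟨a, h⟩)
      · exact ⟨false, x, Prod.ext rfl h.symm⟩
      · exact ⟨true, (a, t), Prod.ext h rfl⟩
  rw [this]
  exact SSet.anodyneExtensions_unionProd_ι _ _ (.horn_ι ε)

/-- This is the relative homotopy lifting property, starting at the end `ε`; injectivity of `i`
makes the data on `A × Δ[1]` and on the end compatible. -/
lemma KanFib.lift_cyl {S T : SSet.{u}} {p : S ⟶ T} (hp : KanFib p) (ε : Fin 2) {A B : SSet.{u}}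
    (i : A ⟶ B) [Mono i] {h : A ⊗ Δ[1] ⟶ S} {f : B ⟶ S} {g : B ⊗ Δ[1] ⟶ T}
    (w : endIncl ε A ≫ h = i ≫ f) (wh : h ≫ p = i ▷ _ ≫ g) (wf : f ≫ p = endIncl ε B ≫ g) :
    ∃ H : B ⊗ Δ[1] ⟶ S, i ▷ _ ≫ H = h ∧ endIncl ε B ≫ H = f ∧ H ≫ p = g := by
  let k : ∀ s : Bool, cylSource A B s ⟶ S := fun s ↦ match s with
    | true => h
    | false => f
  have inj : ∀ n, Function.Injective (i.app n) := fun n ↦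
    (mono_iff_injective _).1 inferInstance
  have key : ∀ n (a : (A ⊗ Δ[1] : SSet.{u}).obj n) (b : B.obj n),
      (i ▷ Δ[1]).app n a = (endIncl ε B).app n b → h.app n a = f.app n b := by
    rintro n ⟨a, t⟩ b hab
    have h1 : i.app n a = b := congrArg Prod.fst hab
    have h2 : t = SSet.stdSimplex.const 1 ε n := congrArg Prod.snd hab
    subst h1 h2
    exact app_congr w a
  obtain ⟨H, h1, h2⟩ := unionRange_lift (i := cylFamily ε i) (h := k) (p := p) (g := g) (by
      rintro (_ | _) (_ | _) n a b hab
      · have : a = b := congrArg Prod.fst hab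
        subst this; rfl
      · exact (key n b a hab.symm).symm
      · exact key n a b hab
      · congr 1
        exact Prod.ext (inj _ (congrArg Prod.fst hab)) (congrArg Prod.snd hab :))
    (anodyne_cylFamily ε i _ hp) (by rintro (_ | _); exacts [wf, wh])
  exact ⟨H, h1 true, h1 false, h2⟩

end

/-! ### Kan complexes and the naive homotopy category -/

noncomputable section

open CategoryTheory Simplicial Opposite MonoidalCategory CartesianMonoidalCategory

/-- Some of the faces of `S × Δ[n + 1]`. -/
abbrev faceFamily {n : ℕ} (P : Fin (n + 2) → Prop) (S : SSet.{u}) (s : {s // P s}) :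
    S ⊗ Δ[n] ⟶ S ⊗ Δ[n + 1] := S ◁ SSet.stdSimplex.δ s.1

lemma δ_app_apply {n m : ℕ} (i : Fin (n + 2)) (a : (Δ[n] : SSet.{u}) _⦋m⦌) (k : Fin (m + 1)) :
    ((SSet.stdSimplex.δ i).app (op ⦋m⦌) a : (Δ[n + 1] : SSet.{u}) _⦋m⦌) k = i.succAbove (a k) := rfl

lemma mem_range_δ {n : ℕ} (i : Fin (n + 2)) {m : ℕ} (t : (Δ[n + 1] : SSet.{u}) _⦋m⦌) :
    (∃ a, (SSet.stdSimplex.δ i).app _ a = t) ↔ i ∉ Set.range t := by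
  have : t ∈ (SSet.Subcomplex.range (SSet.stdSimplex.δ i)).obj _ ↔
      t ∈ (SSet.stdSimplex.face {i}ᶜ).obj _ := by
    rw [SSet.stdSimplex.range_δ]
  refine this.trans ((SSet.stdSimplex.mem_face_iff _ _).trans ?_)
  simp

/-- The empty subcomplex of `S` turns the pushout product into `S × Λ[n + 1, k]`, so that results on
pushout products with horns apply. -/
lemma unionRange_faceFamily {n : ℕ} (k : Fin (n + 2)) (S : SSet.{u}) :
    unionRange (faceFamily (· ≠ k) S) = (⊥ : S.Subcomplex).unionProd Λ[n + 1, k] := by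
  ext m ⟨x, t⟩
  induction m using Opposite.rec with | op m =>
  induction m using SimplexCategory.rec with | _ m =>
  refine (mem_unionRange _ _).trans
    (Iff.trans ?_ (SSet.Subcomplex.mem_unionProd_iff _ _ _).symm)
  rw [SSet.mem_horn_iff_notMem_range]
  constructor
  · rintro ⟨⟨s, hs⟩, a, h⟩
    exact Or.inl ⟨s, hs, (mem_range_δ s t).1 ⟨a.2, congrArg Prod.snd h⟩⟩
  · rintro (⟨s, hs, h⟩ | h)
    · obtain ⟨a, ha⟩ := (mem_range_δ s t).2 h
      exact ⟨⟨s, hs⟩, (x, a), Prod.ext rfl ha⟩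
    · exact h.elim

/-- Two different edges of a triangle share exactly one vertex, so a simplex in both is constant
there. -/
lemma face_overlap {i j : Fin 3} (hij : i ≠ j) {n} {a b : (Δ[1] : SSet.{u}).obj n}
    (h : (SSet.stdSimplex.δ i).app n a = (SSet.stdSimplex.δ j).app n b) :
    ∃ x y : Fin 2, i.succAbove x = j.succAbove y ∧ a = SSet.stdSimplex.const 1 x n ∧
      b = SSet.stdSimplex.const 1 y n := by
  induction n using Opposite.rec with | op n =>
  induction n using SimplexCategory.rec with | _ n =>
  have key : ∀ k, i.succAbove (a k) = j.succAbove (b k) := fun k ↦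
    congrArg (fun t : (Δ[2] : SSet.{u}) _⦋n⦌ ↦ t k) h
  have aux : ∀ i j : Fin 3, i ≠ j → ∀ x y x' y' : Fin 2, i.succAbove x = j.succAbove y →
      i.succAbove x' = j.succAbove y' → x = x' ∧ y = y' := by decide
  exact ⟨a 0, b 0, key 0, SSet.stdSimplex.ext _ _ fun k ↦ (aux i j hij _ _ _ _ (key k) (key 0)).1,
    SSet.stdSimplex.ext _ _ fun k ↦ (aux i j hij _ _ _ _ (key k) (key 0)).2⟩

instance mono_δ {n : ℕ} (i : Fin (n + 2)) : Mono (SSet.stdSimplex.{u}.δ i) := by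
  refine @NatTrans.mono_of_mono_app _ _ _ _ _ _ _ fun m ↦ ?_
  rw [mono_iff_injective]
  induction m using Opposite.rec with | op m =>
  induction m using SimplexCategory.rec with | _ m =>
  intro a b h
  exact SSet.stdSimplex.ext _ _ fun k ↦ Fin.succAbove_right_injective
    (congrArg (fun t : (Δ[n + 1] : SSet.{u}) _⦋m⦌ ↦ t k) h)

lemma app_injective {S T : SSet.{u}} (i : S ⟶ T) [Mono i] (n) : Function.Injective (i.app n) :=
  (mono_iff_injective _).1 inferInstance

/-- By `face_overlap`, faces of a prism need to be compared only over common vertices. -/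
lemma compatible_faceFamily {P : Fin 3 → Prop} {S Y : SSet.{u}} (h : {s // P s} → (S ⊗ Δ[1] ⟶ Y))
    (w : ∀ s t : {s // P s}, s.1 ≠ t.1 → ∀ x y : Fin 2, s.1.succAbove x = t.1.succAbove y →
      endIncl x S ≫ h s = endIncl y S ≫ h t) : Compatible (faceFamily P S) h := by
  rintro s t _ ⟨a, a'⟩ ⟨b, b'⟩ hab
  have h1 : a = b := congrArg Prod.fst hab
  have h2 : (SSet.stdSimplex.δ s.1).app _ a' = (SSet.stdSimplex.δ t.1).app _ b' :=
    congrArg Prod.snd hab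
  subst h1
  by_cases hst : s = t
  · subst hst
    rw [app_injective _ _ h2]
  · obtain ⟨x, y, hxy, rfl, rfl⟩ := face_overlap (fun h ↦ hst (Subtype.ext h)) h2
    exact app_congr (w s t (fun h ↦ hst (Subtype.ext h)) x y hxy) a

lemma endIncl_whiskerLeft_δ (S : SSet.{u}) (x : Fin 2) (i : Fin 3) :
    endIncl x S ≫ S ◁ SSet.stdSimplex.δ i = lift (𝟙 S)
      (SSet.const (SSet.stdSimplex.obj₀Equiv.symm (i.succAbove x))) := by
  exact ext_app fun _ _ ↦ Prod.ext rfl rfl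

/-- Kan complexes. -/
def Kan (T : SSet.{u}) : Prop :=
  ∀ ⦃A B : SSet.{u}⦄ ⦃i : A ⟶ B⦄, SSet.anodyneExtensions i → ∀ f : A ⟶ T, ∃ g, i ≫ g = f

lemma KanFib.kan {S T : SSet.{u}} {p : S ⟶ T} (hp : KanFib p) (hT : Kan T) : Kan S := by
  intro A B i hi f
  obtain ⟨g, hg⟩ := hT hi (f ≫ p)
  obtain ⟨l, hl, -⟩ := hp.lift hi hg.symm
  exact ⟨l, hl⟩

/-- The homotopy relation. -/
def Homotopic {S T : SSet.{u}} (f g : S ⟶ T) : Prop :=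
  ∃ h : S ⊗ Δ[1] ⟶ T, endIncl 0 S ≫ h = f ∧ endIncl 1 S ≫ h = g

lemma Homotopic.refl {S T : SSet.{u}} (f : S ⟶ T) : Homotopic f f :=
  ⟨fst _ _ ≫ f, rfl, rfl⟩

/-- Both homotopies start at `f` and form a horn `Λ[2, 0]`, the filler of which has a homotopy from
`g` to `k` as its new face. This form yields symmetry and transitivity at once. -/
lemma Homotopic.trans' {S T : SSet.{u}} (hT : Kan T) {f g k : S ⟶ T} :
    Homotopic f g → Homotopic f k → Homotopic g k := by
  rintro ⟨h, rfl, rfl⟩ ⟨h', w, rfl⟩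
  have C := compatible_faceFamily (P := (· ≠ (0 : Fin 3))) (S := S)
    (fun s ↦ if s.1 = 1 then h' else h) (by
      have aux : ∀ s t : {s // s ≠ (0 : Fin 3)}, s.1 ≠ t.1 → ∀ x y : Fin 2,
        s.1.succAbove x = t.1.succAbove y → x = 0 ∧ y = 0 := by decide
      intro s t hst x y hxy
      obtain ⟨rfl, rfl⟩ := aux s t hst x y hxy
      by_cases h1 : s.1 = 1 <;> by_cases h2 : t.1 = 1
      · rw [if_pos h1, if_pos h2]
      · rw [if_pos h1, if_neg h2, w]
      · rw [if_neg h1, if_pos h2, w]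
      · rw [if_neg h1, if_neg h2])
  obtain ⟨H, hH⟩ := hT (i := (unionRange (faceFamily (· ≠ (0 : Fin 3)) S)).ι) (by
    rw [unionRange_faceFamily]
    exact SSet.anodyneExtensions_unionProd_ι _ _ (.horn_ι _)) (glue C)
  have H' : ∀ s : {s // s ≠ (0 : Fin 3)}, S ◁ SSet.stdSimplex.δ s.1 ≫ H =
      if s.1 = 1 then h' else h := fun s ↦
    (congrArg (toUnion _ s ≫ ·) hH).trans (toUnion_glue C s)
  have e1 : S ◁ SSet.stdSimplex.δ 1 ≫ H = h' := (H' ⟨1, by decide⟩).trans (if_pos rfl)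
  have e2 : S ◁ SSet.stdSimplex.δ 2 ≫ H = h := (H' ⟨2, by decide⟩).trans (if_neg (by decide))
  refine ⟨S ◁ SSet.stdSimplex.δ 0 ≫ H, ?_, ?_⟩
  · rw [← e2, ← Category.assoc, ← Category.assoc, endIncl_whiskerLeft_δ, endIncl_whiskerLeft_δ]
    rfl
  · rw [← e1, ← Category.assoc, ← Category.assoc, endIncl_whiskerLeft_δ, endIncl_whiskerLeft_δ]
    rfl

lemma Homotopic.symm {S T : SSet.{u}} (hT : Kan T) {f g : S ⟶ T} (h : Homotopic f g) :
    Homotopic g f := h.trans' hT (.refl f)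

lemma Homotopic.trans {S T : SSet.{u}} (hT : Kan T) {f g k : S ⟶ T} (h : Homotopic f g)
    (h' : Homotopic g k) : Homotopic f k := (h.symm hT).trans' hT h'

lemma Homotopic.comp_right {S T U : SSet.{u}} {f g : S ⟶ T} (h : Homotopic f g) (k : T ⟶ U) :
    Homotopic (f ≫ k) (g ≫ k) := by
  obtain ⟨h, rfl, rfl⟩ := h
  exact ⟨h ≫ k, by simp, by simp⟩

lemma Homotopic.comp_left {S T U : SSet.{u}} {f g : S ⟶ T} (h : Homotopic f g) (k : U ⟶ S) :
    Homotopic (k ≫ f) (k ≫ g) := by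
  obtain ⟨h, rfl, rfl⟩ := h
  exact ⟨k ▷ _ ≫ h, rfl, rfl⟩

/-- The homotopy relation on the category of simplicial sets. -/
def homotopyRel : HomRel SSet.{u} := fun _ _ f g ↦ Homotopic f g

/-- The naive homotopy category. -/
abbrev hoFunctor : SSet.{u} ⥤ CategoryTheory.Quotient homotopyRel.{u} :=
  CategoryTheory.Quotient.functor _

/-- The quotient category imposes the equivalence relation and congruence generated by homotopy;
with a Kan target, homotopy is already closed under both. -/
lemma homotopic_of_hoFunctor_eq {S T : SSet.{u}} (hT : Kan T) {f g : S ⟶ T}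
    (h : hoFunctor.map f = hoFunctor.map g) : Homotopic f g := by
  have h' := Quot.eqvGen_exact h
  clear h
  induction h' with
  | rel f g h =>
    obtain ⟨_, _, a, m, n, b, h⟩ := h
    exact Homotopic.comp_left (Homotopic.comp_right h b) a
  | refl f => exact .refl f
  | symm f g _ h => exact h.symm hT
  | trans f g k _ _ h h' => exact h.trans hT h'

lemma hoFunctor_eq {S T : SSet.{u}} {f g : S ⟶ T} (h : Homotopic f g) :
    hoFunctor.map f = hoFunctor.map g := CategoryTheory.Quotient.sound _ h

/-- Homotopy equivalences. -/
abbrev WE {S T : SSet.{u}} (f : S ⟶ T) : Prop := IsIso (hoFunctor.map f)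

lemma WE.of_comp_left {S T U : SSet.{u}} {f : S ⟶ T} {g : T ⟶ U} (hf : WE f) (hfg : WE (f ≫ g)) :
    WE g := by
  rw [WE, Functor.map_comp] at hfg; exact IsIso.of_isIso_comp_left (hoFunctor.map f) _

lemma WE.of_comp_right {S T U : SSet.{u}} {f : S ⟶ T} {g : T ⟶ U} (hg : WE g) (hfg : WE (f ≫ g)) :
    WE f := by
  rw [WE, Functor.map_comp] at hfg; exact IsIso.of_isIso_comp_right _ (hoFunctor.map g)

lemma WE.comp {S T U : SSet.{u}} {f : S ⟶ T} {g : T ⟶ U} (hf : WE f) (hg : WE g) : WE (f ≫ g) := by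
  rw [WE, Functor.map_comp]; infer_instance

lemma WE.of_homotopyInverse {S T : SSet.{u}} (f : S ⟶ T) (g : T ⟶ S)
    (h : hoFunctor.map (f ≫ g) = hoFunctor.map (𝟙 _))
    (h' : hoFunctor.map (g ≫ f) = hoFunctor.map (𝟙 _)) : WE f :=
  ⟨hoFunctor.map g, by simpa using h, by simpa using h'⟩

lemma TrivFib.section {S T : SSet.{u}} {p : S ⟶ T} (hp : TrivFib p) : ∃ s : T ⟶ S, s ≫ p = 𝟙 T := by
  obtain ⟨l, -, hl⟩ := hp.lift (Limits.initial.to T) (f := Limits.initial.to S) (g := 𝟙 T)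
    (Limits.initial.hom_ext _ _)
  exact ⟨l, hl⟩

end

/-! ### Trivial fibrations as Kan fibrations that are homotopy equivalences -/

noncomputable section

open CategoryTheory Simplicial Opposite MonoidalCategory CartesianMonoidalCategory

lemma endIncl_whiskerLeft_δ_eq (S : SSet.{u}) {x y : Fin 2} {i j : Fin 3}
    (h : i.succAbove x = j.succAbove y) : endIncl x S ≫ S ◁ SSet.stdSimplex.δ i =
      endIncl y S ≫ S ◁ SSet.stdSimplex.δ j := by
  rw [endIncl_whiskerLeft_δ, endIncl_whiskerLeft_δ, h]

lemma endIncl_eq_iff {K : SSet.{u}} {d e : Fin 2} {n} {x y : K.obj n} :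
    (endIncl d K).app n x = (endIncl e K).app n y ↔ d = e ∧ x = y := by
  constructor
  · intro h
    refine ⟨?_, congrArg Prod.fst h⟩
    have h' : SSet.stdSimplex.const.{u} 1 d n = SSet.stdSimplex.const 1 e n := congrArg Prod.snd h
    exact congrArg (fun x : (Δ[1] : SSet.{u}).obj n ↦ (SSet.stdSimplex.objEquiv x).toOrderHom 0) h'
  · rintro ⟨rfl, rfl⟩; rfl

/-- The sources of `boxFamily`. -/
def boxSource (A B : SSet.{u}) : Option (Fin 2) → SSet.{u} := fun s ↦ match s with
  | none => A ⊗ Δ[1]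
  | some _ => B

/-- The cylinder `A × Δ[1]` and both ends of the cylinder `B × Δ[1]`. -/
def boxFamily {A B : SSet.{u}} (i : A ⟶ B) (s : Option (Fin 2)) : boxSource A B s ⟶ B ⊗ Δ[1] :=
  match s with
  | none => i ▷ Δ[1]
  | some e => endIncl e B

/-- A family of maps on `boxFamily`. -/
def boxMaps {A B Y : SSet.{u}} (h : A ⊗ Δ[1] ⟶ Y) (f : Fin 2 → (B ⟶ Y)) (s : Option (Fin 2)) :
    boxSource A B s ⟶ Y :=
  match s with
  | none => h
  | some e => f e

lemma compatible_boxFamily {A B Y : SSet.{u}} (i : A ⟶ B) [Mono i] (h : A ⊗ Δ[1] ⟶ Y)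
    (f : Fin 2 → (B ⟶ Y)) (w : ∀ e, endIncl e A ≫ h = i ≫ f e) :
    Compatible (boxFamily i) (boxMaps h f) := by
  have key : ∀ e n (a : (A ⊗ Δ[1] : SSet.{u}).obj n) (b : B.obj n),
      (i ▷ Δ[1]).app n a = (endIncl e B).app n b → h.app n a = (f e).app n b := by
    rintro e n ⟨a, t⟩ b hab
    have h1 : i.app n a = b := congrArg Prod.fst hab
    have h2 : t = SSet.stdSimplex.const 1 e n := congrArg Prod.snd hab
    subst h1 h2
    exact app_congr (w e) a
  rintro (_ | d) (_ | e) n a b hab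
  · exact congrArg (h.app n) (Prod.ext (app_injective i _ (congrArg Prod.fst hab))
      (congrArg Prod.snd hab :))
  · exact key e n a b hab
  · exact (key d n b a hab.symm).symm
  · obtain ⟨rfl, rfl⟩ := endIncl_eq_iff.1 hab
    rfl

lemma TrivFib.lift_homotopy {E B : SSet.{u}} {p : E ⟶ B} (hp : TrivFib p) {A S : SSet.{u}}
    (i : A ⟶ S) [Mono i] {h : A ⊗ Δ[1] ⟶ E} {f : Fin 2 → (S ⟶ E)} {b : S ⊗ Δ[1] ⟶ B}
    (w : ∀ e, endIncl e A ≫ h = i ≫ f e) (wh : h ≫ p = i ▷ _ ≫ b)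
    (wf : ∀ e, f e ≫ p = endIncl e S ≫ b) :
    ∃ H : S ⊗ Δ[1] ⟶ E, i ▷ _ ≫ H = h ∧ (∀ e, endIncl e S ≫ H = f e) ∧ H ≫ p = b := by
  obtain ⟨H, h1, h2⟩ := unionRange_lift (compatible_boxFamily i h f w) (p := p) (hp.hasLift _) b
    (by rintro (_ | e); exacts [wh, wf e])
  exact ⟨H, h1 none, fun e ↦ h1 (some e), h2⟩

lemma TrivFib.homotopic {E B : SSet.{u}} {p : E ⟶ B} (hp : TrivFib p) {S : SSet.{u}}
    {f g : S ⟶ E} (h : f ≫ p = g ≫ p) : Homotopic f g := by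
  obtain ⟨H, -, h1, -⟩ := hp.lift_homotopy ((⊥ : S.Subcomplex).ι)
    (h := fst _ _ ≫ (SSet.Subcomplex.isInitialBot).to E) (f := ![f, g]) (b := fst _ _ ≫ f ≫ p)
    (fun e ↦ (SSet.Subcomplex.isInitialBot).hom_ext _ _)
    (ext_app fun n x ↦ x.1.2.elim)
    (by intro e; fin_cases e; exacts [rfl, h.symm])
  exact ⟨H, h1 0, h1 1⟩

lemma TrivFib.we {E B : SSet.{u}} {p : E ⟶ B} (hp : TrivFib p) : WE p := by
  obtain ⟨s, hs⟩ := hp.section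
  refine .of_homotopyInverse p s (hoFunctor_eq (hp.homotopic ?_)) (by rw [hs])
  rw [Category.assoc, hs]; simp

/-- For a lifting problem `(φ, ψ)`, the map `ψ ≫ s` is a solution up to the fibrewise homotopy `φ ▷
_ ≫ V`, and homotopy lifting makes the solution strict. -/
lemma KanFib.trivFib_of_deformation {E B : SSet.{u}} {p : E ⟶ B} (hp : KanFib p) {s : B ⟶ E}
    (sp : s ≫ p = 𝟙 B) (V : E ⊗ Δ[1] ⟶ E) (h0 : endIncl 0 E ≫ V = p ≫ s) (h1 : endIncl 1 E ≫ V = 𝟙 E)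
    (hV : V ≫ p = fst _ _ ≫ p) : TrivFib p := by
  rw [trivFib_iff]
  refine fun n ↦ ⟨fun {φ ψ} sq ↦ ?_⟩
  obtain ⟨H, l1, -, l3⟩ := hp.lift_cyl 0 ∂Δ[n].ι (h := φ ▷ _ ≫ V) (f := ψ ≫ s)
    (g := fst _ _ ≫ ψ)
    (by rw [← Category.assoc, ← endIncl_natural, Category.assoc, h0, sq.w_assoc])
    (by rw [Category.assoc, hV, whiskerRight_fst_assoc, whiskerRight_fst_assoc, sq.w])
    (by rw [Category.assoc, sp, ← Category.assoc, endIncl_fst, Category.id_comp, Category.comp_id])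
  refine ⟨⟨⟨endIncl 1 _ ≫ H, ?_, ?_⟩⟩⟩
  · rw [← Category.assoc, endIncl_natural, Category.assoc, l1, ← Category.assoc,
      ← endIncl_natural, Category.assoc, h1, Category.comp_id]
  · rw [Category.assoc, l3, ← Category.assoc, endIncl_fst, Category.id_comp]

/-- A homotopy inverse is first moved to a strict section; then the homotopy from `p ≫ s` to the
identity is replaced by one over `B`, so that `KanFib.trivFib_of_deformation` applies. -/
lemma KanFib.trivFib {E B : SSet.{u}} {p : E ⟶ B} (hp : KanFib p) (hB : Kan B) (hw : WE p) :
    TrivFib p := by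
  have hE := hp.kan hB
  obtain ⟨g, hg⟩ := hoFunctor.map_surjective (inv (hoFunctor.map p))
  have h1 : Homotopic (g ≫ p) (𝟙 B) := homotopic_of_hoFunctor_eq hB (by simp [hg])
  -- a section homotopic to `g`
  obtain ⟨k, hk0, hk1⟩ := h1
  obtain ⟨H, -, hH0, hHp⟩ := hp.lift_cyl 0 ((⊥ : B.Subcomplex).ι)
    (h := fst _ _ ≫ (SSet.Subcomplex.isInitialBot).to E) (f := g) (g := k)
    ((SSet.Subcomplex.isInitialBot).hom_ext _ _) (ext_app fun n x ↦ x.1.2.elim) hk0.symm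
  set s := endIncl 1 B ≫ H with hs
  have sp : s ≫ p = 𝟙 B := by rw [hs, Category.assoc, hHp, hk1]
  have hgs : hoFunctor.map g = hoFunctor.map s := hoFunctor_eq ⟨H, hH0, rfl⟩
  obtain ⟨K, hK0, hK1⟩ : Homotopic (p ≫ s) (𝟙 E) := homotopic_of_hoFunctor_eq hE (by
    rw [Functor.map_comp, ← hgs, hg]; simp)
  -- The homotopy `K` is the edge `02` and `K ≫ p ≫ s` the edge `01` of a horn in `E`, lying over
  -- the degenerate triangle given by `σ 1` and `K ≫ p`. Vertices 1 and 2 lie over the same point,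
  -- so the new edge `12` is a vertical homotopy from `p ≫ s` to the identity.
  have C := compatible_faceFamily (P := (· ≠ (0 : Fin 3))) (S := E)
    (fun t ↦ if t.1 = 1 then K else K ≫ p ≫ s) (by
      have aux : ∀ s t : {s // s ≠ (0 : Fin 3)}, s.1 ≠ t.1 → ∀ x y : Fin 2,
        s.1.succAbove x = t.1.succAbove y → x = 0 ∧ y = 0 := by decide
      have e : endIncl 0 E ≫ K ≫ p ≫ s = endIncl 0 E ≫ K := by
        rw [← Category.assoc, hK0, Category.assoc, ← Category.assoc s, sp, Category.id_comp]
      intro s t hst x y hxy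
      obtain ⟨rfl, rfl⟩ := aux s t hst x y hxy
      by_cases h1 : s.1 = 1 <;> by_cases h2 : t.1 = 1
      · rw [if_pos h1, if_pos h2]
      · rw [if_pos h1, if_neg h2, e]
      · rw [if_neg h1, if_pos h2, e]
      · rw [if_neg h1, if_neg h2])
  have hσ1 : E ◁ SSet.stdSimplex.δ 1 ≫ E ◁ SSet.stdSimplex.{u}.σ (1 : Fin 2) = 𝟙 _ := by
    rw [← whiskerLeft_comp, SSet.stdSimplex.δ_comp_σ_self' (by rfl), whiskerLeft_id]
  have hσ2 : E ◁ SSet.stdSimplex.δ 2 ≫ E ◁ SSet.stdSimplex.{u}.σ (1 : Fin 2) = 𝟙 _ := by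
    rw [← whiskerLeft_comp, SSet.stdSimplex.δ_comp_σ_succ' (by rfl), whiskerLeft_id]
  obtain ⟨L, hL, hLp⟩ := unionRange_lift C (p := p) (by
    rw [unionRange_faceFamily]
    exact SSet.anodyneExtensions_unionProd_ι _ _ (.horn_ι _) _ hp)
    (E ◁ SSet.stdSimplex.σ (1 : Fin 2) ≫ K ≫ p) (by
      rintro ⟨t, ht⟩
      by_cases h1 : t = 1
      · subst h1
        rw [if_pos rfl, ← Category.assoc, hσ1, Category.id_comp]
      · obtain rfl : t = 2 := by revert ht h1; revert t; decide
        rw [if_neg h1]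
        exact Eq.trans (b := K ≫ p) (by simp [sp])
          ((Category.id_comp _).symm.trans ((hσ2.symm =≫ _).trans (Category.assoc _ _ _))))
  have e1 : E ◁ SSet.stdSimplex.δ 1 ≫ L = K := (hL ⟨1, by decide⟩).trans (if_pos rfl)
  have e2 : E ◁ SSet.stdSimplex.δ 2 ≫ L = K ≫ p ≫ s :=
    (hL ⟨2, by decide⟩).trans (if_neg (by decide))
  refine hp.trivFib_of_deformation sp (E ◁ SSet.stdSimplex.δ 0 ≫ L) ?_ ?_ ?_
  · rw [← Category.assoc, ← endIncl_whiskerLeft_δ_eq E (i := 2) (j := 0) (x := 1) (y := 0) rfl,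
      Category.assoc, e2, ← Category.assoc, hK1, Category.id_comp]
  · rw [← Category.assoc, ← endIncl_whiskerLeft_δ_eq E (i := 1) (j := 0) (x := 1) (y := 1) rfl,
      Category.assoc, e1, hK1]
  · have h0 : SSet.stdSimplex.δ 0 ≫ SSet.stdSimplex.{u}.σ (1 : Fin 2) =
        SSet.const (SSet.stdSimplex.obj₀Equiv.symm 1) := by
      refine ext_app fun n x ↦ ?_
      induction n using Opposite.rec with | op n =>
      induction n using SimplexCategory.rec with | _ n =>
      refine SSet.stdSimplex.ext _ _ fun k ↦ ?_
      exact (by decide : ∀ x : Fin 2, Fin.predAbove (1 : Fin 2) ((0 : Fin 3).succAbove x) = 1) (x k)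
    rw [Category.assoc, hLp, ← Category.assoc, ← whiskerLeft_comp, h0]
    have : E ◁ (SSet.const (SSet.stdSimplex.obj₀Equiv.symm 1) : Δ[1] ⟶ Δ[1]) =
      fst _ _ ≫ endIncl 1 E := rfl
    rw [this, Category.assoc, ← Category.assoc (endIncl 1 E), hK1, Category.id_comp]

/-- A lift for `p ≫ q` has the right boundary but lies over `ψ` only after applying `q`. As `q` is a
trivial fibration, the discrepancy is a homotopy relative to `A`, which lifts along `p`. Working
with a single `i` is needed for (-1)-truncated maps, where the empty boundary is excluded. -/
lemma KanFib.hasLift_of_comp {E B D A S : SSet.{u}} {p : E ⟶ B} {q : B ⟶ D} (hp : KanFib p)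
    (hq : TrivFib q) (i : A ⟶ S) [Mono i] (h : HasLiftingProperty i (p ≫ q)) :
    HasLiftingProperty i p := by
  refine ⟨fun {φ ψ} sq ↦ ?_⟩
  obtain ⟨a, ha, ha'⟩ := exists_lift_of i (p ≫ q) (f := φ) (g := ψ ≫ q) (by
    rw [← Category.assoc, sq.w, Category.assoc])
  obtain ⟨H, h1, h2, h3⟩ := hq.lift_homotopy i (h := fst _ _ ≫ φ ≫ p) (f := ![a ≫ p, ψ])
    (b := fst _ _ ≫ ψ ≫ q) (by
      intro e; fin_cases e
      · change endIncl 0 A ≫ fst _ _ ≫ φ ≫ p = i ≫ a ≫ p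
        rw [← Category.assoc, endIncl_fst, Category.id_comp, ← Category.assoc, ha]
      · change endIncl 1 A ≫ fst _ _ ≫ φ ≫ p = i ≫ ψ
        rw [← Category.assoc, endIncl_fst, Category.id_comp, sq.w])
    (by rw [whiskerRight_fst_assoc, ← sq.w_assoc]; simp)
    (by
      intro e
      rw [← Category.assoc (endIncl e S), endIncl_fst, Category.id_comp]
      fin_cases e
      · exact (Category.assoc _ _ _).trans ha'
      · rfl)
  obtain ⟨L, l1, l2, l3⟩ := hp.lift_cyl 0 i (h := fst _ _ ≫ φ) (f := a) (g := H)
    (by rw [← Category.assoc, endIncl_fst, Category.id_comp, ha])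
    (by rw [h1, Category.assoc]) (h2 0).symm
  refine ⟨⟨⟨endIncl 1 S ≫ L, ?_, ?_⟩⟩⟩
  · rw [← Category.assoc, endIncl_natural, Category.assoc, l1, ← Category.assoc, endIncl_fst,
      Category.id_comp]
  · rw [Category.assoc, l3]; exact h2 1

lemma TrivFib.of_comp {E B D : SSet.{u}} {p : E ⟶ B} {q : B ⟶ D} (hp : KanFib p)
    (hq : TrivFib q) (h : TrivFib (p ≫ q)) : TrivFib p :=
  trivFib_iff.2 fun _ ↦ hp.hasLift_of_comp hq _ (h.hasLift _)

lemma TrivFib.comp {E B D : SSet.{u}} {p : E ⟶ B} {q : B ⟶ D} (hp : TrivFib p)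
    (hq : TrivFib q) : TrivFib (p ≫ q) :=
  MorphismProperty.comp_mem SSet.modelCategoryQuillen.I.rlp _ _ hp hq

lemma KanFib.comp {E B D : SSet.{u}} {p : E ⟶ B} {q : B ⟶ D} (hp : KanFib p)
    (hq : KanFib q) : KanFib (p ≫ q) :=
  MorphismProperty.comp_mem SSet.modelCategoryQuillen.J.rlp _ _ hp hq

lemma hasLift_of_comp_left {E B D A S : SSet.{u}} {p : E ⟶ B} {q : B ⟶ D} (hp : TrivFib p)
    (i : A ⟶ S) [Mono i] (h : HasLiftingProperty i (p ≫ q)) : HasLiftingProperty i q := by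
  refine ⟨fun {φ ψ} sq ↦ ?_⟩
  obtain ⟨φ', -, hφ⟩ := hp.lift (Limits.initial.to A) (f := Limits.initial.to E) (g := φ)
    (Limits.initial.hom_ext _ _)
  obtain ⟨l, hl, hl'⟩ := exists_lift_of i (p ≫ q) (f := φ') (g := ψ) (by
    rw [← Category.assoc, hφ, sq.w])
  exact ⟨⟨⟨l ≫ p, by rw [← Category.assoc, hl, hφ], by rw [Category.assoc, hl']⟩⟩⟩

lemma TrivFib.of_comp_left {E B D : SSet.{u}} {p : E ⟶ B} {q : B ⟶ D} (hp : TrivFib p)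
    (h : TrivFib (p ≫ q)) : TrivFib q :=
  trivFib_iff.2 fun _ ↦ hasLift_of_comp_left hp _ (h.hasLift _)

lemma TrivFib.of_isPullback {P E B B' : SSet.{u}} {f : P ⟶ E} {q : P ⟶ B'} {p : E ⟶ B} {g : B' ⟶ B}
    (sq : IsPullback f q p g) (hp : TrivFib p) : TrivFib q :=
  MorphismProperty.of_isPullback (P := SSet.modelCategoryQuillen.I.rlp) sq hp

lemma KanFib.of_isPullback {P E B B' : SSet.{u}} {f : P ⟶ E} {q : P ⟶ B'} {p : E ⟶ B} {g : B' ⟶ B}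
    (sq : IsPullback f q p g) (hp : KanFib p) : KanFib q :=
  MorphismProperty.of_isPullback (P := SSet.modelCategoryQuillen.J.rlp) sq hp

lemma hasLift_of_isPullback {P E B B' A S : SSet.{u}} {f : P ⟶ E} {q : P ⟶ B'} {p : E ⟶ B}
    {g : B' ⟶ B} (sq : IsPullback f q p g) (i : A ⟶ S) (hp : HasLiftingProperty i p) :
    HasLiftingProperty i q := sq.hasLiftingProperty _

/-- The contraction of a simplex to its last vertex. -/
def contractSimplex (n : ℕ) : (Δ[n] : SSet.{u}) ⊗ Δ[1] ⟶ Δ[n] where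
  app m := ↾fun x ↦ SSet.stdSimplex.objEquiv.symm (SimplexCategory.mkHom
    ⟨fun k ↦ if (SSet.stdSimplex.objEquiv x.2).toOrderHom k = 0 then
      (SSet.stdSimplex.objEquiv x.1).toOrderHom k else Fin.last n, by
        intro i j hij
        have h := (SSet.stdSimplex.objEquiv x.2).toOrderHom.monotone hij
        dsimp only
        split_ifs with h₁ h₂ h₂
        · exact (SSet.stdSimplex.objEquiv x.1).toOrderHom.monotone hij
        · exact Fin.le_last _
        · exact absurd (le_antisymm (h.trans h₂.le) (Fin.zero_le _)) h₁
        · exact le_rfl⟩)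
  naturality _ _ _ := rfl

lemma endIncl_zero_contractSimplex (n : ℕ) : endIncl 0 _ ≫ contractSimplex.{u} n = 𝟙 _ := by
  refine ext_app fun m x ↦ ?_
  induction m using Opposite.rec with | op m =>
  induction m using SimplexCategory.rec with | _ m =>
  exact SSet.stdSimplex.ext _ _ fun k ↦ rfl

lemma endIncl_one_contractSimplex (n : ℕ) : endIncl 1 _ ≫ contractSimplex.{u} n =
    SSet.const (SSet.stdSimplex.obj₀Equiv.symm (Fin.last n)) := rfl

/-- Contracting the simplex to its last vertex transports a lifting problem into the fiber over that
vertex; there it is solved, and the solution is transported back along the same homotopy. -/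
lemma KanFib.hasLift_of_fibers {E B : SSet.{u}} {p : E ⟶ B} (hp : KanFib p) (n : ℕ)
    (h : ∀ (b : B _⦋0⦌) (φ : (∂Δ[n] : SSet.{u}) ⟶ E), φ ≫ p = SSet.const b →
      ∃ ψ : Δ[n] ⟶ E, ∂Δ[n].ι ≫ ψ = φ ∧ ψ ≫ p = SSet.const b) :
    HasLiftingProperty ∂Δ[n].ι p := by
  refine ⟨fun {φ ψ} sq ↦ ?_⟩
  obtain ⟨H, -, h0, hH⟩ := hp.lift_cyl 0 ((⊥ : (∂Δ[n] : SSet.{u}).Subcomplex).ι)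
    (h := fst _ _ ≫ (SSet.Subcomplex.isInitialBot).to E) (f := φ)
    (g := ∂Δ[n].ι ▷ _ ≫ contractSimplex n ≫ ψ)
    ((SSet.Subcomplex.isInitialBot).hom_ext _ _) (ext_app fun n x ↦ x.1.2.elim) (by
      rw [← Category.assoc, ← endIncl_natural, Category.assoc, ← Category.assoc (endIncl 0 _),
        endIncl_zero_contractSimplex, Category.id_comp, sq.w])
  obtain ⟨χ, h1, h2⟩ := h (ψ.app _ (SSet.stdSimplex.obj₀Equiv.symm (Fin.last n)))
    (endIncl 1 _ ≫ H) (by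
      rw [Category.assoc, hH, ← Category.assoc, ← endIncl_natural, Category.assoc,
        ← Category.assoc (endIncl 1 _), endIncl_one_contractSimplex, SSet.const_comp,
        SSet.comp_const])
  obtain ⟨L, l1, l2, l3⟩ := hp.lift_cyl 1 ∂Δ[n].ι (h := H) (f := χ) (g := contractSimplex n ≫ ψ)
    h1.symm hH (by
      rw [h2, ← Category.assoc, endIncl_one_contractSimplex, SSet.const_comp])
  refine ⟨⟨⟨endIncl 0 _ ≫ L, ?_, ?_⟩⟩⟩
  · rw [← Category.assoc, endIncl_natural, Category.assoc, l1, h0]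
  · rw [Category.assoc, l3, ← Category.assoc, endIncl_zero_contractSimplex, Category.id_comp]

/-- Replacing the base of a fibration along a span of trivial fibrations. -/
lemma hasLift_span_iff {P T U B₁ B₂ A S : SSet.{u}} {f : P ⟶ T} {g : P ⟶ U} {t : T ⟶ B₁}
    {u₁ : U ⟶ B₁} {u₂ : U ⟶ B₂} (sq : IsPullback f g t u₁) (ht : KanFib t) (h₁ : TrivFib u₁)
    (h₂ : TrivFib u₂) (i : A ⟶ S) [Mono i] :
    HasLiftingProperty i (g ≫ u₂) ↔ HasLiftingProperty i t := by
  constructor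
  · intro h
    have hf : TrivFib f := h₁.of_isPullback sq.flip
    have hg := (ht.of_isPullback sq).hasLift_of_comp h₂ i h
    refine hasLift_of_comp_left hf i ?_
    rw [sq.w]
    have := h₁.hasLift i
    infer_instance
  · intro h
    have := hasLift_of_isPullback sq i h
    have := h₂.hasLift i
    infer_instance

lemma isPullback_of_levelwise {P T U B : SSet.{u}} {f : P ⟶ T} {g : P ⟶ U} {t : T ⟶ B}
    {u : U ⟶ B} (w : f ≫ t = g ≫ u) (h : ∀ n (x : T.obj n) (y : U.obj n),
      t.app n x = u.app n y → ∃! z, f.app n z = x ∧ g.app n z = y) : IsPullback f g t u := by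
  choose l hl hl' using h
  refine ⟨⟨w⟩, ⟨Limits.PullbackCone.IsLimit.mk w
    (fun s ↦
      { app := fun n ↦ ↾fun x ↦ l n (s.fst.app n x) (s.snd.app n x) (app_congr s.condition x)
        naturality := fun n m a ↦ ConcreteCategory.hom_ext _ _ fun x ↦ (hl' m _ _ _ _ ⟨?_, ?_⟩).symm })
    (fun s ↦ ext_app fun n x ↦ (hl n _ _ _).1) (fun s ↦ ext_app fun n x ↦ (hl n _ _ _).2)
    (fun s m h1 h2 ↦ ext_app fun n x ↦ hl' n _ _ _ _ ⟨app_congr h1 x, app_congr h2 x⟩)⟩⟩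
  · exact (app_map f a _).trans ((congrArg (T.map a) (hl n _ _ _).1).trans (app_map s.fst a x).symm)
  · exact (app_map g a _).trans ((congrArg (U.map a) (hl n _ _ _).2).trans (app_map s.snd a x).symm)

end

/-! ### Inner anodyne maps are local for Segal spaces -/

noncomputable section

open CategoryTheory Simplicial Opposite MonoidalCategory CartesianMonoidalCategory

section Cover

variable {ι : Type} {A : ι → SSet.{u}} {B Y : SSet.{u}} {i : ∀ s, A s ⟶ B}

/-- The family is jointly surjective. -/
def IsCover (i : ∀ s, A s ⟶ B) : Prop := ∀ n (x : B.obj n), ∃ s a, (i s).app n a = x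

lemma IsCover.hom_ext (hi : IsCover i) {f g : B ⟶ Y} (H : ∀ s, i s ≫ f = i s ≫ g) : f = g := by
  refine ext_app fun n x ↦ ?_
  obtain ⟨s, a, rfl⟩ := hi n x
  exact app_congr (H s) a

lemma IsCover.exists_desc (hi : IsCover i) {h : ∀ s, A s ⟶ Y} (H : Compatible i h) :
    ∃ l : B ⟶ Y, ∀ s, i s ≫ l = h s := by
  have e : unionRange i = ⊤ := by
    ext n x
    simpa using (mem_unionRange i x).2 (hi n x)
  have : IsIso (unionRange i).ι := by
    rw [e]
    exact inferInstanceAs (IsIso (SSet.Subcomplex.topIso B).hom)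
  refine ⟨inv (unionRange i).ι ≫ glue H, fun s ↦ ?_⟩
  rw [← toUnion_ι i s, Category.assoc, IsIso.hom_inv_id_assoc, toUnion_glue]

/-- The sources of a family of two maps. -/
def pairSource (K L : SSet.{u}) (s : Bool) : SSet.{u} := match s with
  | true => K
  | false => L

/-- A family of two maps. -/
def pairMaps {K L : SSet.{u}} (f : K ⟶ B) (g : L ⟶ B) (s : Bool) : pairSource K L s ⟶ B :=
  match s with
  | true => f
  | false => g

lemma compatible_pair {K L : SSet.{u}} (f : K ⟶ B) (g : L ⟶ B) [Mono f] [Mono g] (f' : K ⟶ Y)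
    (g' : L ⟶ Y) (w : ∀ n (a : K.obj n) (b : L.obj n), f.app n a = g.app n b →
      f'.app n a = g'.app n b) : Compatible (pairMaps f g) (pairMaps f' g') := by
  rintro (_ | _) (_ | _) n a b hab
  · exact congrArg (g'.app n) (app_injective g n hab)
  · exact (w n b a hab.symm).symm
  · exact w n a b hab
  · exact congrArg (f'.app n) (app_injective f n hab)

end Cover

section Transpose

variable (X : SimplicialSpace.{u})

/-- The simplicial set of maps of a space `U` to the spaces of `X`. -/
def cot : SSet.{u}ᵒᵖ ⥤ SSet.{u} := coyoneda ⋙ (Functor.whiskeringLeft _ _ _).obj X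

/-- The mapping space from `i`. -/
abbrev Map (K : SSet.{u}) : SSet.{u} := X.mapSpaceFrom.obj (op K)

/-- The restriction of diagrams along `i`. -/
abbrev res {K L : SSet.{u}} (i : K ⟶ L) : X.Map L ⟶ X.Map K := X.mapSpaceFrom.map i.op

variable {X}

/-- A map from `U` to `Map(K, X)` is the same as a map `K ⟶ X.cot U`. -/
def transpose {U K : SSet.{u}} (a : U ⟶ X.Map K) : K ⟶ X.cot.obj (op U) where
  app n := ↾fun k ↦ (
    { app := fun l ↦ ↾fun x ↦ NatTrans.app (a.app l x : K ⟶ X.row l) n k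
      naturality := fun l l' g ↦ ConcreteCategory.hom_ext _ _ fun x ↦
        app_congr (S := K) (T := X.row l') (app_map a g x) k } : U ⟶ X.obj n)
  naturality n m g := by
    refine ConcreteCategory.hom_ext _ _ fun k ↦ ?_
    exact ext_app fun l x ↦ app_map (a.app l x : K ⟶ X.row l) g k

/-- The inverse of `transpose`. -/
def untranspose {U K : SSet.{u}} (a : K ⟶ X.cot.obj (op U)) : U ⟶ X.Map K where
  app l := ↾fun x ↦ (
    { app := fun n ↦ ↾fun k ↦ NatTrans.app (a.app n k : U ⟶ X.obj n) l x
      naturality := fun n n' g ↦ ConcreteCategory.hom_ext _ _ fun k ↦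
        app_congr (S := U) (T := X.obj n') (app_map a g k) x } : K ⟶ X.row l)
  naturality l l' g := by
    refine ConcreteCategory.hom_ext _ _ fun x ↦ ?_
    exact ext_app fun n k ↦ app_map (a.app n k : U ⟶ X.obj n) g x

/-- Both sides are the same extension problem for bisimplicial sets, read in the space direction and
in the categorical direction. -/
lemma hasLift_res_iff {U V K L : SSet.{u}} (j : U ⟶ V) (i : K ⟶ L) :
    HasLiftingProperty j (X.res i) ↔ HasLiftingProperty i (X.cot.map j.op) := by
  constructor
  · refine fun h ↦ ⟨fun {f g} sq ↦ ?_⟩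
    obtain ⟨l, h1, h2⟩ := exists_lift_of j (X.res i) (f := untranspose g) (g := untranspose f)
      (congrArg untranspose sq.w.symm)
    exact ⟨⟨⟨transpose l, congrArg transpose h2, congrArg transpose h1⟩⟩⟩
  · refine fun h ↦ ⟨fun {f g} sq ↦ ?_⟩
    obtain ⟨l, h1, h2⟩ := exists_lift_of i (X.cot.map j.op) (f := transpose g) (g := transpose f)
      (congrArg transpose sq.w.symm)
    exact ⟨⟨⟨untranspose l, congrArg untranspose h2, congrArg untranspose h1⟩⟩⟩

/-- Reedy fibrancy is assumed for boundary inclusions only. Transposed, it makes `X.cot` of an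
anodyne generator a trivial fibration, which lifts against every monomorphism. -/
lemma IsReedyFibrant.kanFib_res (hX : X.IsReedyFibrant) {K L : SSet.{u}} (i : K ⟶ L) [Mono i] :
    KanFib (X.res i) := by
  intro U V j hj
  rw [hasLift_res_iff]
  refine TrivFib.hasLift (trivFib_iff.2 fun n ↦ ?_) i
  rw [← hasLift_res_iff]
  exact hX n j hj

variable (X) in
/-- Restriction along `i` is a trivial fibration of spaces of diagrams. -/
def IsLocal {K L : SSet.{u}} (i : K ⟶ L) : Prop := TrivFib (X.res i)

lemma isLocal_iff {K L : SSet.{u}} (i : K ⟶ L) :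
    X.IsLocal i ↔ ∀ n : ℕ, HasLiftingProperty i (X.cot.map (∂Δ[n].ι : _ ⟶ Δ[n]).op) := by
  simp_rw [← hasLift_res_iff]
  exact trivFib_iff

lemma IsLocal.comp {K L M : SSet.{u}} {i : K ⟶ L} {k : L ⟶ M} (hi : X.IsLocal i)
    (hk : X.IsLocal k) : X.IsLocal (i ≫ k) := by
  rw [isLocal_iff] at *
  intro n
  have := hi n
  have := hk n
  infer_instance

lemma IsReedyFibrant.isLocal_of_comp (hX : X.IsReedyFibrant) {K L M : SSet.{u}} {i : K ⟶ L}
    {k : L ⟶ M} [Mono k] (hi : X.IsLocal i) (h : X.IsLocal (i ≫ k)) : X.IsLocal k :=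
  TrivFib.of_comp (hX.kanFib_res k) hi (by
    have : X.res (i ≫ k) = X.res k ≫ X.res i := rfl
    rw [← this]; exact h)

lemma isLocal_of_isIso {K L : SSet.{u}} (i : K ⟶ L) [IsIso i] : X.IsLocal i := by
  rw [isLocal_iff]; intro n; infer_instance

/-- For subcomplexes `A ≤ B`, restriction from `B` to `A` is a trivial fibration. -/
def IsLocalPair (X : SimplicialSpace.{u}) {L : SSet.{u}} (A B : L.Subcomplex) : Prop :=
  ∃ h : A ≤ B, X.IsLocal (SSet.Subcomplex.homOfLE h)

lemma IsLocalPair.of_eq {L : SSet.{u}} {A B : L.Subcomplex} (h : A = B) : X.IsLocalPair A B := by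
  subst h
  refine ⟨le_rfl, ?_⟩
  rw [SSet.Subcomplex.homOfLE_refl]
  exact isLocal_of_isIso _

lemma IsReedyFibrant.isLocalPair_of_trans (hX : X.IsReedyFibrant) {L : SSet.{u}}
    {A B C : L.Subcomplex} (h : X.IsLocalPair A B) (hBC : B ≤ C)
    (h' : X.IsLocalPair A C) : X.IsLocalPair B C :=
  ⟨hBC, hX.isLocal_of_comp h.2 h'.2⟩

lemma isLocalPair_top_iff {L : SSet.{u}} {A : L.Subcomplex} :
    X.IsLocalPair A ⊤ ↔ X.IsLocal A.ι := by
  have h : SSet.Subcomplex.homOfLE (le_top : A ≤ ⊤) ≫ (SSet.Subcomplex.topIso L).hom = A.ι := rfl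
  constructor
  · intro h'
    rw [← h]
    exact h'.2.comp (isLocal_of_isIso _)
  · intro h'
    refine ⟨le_top, ?_⟩
    have : A.ι ≫ (SSet.Subcomplex.topIso L).inv = SSet.Subcomplex.homOfLE (le_top : A ≤ ⊤) := rfl
    rw [← this]
    exact h'.comp (isLocal_of_isIso _)

/-- Excision. -/
lemma IsLocal.excision {K L : SSet.{u}} (g : K ⟶ L) [Mono g] (B : L.Subcomplex)
    (h : X.IsLocal (B.preimage g).ι) : X.IsLocalPair B (B ⊔ SSet.Subcomplex.range g) := by
  refine ⟨le_sup_left, ?_⟩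
  rw [isLocal_iff] at *
  refine fun n ↦ ⟨fun {φ ψ} sq ↦ ?_⟩
  set p := X.cot.map (∂Δ[n].ι : _ ⟶ Δ[n]).op
  have := h n
  let gK : K ⟶ (B ⊔ SSet.Subcomplex.range g : L.Subcomplex) :=
    SSet.Subcomplex.lift g le_sup_right
  obtain ⟨l, hl, hl'⟩ := exists_lift_of (B.preimage g).ι p
    (f := B.fromPreimage g ≫ φ) (g := gK ≫ ψ) (by
      rw [Category.assoc, sq.w]; rfl)
  let iB : (B : SSet) ⟶ (B ⊔ SSet.Subcomplex.range g : L.Subcomplex) :=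
    SSet.Subcomplex.homOfLE le_sup_left
  have hc : IsCover (pairMaps iB gK) := by
    rintro m ⟨x, hx | ⟨a, ha⟩⟩
    · exact ⟨true, ⟨x, hx⟩, rfl⟩
    · exact ⟨false, a, Subtype.ext ha⟩
  have hgK : gK ≫ (B ⊔ SSet.Subcomplex.range g).ι = g := rfl
  have : Mono gK := mono_of_mono_fac hgK
  obtain ⟨k, hk⟩ := hc.exists_desc (compatible_pair iB gK φ l (by
    intro m a b hab
    have hab' : a.1 = g.app m b := congrArg Subtype.val hab
    have hb : b ∈ (B.preimage g).obj m := by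
      change g.app m b ∈ B.obj m
      rw [← hab']; exact a.2
    have e := app_congr hl ⟨b, hb⟩
    refine Eq.trans (congrArg (φ.app m) (Subtype.ext hab')) e.symm))
  exact ⟨⟨⟨k, hk true, hc.hom_ext fun s ↦ by
    rw [← Category.assoc, hk]
    rcases s with _ | _
    · exact hl'
    · exact sq.w⟩⟩⟩

end Transpose

section Segal

variable {X : SimplicialSpace.{u}}

lemma mem_spine {n m : ℕ} (x : (Δ[n] : SSet.{u}) _⦋m⦌) :
    x ∈ (spine n).obj (op ⦋m⦌) ↔ ∀ i j : Fin (m + 1), (x j : ℕ) ≤ x i + 1 := Iff.rfl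

lemma mem_range_δ' {n : ℕ} (i : Fin (n + 2)) {m : ℕ} (t : (Δ[n + 1] : SSet.{u}) _⦋m⦌) :
    t ∈ (SSet.Subcomplex.range (SSet.stdSimplex.δ i)).obj _ ↔ ∀ k, t k ≠ i := by
  refine Iff.trans (b := ∃ a, (SSet.stdSimplex.δ i).app _ a = t) Iff.rfl
    ((mem_range_δ i t).trans ?_)
  simp

/-- An extensionality lemma for subcomplexes of simplices. -/
lemma subcomplex_ext {K : SSet.{u}} {A B : K.Subcomplex}
    (h : ∀ m (x : K _⦋m⦌), x ∈ A.obj (op ⦋m⦌) ↔ x ∈ B.obj (op ⦋m⦌)) : A = B := by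
  ext m x
  induction m using Opposite.rec with | op m =>
  induction m using SimplexCategory.rec with | _ m =>
  exact h m x

lemma preimage_δ_last_spine (n : ℕ) :
    (spine.{u} (n + 1)).preimage (SSet.stdSimplex.δ (Fin.last (n + 1))) = spine n := by
  refine subcomplex_ext fun m x ↦ ?_
  refine (mem_spine _).trans (Iff.trans ?_ (mem_spine _).symm)
  simp only [δ_app_apply, Fin.succAbove_last, Fin.val_castSucc]

lemma preimage_δ_zero_spine (n : ℕ) : (spine.{u} (n + 2) ⊔
      SSet.Subcomplex.range (SSet.stdSimplex.δ (Fin.last (n + 2)))).preimage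
        (SSet.stdSimplex.δ 0) =
    spine (n + 1) ⊔ SSet.Subcomplex.range (SSet.stdSimplex.δ (Fin.last (n + 1))) := by
  refine subcomplex_ext fun m x ↦ ?_
  refine or_congr ((mem_spine _).trans (Iff.trans ?_ (mem_spine _).symm))
    ((mem_range_δ' _ _).trans (Iff.trans ?_ (mem_range_δ' _ _).symm))
  · simp only [δ_app_apply, Fin.succAbove_zero, Fin.val_succ]
    refine forall_congr' fun i ↦ forall_congr' fun j ↦ by omega
  · simp only [δ_app_apply, Fin.succAbove_zero, ← Fin.succ_last, ne_eq, Fin.succ_inj]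

lemma IsSegal.isLocalPair_spine (h : X.IsSegal) (n : ℕ) : X.IsLocalPair (spine n) ⊤ := by
  obtain hn | hn := lt_or_ge n 2
  · refine .of_eq (subcomplex_ext fun m x ↦ ?_)
    refine (mem_spine _).trans ⟨fun _ ↦ trivial, fun _ i j ↦ ?_⟩
    have := (x j).2
    omega
  · exact isLocalPair_top_iff.2 (h n hn)

lemma isLocalPair_top_of_δ {n : ℕ} {A : (Δ[n] : SSet.{u}).Subcomplex}
    {B : (Δ[n + 1] : SSet.{u}).Subcomplex} (i : Fin (n + 2)) (hA : X.IsLocalPair A ⊤)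
    (h : B.preimage (SSet.stdSimplex.δ i) = A) :
    X.IsLocalPair B (B ⊔ SSet.Subcomplex.range (SSet.stdSimplex.δ i)) := by
  subst h
  exact IsLocal.excision _ _ (isLocalPair_top_iff.1 hA)

variable (hX : X.IsReedyFibrant) (hX' : X.IsSegal)
include hX hX'

/-- The last face meets the spine in its own spine, so attaching this face to the spine is local by
excision; then the spine cancels. -/
lemma isLocalPair_spine_δ_last (n : ℕ) :
    X.IsLocalPair (spine (n + 1) ⊔ SSet.Subcomplex.range (SSet.stdSimplex.δ (Fin.last (n + 1))))
      ⊤ :=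
  hX.isLocalPair_of_trans (isLocalPair_top_of_δ _ (hX'.isLocalPair_spine n)
    (preimage_δ_last_spine n)) le_top (hX'.isLocalPair_spine _)

/-- The union of the faces opposite to the vertices in `S`. -/
def faces {n : ℕ} (S : Finset (Fin (n + 1))) : (Δ[n] : SSet.{u}).Subcomplex where
  obj _ := {x | ∃ i ∈ S, ∀ k, SSet.stdSimplex.asOrderHom x k ≠ i}
  map _ _ := fun ⟨i, hi, h⟩ ↦ ⟨i, hi, fun _ ↦ h _⟩

omit hX hX' in
lemma mem_faces {n m : ℕ} (S : Finset (Fin (n + 1))) (x : (Δ[n] : SSet.{u}) _⦋m⦌) :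
    x ∈ (faces S).obj (op ⦋m⦌) ↔ ∃ i ∈ S, ∀ k, x k ≠ i := Iff.rfl

/-- The spine lies in the union of the first and last faces in dimension at least two, and this
union is obtained from it by attaching the last face and then the first, both along local
inclusions. -/
lemma isLocalPair_faces_ends (n : ℕ) :
    X.IsLocalPair (faces {0, Fin.last (n + 2)} : (Δ[n + 2] : SSet.{u}).Subcomplex) ⊤ := by
  have h1 := isLocalPair_spine_δ_last hX hX' (n + 1)
  have h2 := isLocalPair_top_of_δ _ (isLocalPair_spine_δ_last hX hX' n) (preimage_δ_zero_spine n)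
  have h3 := hX.isLocalPair_of_trans h2 le_top h1
  convert h3 using 1
  refine subcomplex_ext fun m x ↦ ?_
  have e : x ∈ ((spine (n + 2) ⊔ SSet.Subcomplex.range (SSet.stdSimplex.δ (Fin.last (n + 2)))) ⊔
      SSet.Subcomplex.range (SSet.stdSimplex.δ 0)).obj (op ⦋m⦌) ↔
    ((∀ i j : Fin (m + 1), (x j : ℕ) ≤ x i + 1) ∨ (∀ k, x k ≠ Fin.last (n + 2))) ∨
      ∀ k, x k ≠ 0 := or_congr (or_congr (mem_spine _) (mem_range_δ' _ _)) (mem_range_δ' _ _)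
  rw [e, mem_faces]
  constructor
  · rintro ⟨i, hi, h⟩
    obtain rfl | rfl : i = 0 ∨ i = Fin.last (n + 2) := by simpa using hi
    · exact Or.inr h
    · exact Or.inl (Or.inr h)
  · rintro ((h | h) | h)
    · by_contra! h'
      obtain ⟨i, hi⟩ := h' 0 (by simp)
      obtain ⟨j, hj⟩ := h' (Fin.last _) (by simp)
      have := h i j
      rw [hi, hj] at this
      simp at this
    · exact ⟨_, by simp, h⟩
    · exact ⟨_, by simp, h⟩

/-- A union of faces that contains both end faces, but not all faces, is a generalized inner horn.
Further faces are added one at a time: the face `i` meets the previous union in a union of the same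
kind, one dimension lower. -/
lemma isLocalPair_faces (n : ℕ) : ∀ S : Finset (Fin (n + 1)), 0 ∈ S → Fin.last n ∈ S →
    S ≠ Finset.univ → X.IsLocalPair (faces S : (Δ[n] : SSet.{u}).Subcomplex) ⊤ := by
  induction n with
  | zero =>
    intro S h0 _ hS
    refine (hS (Finset.eq_univ_of_forall fun i ↦ ?_)).elim
    rwa [show i = 0 from Fin.ext (by omega)]
  | succ n ih =>
    suffices H : ∀ T : Finset (Fin (n + 2)), ∀ S : Finset (Fin (n + 2)), S = T ∪ {0, Fin.last _} →
        S ≠ Finset.univ → X.IsLocalPair (faces S : (Δ[n + 1] : SSet.{u}).Subcomplex) ⊤ by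
      intro S h0 hl hS
      exact H S S (by
        refine (Finset.union_eq_left.2 fun i hi ↦ ?_).symm
        obtain rfl | rfl : i = 0 ∨ i = Fin.last _ := by simpa using hi
        exacts [h0, hl]) hS
    intro T
    induction T using Finset.induction with
    | empty =>
      rintro S rfl hS
      -- In dimension one the two end faces are all the faces, which is excluded.
      obtain _ | n := n
      · refine (hS ?_).elim
        decide
      · simpa using isLocalPair_faces_ends hX hX' n
    | insert i T hi ihT =>
      intro S hS hS'
      by_cases hiT : i ∈ T ∪ {0, Fin.last _}
      · exact ihT S (by rw [hS, Finset.insert_union, Finset.insert_eq_of_mem hiT]) hS'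
      set S' := T ∪ {0, Fin.last _} with hS'def
      have hSS : S = insert i S' := by rw [hS, Finset.insert_union]
      have h1 := ihT S' rfl (fun h ↦ hiT (h ▸ Finset.mem_univ _))
      have hi0 : i ≠ 0 := by rintro rfl; exact hiT (by simp [hS'def])
      have hil : i ≠ Fin.last _ := by rintro rfl; exact hiT (by simp [hS'def])
      have h2 := isLocalPair_top_of_δ (X := X) (B := faces S') i
        (ih (Finset.univ.filter fun k ↦ i.succAbove k ∈ S') ?_ ?_ ?_) ?_
      · have h3 := hX.isLocalPair_of_trans h2 le_top h1
        convert h3 using 1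
        refine subcomplex_ext fun m x ↦ ?_
        have e : x ∈ (faces S' ⊔ SSet.Subcomplex.range (SSet.stdSimplex.δ i)).obj (op ⦋m⦌) ↔
          (∃ i ∈ S', ∀ k, x k ≠ i) ∨ ∀ k, x k ≠ i := or_congr (mem_faces _ _) (mem_range_δ' _ _)
        rw [e, mem_faces, hSS]
        simp [or_comm]
      · simp only [Finset.mem_filter_univ, Fin.succAbove_ne_zero_zero hi0]
        simp [hS'def]
      · simp only [Finset.mem_filter_univ, Fin.succAbove_ne_last_last hil]
        simp [hS'def]
      · intro h
        refine hS' (Finset.eq_univ_of_forall fun j ↦ ?_)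
        rw [hSS]
        by_cases hj : j = i
        · simp [hj]
        · obtain ⟨k, rfl⟩ := Fin.exists_succAbove_eq hj
          have : k ∈ Finset.univ.filter fun k ↦ i.succAbove k ∈ S' := by
            rw [h]; exact Finset.mem_univ _
          exact Finset.mem_insert_of_mem (by simpa using this)
      · refine subcomplex_ext fun m x ↦ ?_
        rw [mem_faces]
        refine Iff.trans (mem_faces _ _) ⟨?_, ?_⟩
        · rintro ⟨j, hj, h⟩
          have hji : j ≠ i := fun h' ↦ hiT (h' ▸ hj)
          obtain ⟨k, rfl⟩ := Fin.exists_succAbove_eq hji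
          exact ⟨k, by simpa using hj, fun l hl ↦ h l (congrArg i.succAbove hl)⟩
        · rintro ⟨k, hk, h⟩
          exact ⟨i.succAbove k, by simpa using hk, fun l hl ↦
            h l (Fin.succAbove_right_injective hl)⟩

lemma isLocal_innerHorn {n : ℕ} (i : Fin (n + 3)) (h0 : 0 < i) (hn : i < Fin.last (n + 2)) :
    X.IsLocal (Λ[n + 2, i].ι : _ ⟶ (Δ[n + 2] : SSet.{u})) := by
  rw [← isLocalPair_top_iff]
  convert isLocalPair_faces hX hX' (n + 2) (Finset.univ.erase i) (by simp [h0.ne])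
    (by simp [hn.ne']) (fun h ↦ Finset.notMem_erase i _ (h ▸ Finset.mem_univ i)) using 1
  refine subcomplex_ext fun m x ↦ ?_
  rw [mem_faces, SSet.mem_horn_iff_notMem_range]
  simp

lemma isLocal_of_innerAnodyne {K L : SSet.{u}} {i : K ⟶ L} (hi : SSet.innerAnodyneExtensions i) :
    X.IsLocal i := by
  rw [isLocal_iff]
  refine fun n ↦ hi _ ?_
  rintro _ _ _ ⟨i, h0, hn⟩
  exact isLocal_iff _ |>.1 (isLocal_innerHorn hX hX' i h0 hn) n

/-- Inner horns in `K × Δ[2]`. -/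
lemma isLocal_faceFamily (S : SSet.{u}) : X.IsLocal (unionRange (faceFamily (· ≠ (1 : Fin 3)) S)).ι := by
  rw [unionRange_faceFamily]
  exact isLocal_of_innerAnodyne hX hX'
    (SSet.innerAnodyneExtensions_unionProd_ι _ _ (.horn_ι (by decide) (by decide)))

end Segal
end

/-! ### Spaces of extensions and of natural transformations -/

noncomputable section

open CategoryTheory Simplicial Opposite MonoidalCategory CartesianMonoidalCategory

variable {X : SimplicialSpace.{u}}

section Family

variable {ι : Type} {A : ι → SSet.{u}} {B P Q : SSet.{u}} {i : ∀ s, A s ⟶ B}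
  {π : P ⟶ Q} {ρ : P ⟶ X.Map B} {η : ∀ s, Q ⟶ X.Map (A s)}

/-- `P` is the space of pairs of a point of `Q` and a diagram of shape `B`, the restriction of
which along the maps `i s` is prescribed by the point of `Q`. -/
structure IsExtensionSpace (i : ∀ s, A s ⟶ B) (η : ∀ s, Q ⟶ X.Map (A s)) (π : P ⟶ Q)
    (ρ : P ⟶ X.Map B) : Prop where
  comm : ∀ s, ρ ≫ X.res (i s) = π ≫ η s
  compatible : ∀ l (q : Q.obj l), Compatible (Y := X.row l) i (fun s ↦ (η s).app l q)
  existsUnique : ∀ l (q : Q.obj l) (H : B ⟶ X.row l), (∀ s, i s ≫ H = (η s).app l q) →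
    ∃! p, ρ.app l p = H ∧ π.app l p = q

/-- The map to the space of diagrams on the union of the images. -/
def toMapUnion (h : ∀ l (q : Q.obj l), Compatible (Y := X.row l) i (fun s ↦ (η s).app l q)) :
    Q ⟶ X.Map (unionRange i) where
  app l := ↾fun q ↦ (glue (h l q) : (unionRange i : SSet) ⟶ X.row l)
  naturality l l' g := by
    refine ConcreteCategory.hom_ext _ _ fun q ↦ ?_
    refine unionRange_hom_ext i (Y := X.row l') fun s ↦ ?_
    refine (toUnion_glue (h l' _) s).trans ?_
    refine (app_map (η s) g q).trans ?_
    have := toUnion_glue (h l q) s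
    exact (congrArg (· ≫ X.flip.map g) this.symm).trans (Category.assoc _ _ _)

/-- This reduces the fibration properties of all spaces of diagrams below to one restriction map:
its base change is a Kan fibration by Reedy fibrancy, and a trivial one if the union of the pieces
is local in `B`. -/
lemma IsExtensionSpace.isPullback (h : IsExtensionSpace i η π ρ) :
    IsPullback ρ π (X.res (unionRange i).ι) (toMapUnion h.compatible) := by
  have key : ∀ l (H : B ⟶ X.row l) q, ((unionRange i).ι ≫ H = (glue (h.compatible l q) : _ ⟶ X.row l))
      ↔ ∀ s, i s ≫ H = (η s).app l q := by
    intro l H q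
    constructor
    · intro e s
      rw [← toUnion_ι i s, Category.assoc, e]
      exact toUnion_glue _ s
    · intro e
      refine unionRange_hom_ext i fun s ↦ ?_
      exact (e s).trans (toUnion_glue (h.compatible l q) s).symm
  refine isPullback_of_levelwise (ext_app fun l p ↦ ?_) fun l H q e ↦ ?_
  · exact (key l _ _).2 fun s ↦ app_congr (h.comm s) p
  · exact h.existsUnique l q H ((key l H q).1 e)

lemma IsExtensionSpace.kanFib (h : IsExtensionSpace i η π ρ) (hX : X.IsReedyFibrant) :
    KanFib π := (hX.kanFib_res _).of_isPullback h.isPullback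

lemma IsExtensionSpace.trivFib (h : IsExtensionSpace i η π ρ)
    (hi : X.IsLocal (unionRange i).ι) : TrivFib π := TrivFib.of_isPullback h.isPullback hi

end Family

lemma baseTo_map {l l' : SimplexCategoryᵒᵖ} (g : l ⟶ l') :
    X.baseTo l ≫ X.flip.map g = X.baseTo l' := by
  rw [baseTo, baseTo, ← fromZero_comp g, CategoryTheory.Functor.map_comp]

/-- A constant family of diagrams. -/
abbrev constMap {K Q : SSet.{u}} (φ : K ⟶ X.base) : Q ⟶ X.Map K :=
  SSet.const (Y := X.Map K) φ

/-- The space of natural transformations between two fixed diagrams. -/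
def Sec {K : SSet.{u}} (χ : Fin 2 → (K ⟶ X.base)) : (X.Map (K ⊗ Δ[1])).Subcomplex where
  obj l := {H | ∀ i, endIncl i K ≫ (H : K ⊗ Δ[1] ⟶ X.row l) = χ i ≫ X.baseTo l}
  map g _ h i := by
    refine (Category.assoc _ _ _).symm.trans ((congrArg (· ≫ X.flip.map g) (h i)).trans ?_)
    exact (Category.assoc _ _ _).trans (congrArg _ (baseTo_map g))

/-- The underlying transformation. -/
abbrev Sec.hom {K : SSet.{u}} {χ : Fin 2 → (K ⟶ X.base)} {l : SimplexCategoryᵒᵖ}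
    (H : (Sec χ : SSet).obj l) : (K ⊗ Δ[1] : SSet) ⟶ X.row l := H.1

lemma mem_sec {K : SSet.{u}} {χ : Fin 2 → (K ⟶ X.base)} {l : SimplexCategoryᵒᵖ}
    (H : (K ⊗ Δ[1] : SSet) ⟶ X.row l) :
    H ∈ (Sec χ).obj l ↔ ∀ i, endIncl i K ≫ H = χ i ≫ X.baseTo l := Iff.rfl

lemma Sec.endIncl_hom {K : SSet.{u}} {χ : Fin 2 → (K ⟶ X.base)} {l : SimplexCategoryᵒᵖ}
    (H : (Sec χ : SSet).obj l) (i : Fin 2) : endIncl i K ≫ Sec.hom H = χ i ≫ X.baseTo l :=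
  (mem_sec _).1 H.2 i

lemma Sec.ext {K : SSet.{u}} {χ : Fin 2 → (K ⟶ X.base)} {l : SimplexCategoryᵒᵖ}
    {H H' : (Sec χ : SSet).obj l} (h : Sec.hom H = Sec.hom H') : H = H' := Subtype.ext h

/-- Restriction of natural transformations. -/
def secMap {K L : SSet.{u}} {χ : Fin 2 → (K ⟶ X.base)} {χ' : Fin 2 → (L ⟶ X.base)} (g : L ⟶ K)
    (h : ∀ i, g ≫ χ i = χ' i) : (Sec χ : SSet) ⟶ Sec χ' :=
  SSet.Subcomplex.lift ((Sec χ).ι ≫ X.res (g ▷ Δ[1])) (by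
    rintro l _ ⟨H, rfl⟩
    refine (mem_sec _).2 fun i ↦ ?_
    change endIncl i L ≫ g ▷ Δ[1] ≫ Sec.hom H = χ' i ≫ X.baseTo l
    rw [← h i, Category.assoc, ← Sec.endIncl_hom H]; rfl)

section

variable (hX : X.IsReedyFibrant)
include hX

/-- Extending a transformation with prescribed ends from `L` to `K` is an extension from `L × Δ[1]`
and the two ends of `K × Δ[1]`. -/
lemma kanFib_secMap {K L : SSet.{u}} {χ : Fin 2 → (K ⟶ X.base)} {χ' : Fin 2 → (L ⟶ X.base)}
    (g : L ⟶ K) [Mono g] (h : ∀ i, g ≫ χ i = χ' i) : KanFib (secMap g h) := by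
  let η : ∀ s, (Sec χ' : SSet) ⟶ X.Map (boxSource L K s) := fun s ↦ match s with
    | none => (Sec χ').ι
    | some e => constMap (χ e)
  have : IsExtensionSpace (boxFamily g) η (secMap g h) (Sec χ).ι := by
    refine ⟨?_, fun l q ↦ ?_, fun l q H hH ↦ ?_⟩
    · rintro (_ | e)
      · rfl
      · exact ext_app fun l H ↦ Sec.endIncl_hom H e
    · have := compatible_boxFamily g (Sec.hom q) (fun e ↦ χ e ≫ X.baseTo l) (fun e ↦ by
        rw [← Category.assoc, h]; exact Sec.endIncl_hom q e)
      have e : (fun s ↦ (η s).app l q) = boxMaps (Sec.hom q) (fun e ↦ χ e ≫ X.baseTo l) := by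
        funext s
        rcases s with _ | e <;> rfl
      exact e ▸ this
    · exact ⟨⟨H, (mem_sec _).2 fun e ↦ hH (some e)⟩, ⟨rfl, Subtype.ext (hH none)⟩,
        fun p hp ↦ Subtype.ext hp.1⟩
  exact this.kanFib hX

omit hX in
lemma kan_of_unique {T : SSet.{u}} (h : ∀ n (x y : T.obj n), x = y) (t : T _⦋0⦌) : Kan T :=
  fun _ _ _ _ _ ↦ ⟨SSet.const t, ext_app fun _ _ ↦ h _ _ _⟩

lemma kan_sec {K : SSet.{u}} (χ : Fin 2 → (K ⟶ X.base)) : Kan (Sec χ : SSet) := by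
  -- Over the empty diagram there is exactly one transformation, so the base of this fibration is a
  -- point.
  refine (kanFib_secMap hX (χ := χ) (⊥ : K.Subcomplex).ι fun _ ↦ rfl).kan
    (kan_of_unique (fun n x y ↦ ?_) ?_)
  · exact Subtype.ext (ext_app (S := (⊥ : K.Subcomplex) ⊗ Δ[1]) (T := X.row n)
      fun m z ↦ z.1.2.elim)
  · exact ⟨fst _ _ ≫ SSet.Subcomplex.isInitialBot.to _,
      (mem_sec _).2 fun i ↦ SSet.Subcomplex.isInitialBot.hom_ext _ _⟩

end

end

/-! ### Triangles of transformations -/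

noncomputable section

open CategoryTheory Simplicial Opposite MonoidalCategory CartesianMonoidalCategory

variable {X : SimplicialSpace.{u}}

/-- The outer vertices of `Δ[2]`. -/
def outer (e : Fin 2) : Fin 3 := if e = 0 then 0 else 2

/-- A vertex of `Δ[2]`, in a product. -/
abbrev vtx (j : Fin 3) (B : SSet.{u}) : B ⟶ B ⊗ Δ[2] :=
  lift (𝟙 B) (SSet.const (SSet.stdSimplex.obj₀Equiv.symm j))

/-- Transformations of two composable arrows `B × Δ[2] → X` with prescribed vertices and a
prescribed outer face. -/
def Tri (e : Fin 2) {B : SSet.{u}} (v : Fin 3 → (B ⟶ X.base)) (h : B ⊗ Δ[1] ⟶ X.base) :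
    (X.Map (B ⊗ Δ[2])).Subcomplex where
  obj l := {H | B ◁ SSet.stdSimplex.δ (outer e) ≫ (H : B ⊗ Δ[2] ⟶ X.row l) = h ≫ X.baseTo l ∧
    ∀ j, vtx j B ≫ (H : B ⊗ Δ[2] ⟶ X.row l) = v j ≫ X.baseTo l}
  map g _ H := by
    refine ⟨?_, fun i ↦ ?_⟩
    · refine (Category.assoc _ _ _).symm.trans ((congrArg (· ≫ X.flip.map g) H.1).trans ?_)
      exact (Category.assoc _ _ _).trans (congrArg _ (baseTo_map g))
    · refine (Category.assoc _ _ _).symm.trans ((congrArg (· ≫ X.flip.map g) (H.2 i)).trans ?_)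
      exact (Category.assoc _ _ _).trans (congrArg _ (baseTo_map g))

variable {e : Fin 2} {B : SSet.{u}} {v : Fin 3 → (B ⟶ X.base)} {h : B ⊗ Δ[1] ⟶ X.base}

lemma mem_tri {l : SimplexCategoryᵒᵖ} (H : (B ⊗ Δ[2] : SSet) ⟶ X.row l) :
    H ∈ (Tri e v h).obj l ↔ B ◁ SSet.stdSimplex.δ (outer e) ≫ H = h ≫ X.baseTo l ∧
      ∀ j, vtx j B ≫ H = v j ≫ X.baseTo l := Iff.rfl

/-- The underlying map. -/
abbrev Tri.hom {l : SimplexCategoryᵒᵖ} (H : (Tri e v h : SSet).obj l) :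
    (B ⊗ Δ[2] : SSet) ⟶ X.row l := H.1

lemma Tri.ext {l : SimplexCategoryᵒᵖ} {H H' : (Tri e v h : SSet).obj l}
    (w : Tri.hom H = Tri.hom H') : H = H' := Subtype.ext w

/-- The faces. -/
def triFace (i : Fin 3) {χ : Fin 2 → (B ⟶ X.base)} (hχ : ∀ x, v (i.succAbove x) = χ x) :
    (Tri e v h : SSet) ⟶ Sec χ :=
  SSet.Subcomplex.lift ((Tri e v h).ι ≫ X.res (B ◁ SSet.stdSimplex.δ i)) (by
    rintro l _ ⟨H, rfl⟩
    refine (mem_sec _).2 fun x ↦ ?_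
    change endIncl x B ≫ B ◁ SSet.stdSimplex.δ i ≫ Tri.hom H = χ x ≫ X.baseTo l
    rw [← Category.assoc, endIncl_whiskerLeft_δ, ← hχ]
    exact ((mem_tri _).1 H.2).2 _)

section

variable (hv : ∀ y, endIncl y B ≫ h = v ((outer e).succAbove y)) (i j : Fin 3) (hij : i ≠ j)
  (hi : i ≠ outer e) (hj : j ≠ outer e) {χ : Fin 2 → (B ⟶ X.base)}
  (hχ : ∀ x, v (i.succAbove x) = χ x)

include hv hi hj hij

/-- The face `outer e` is fixed, so prescribing the face `i` as well leaves a horn that misses only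
the face `j`. -/
lemma isExtensionSpace_tri : IsExtensionSpace (faceFamily (· ≠ j) B)
    (fun s ↦ if s.1 = i then (Sec χ).ι else constMap h) (triFace (e := e) (h := h) i hχ)
    (Tri e v h).ι := by
  have cases : ∀ s, s ≠ j → s ≠ i → s = outer e := by
    intro s h1 h2
    generalize outer e = k at hi hj ⊢
    omega
  refine ⟨fun s ↦ ?_, fun l q ↦ compatible_faceFamily _ fun s t hst x y hxy ↦ ?_, fun l q H hH ↦ ?_⟩
  · by_cases hs : s.1 = i
    · rw [if_pos hs]
      obtain ⟨s, hs'⟩ := s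
      obtain rfl : s = i := hs
      rfl
    · rw [if_neg hs]
      obtain ⟨s, hs'⟩ := s
      obtain rfl : s = outer e := cases s hs' hs
      exact ext_app fun l H ↦ ((mem_tri _).1 H.2).1
  · have key : ∀ s : {s // s ≠ j}, ∀ x, endIncl x B ≫
        (((if s.1 = i then (Sec χ).ι else constMap h : (Sec χ : SSet) ⟶ X.Map (B ⊗ Δ[1])).app l q) :
          B ⊗ Δ[1] ⟶ X.row l) = v (s.1.succAbove x) ≫ X.baseTo l := by
      intro s x
      by_cases hs : s.1 = i
      · rw [if_pos hs, hs, hχ]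
        exact Sec.endIncl_hom q x
      · rw [if_neg hs, cases s.1 s.2 hs, ← hv]
        exact (Category.assoc _ _ _).symm
    exact (key s x).trans ((congrArg (fun z ↦ v z ≫ X.baseTo l) hxy).trans (key t y).symm)
  · have h1 : B ◁ SSet.stdSimplex.δ i ≫ H = Sec.hom q :=
      (hH ⟨i, hij⟩).trans (by rw [if_pos rfl]; rfl)
    have h2 : B ◁ SSet.stdSimplex.δ (outer e) ≫ H = h ≫ X.baseTo l :=
      (hH ⟨outer e, hj.symm⟩).trans (by rw [if_neg hi.symm]; rfl)
    refine ⟨⟨H, (mem_tri _).2 ⟨h2, fun m ↦ ?_⟩⟩, ⟨rfl, Sec.ext h1⟩,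
        fun p hp ↦ Subtype.ext hp.1⟩
    obtain ⟨x, rfl⟩ | ⟨x, rfl⟩ := (by decide : ∀ i k : Fin 3, i ≠ k → ∀ m : Fin 3,
      (∃ x : Fin 2, i.succAbove x = m) ∨ ∃ x : Fin 2, k.succAbove x = m) i _ hi m
    · rw [vtx, ← endIncl_whiskerLeft_δ, Category.assoc, h1, hχ, Sec.endIncl_hom]
    · rw [vtx, ← endIncl_whiskerLeft_δ, Category.assoc, h2, ← hv, Category.assoc]

end

lemma outer_ne_one (e : Fin 2) : outer e ≠ 1 := by revert e; decide

lemma outer_ne (e : Fin 2) : outer (1 - e) ≠ outer e := by revert e; decide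

section

variable (hX : X.IsReedyFibrant) (hX' : X.IsSegal)
  (hv : ∀ y, endIncl y B ≫ h = v ((outer e).succAbove y)) {χ : Fin 2 → (B ⟶ X.base)}

include hX hv

/-- The prescribed faces form an outer horn, for which only Reedy fibrancy is available. -/
lemma kanFib_triFace_one (hχ : ∀ x, v ((1 : Fin 3).succAbove x) = χ x) :
    KanFib (triFace (e := e) (h := h) 1 hχ) :=
  (isExtensionSpace_tri hv 1 (outer (1 - e)) (outer_ne_one _).symm (outer_ne_one _).symm
    (outer_ne _) hχ).kanFib hX

include hX'

/-- The two outer faces form the inner horn `Λ[2, 1]`, so the Segal condition gives unique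
composition up to a contractible choice. -/
lemma trivFib_triFace_outer (hχ : ∀ x, v ((outer (1 - e)).succAbove x) = χ x) :
    TrivFib (triFace (e := e) (h := h) (outer (1 - e)) hχ) :=
  (isExtensionSpace_tri hv _ 1 (outer_ne_one _) (outer_ne _) (outer_ne_one _).symm hχ).trivFib
    (isLocal_faceFamily hX hX' B)

end

/-- Triangles with a degenerate edge. -/
lemma δ_one_σ (e : Fin 2) : SSet.stdSimplex.δ 1 ≫ SSet.stdSimplex.{u}.σ (1 - e) = 𝟙 _ := by
  fin_cases e
  · exact SSet.stdSimplex.δ_comp_σ_self' (by rfl)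
  · exact SSet.stdSimplex.δ_comp_σ_succ' (by rfl)

lemma δ_outer_σ (e : Fin 2) : SSet.stdSimplex.δ (outer (1 - e)) ≫ SSet.stdSimplex.{u}.σ (1 - e) = 𝟙 _ := by
  fin_cases e
  · exact SSet.stdSimplex.δ_comp_σ_succ' (by rfl)
  · exact SSet.stdSimplex.δ_comp_σ_self' (by rfl)

lemma vtx_σ (e : Fin 2) (j : Fin 3) (B : SSet.{u}) : vtx j B ≫ B ◁ SSet.stdSimplex.σ (1 - e) =
    endIncl ((1 - e).predAbove j) B := rfl

lemma δ_outer_σ_const (e : Fin 2) (B : SSet.{u}) :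
    B ◁ SSet.stdSimplex.δ (outer e) ≫ B ◁ SSet.stdSimplex.{u}.σ (1 - e) =
      fst _ _ ≫ endIncl (1 - e) B := by
  refine ext_app fun n x ↦ Prod.ext rfl ?_
  induction n using Opposite.rec with | op n =>
  induction n using SimplexCategory.rec with | _ n =>
  refine SSet.stdSimplex.ext _ _ fun k ↦ ?_
  exact (by decide : ∀ (e x : Fin 2), Fin.predAbove (1 - e) ((outer e).succAbove x) = 1 - e) e
    ((x.2 : (Δ[1] : SSet.{u}) _⦋n⦌) k)

lemma eq_of_outer {φ : B ⟶ X.base} (hv : ∀ y, v ((outer e).succAbove y) = φ) {a b : Fin 3}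
    (hab : a = b ∨ a ≠ outer e ∧ b ≠ outer e) : v a = v b := by
  obtain rfl | ⟨ha, hb⟩ := hab
  · rfl
  · obtain ⟨x, rfl⟩ := Fin.exists_succAbove_eq ha
    obtain ⟨y, rfl⟩ := Fin.exists_succAbove_eq hb
    rw [hv, hv]

section

variable (hX : X.IsReedyFibrant) (hX' : X.IsSegal) {φ : B ⟶ X.base}
  (hv : ∀ y, v ((outer e).succAbove y) = φ) {χ : Fin 2 → (B ⟶ X.base)}
  (hχ : ∀ x, v ((1 : Fin 3).succAbove x) = χ x)

include hv hχ

/-- Degenerate triangles. -/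
def triDegenerate : (Sec χ : SSet) ⟶ Tri e v (fst _ _ ≫ φ) :=
  SSet.Subcomplex.lift ((Sec χ).ι ≫ X.res (B ◁ SSet.stdSimplex.σ (1 - e))) (by
    rintro l _ ⟨H, rfl⟩
    refine (mem_tri _).2 ⟨?_, fun j ↦ ?_⟩
    · change B ◁ SSet.stdSimplex.δ (outer e) ≫ B ◁ SSet.stdSimplex.σ (1 - e) ≫ Sec.hom H = _
      rw [← Category.assoc, δ_outer_σ_const, Category.assoc, Sec.endIncl_hom, ← hχ, Category.assoc]
      rw [← hv 0, eq_of_outer hv (b := (outer e).succAbove 0)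
        ((by decide : ∀ e : Fin 2, (1 : Fin 3).succAbove (1 - e) = (outer e).succAbove 0 ∨
          (1 : Fin 3).succAbove (1 - e) ≠ outer e ∧ (outer e).succAbove 0 ≠ outer e) e)]
    · change vtx j B ≫ B ◁ SSet.stdSimplex.σ (1 - e) ≫ Sec.hom H = _
      rw [← Category.assoc, vtx_σ, Sec.endIncl_hom, ← hχ]
      rw [eq_of_outer hv (b := j) ((by decide : ∀ (e : Fin 2) (j : Fin 3),
        (1 : Fin 3).succAbove ((1 - e).predAbove j) = j ∨
          (1 : Fin 3).succAbove ((1 - e).predAbove j) ≠ outer e ∧ j ≠ outer e) e j)])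

include hX hX'

/-- An outer horn can be filled when its fixed edge is degenerate: the degeneracy is a common
section of the outer face map and of the face map 1. The former is a trivial fibration by inner horn
filling, so the degeneracy, and with it the latter, is a homotopy equivalence. -/
lemma trivFib_triFace_one : TrivFib (triFace (e := e) (v := v) (h := fst _ _ ≫ φ) 1 hχ) := by
  have hv' : ∀ y, endIncl y B ≫ fst B Δ[1] ≫ φ = v ((outer e).succAbove y) := fun y ↦ by
    rw [hv, ← Category.assoc, endIncl_fst, Category.id_comp]
  have hχ' : ∀ x, v ((outer (1 - e)).succAbove x) = χ x := fun x ↦ by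
    rw [← hχ]
    exact eq_of_outer hv ((by decide : ∀ e x : Fin 2,
      (outer (1 - e)).succAbove x = (1 : Fin 3).succAbove x ∨
        (outer (1 - e)).succAbove x ≠ outer e ∧ (1 : Fin 3).succAbove x ≠ outer e) e x)
  have h1 := trivFib_triFace_outer (h := fst _ _ ≫ φ) hX hX' hv' hχ'
  have e1 : triDegenerate hv hχ ≫ triFace (outer (1 - e)) hχ' = 𝟙 _ :=
    ext_app fun l H ↦ Sec.ext (by
      change B ◁ SSet.stdSimplex.δ (outer (1 - e)) ≫ B ◁ SSet.stdSimplex.σ (1 - e) ≫ Sec.hom H = _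
      rw [← Category.assoc, ← whiskerLeft_comp, δ_outer_σ, whiskerLeft_id, Category.id_comp]; rfl)
  have e2 : triDegenerate hv hχ ≫ triFace 1 hχ = 𝟙 _ :=
    ext_app fun l H ↦ Sec.ext (by
      change B ◁ SSet.stdSimplex.δ 1 ≫ B ◁ SSet.stdSimplex.σ (1 - e) ≫ Sec.hom H = _
      rw [← Category.assoc, ← whiskerLeft_comp, δ_one_σ, whiskerLeft_id, Category.id_comp]; rfl)
  have w : WE (triDegenerate hv hχ) := h1.we.of_comp_right (by rw [e1, WE]; infer_instance)
  exact (kanFib_triFace_one hX hv' hχ).trivFib (kan_sec hX _)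
    (w.of_comp_left (by rw [e2, WE]; infer_instance))

end

end

/-! ### Squares as pairs of triangles -/

noncomputable section

open CategoryTheory Simplicial Opposite MonoidalCategory CartesianMonoidalCategory

section Square

/-- One of the two triangles of the square `Δ[1] × Δ[1]`, in a product. -/
def upper (e : Fin 2) (B : SSet.{u}) : B ⊗ Δ[2] ⟶ (B ⊗ Δ[1]) ⊗ Δ[1] :=
  lift (B ◁ SSet.stdSimplex.σ (1 - e)) (snd _ _ ≫ SSet.stdSimplex.σ e)

/-- The other triangle of the square `Δ[1] × Δ[1]`, in a product. -/
def lower (e : Fin 2) (B : SSet.{u}) : B ⊗ Δ[2] ⟶ (B ⊗ Δ[1]) ⊗ Δ[1] :=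
  lift (B ◁ SSet.stdSimplex.σ e) (snd _ _ ≫ SSet.stdSimplex.σ (1 - e))

variable (e : Fin 2) (B : SSet.{u})

/-- Two maps to `(B × Δ[1]) × Δ[1]` that agree on vertices are equal. -/
lemma square_hom_ext {f g : B ⊗ Δ[1] ⟶ (B ⊗ Δ[1]) ⊗ Δ[1]}
    (h : ∀ n (b : B.obj (op ⦋n⦌)) (x : (Δ[1] : SSet.{u}) _⦋n⦌),
      (f.app _ (b, x)).1.1 = (g.app _ (b, x)).1.1 ∧
      (∀ k : Fin (n + 1), ((f.app _ (b, x)).1.2 : (Δ[1] : SSet.{u}) _⦋n⦌) k =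
        ((g.app _ (b, x)).1.2 : (Δ[1] : SSet.{u}) _⦋n⦌) k) ∧
      (∀ k : Fin (n + 1), ((f.app _ (b, x)).2 : (Δ[1] : SSet.{u}) _⦋n⦌) k =
        ((g.app _ (b, x)).2 : (Δ[1] : SSet.{u}) _⦋n⦌) k)) : f = g := by
  refine ext_app fun n x ↦ ?_
  induction n using Opposite.rec with | op n =>
  induction n using SimplexCategory.rec with | _ n =>
  obtain ⟨h1, h2, h3⟩ := h n x.1 x.2
  exact Prod.ext (Prod.ext h1 (SSet.stdSimplex.ext _ _ h2)) (SSet.stdSimplex.ext _ _ h3)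

lemma δ_outer_upper : B ◁ SSet.stdSimplex.δ (outer e) ≫ upper e B = endIncl (1 - e) B ▷ Δ[1] :=
  square_hom_ext B fun n b x ↦ ⟨rfl,
    fun k ↦ (by decide : ∀ e x : Fin 2, (1 - e).predAbove ((outer e).succAbove x) = 1 - e) e (x k),
    fun k ↦ (by decide : ∀ e x : Fin 2, e.predAbove ((outer e).succAbove x) = x) e (x k)⟩

lemma δ_outer'_upper : B ◁ SSet.stdSimplex.δ (outer (1 - e)) ≫ upper e B = endIncl e (B ⊗ Δ[1]) :=
  square_hom_ext B fun n b x ↦ ⟨rfl,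
    fun k ↦ (by decide : ∀ e x : Fin 2, (1 - e).predAbove ((outer (1 - e)).succAbove x) = x) e (x k),
    fun k ↦ (by decide : ∀ e x : Fin 2, e.predAbove ((outer (1 - e)).succAbove x) = e) e (x k)⟩

lemma δ_outer_lower : B ◁ SSet.stdSimplex.δ (outer e) ≫ lower e B = endIncl (1 - e) (B ⊗ Δ[1]) :=
  square_hom_ext B fun n b x ↦ ⟨rfl,
    fun k ↦ (by decide : ∀ e x : Fin 2, e.predAbove ((outer e).succAbove x) = x) e (x k),
    fun k ↦ (by decide : ∀ e x : Fin 2, (1 - e).predAbove ((outer e).succAbove x) = 1 - e) e (x k)⟩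

lemma δ_outer'_lower :
    B ◁ SSet.stdSimplex.δ (outer (1 - e)) ≫ lower e B = endIncl e B ▷ Δ[1] :=
  square_hom_ext B fun n b x ↦ ⟨rfl,
    fun k ↦ (by decide : ∀ e x : Fin 2, e.predAbove ((outer (1 - e)).succAbove x) = e) e (x k),
    fun k ↦ (by decide : ∀ e x : Fin 2, (1 - e).predAbove ((outer (1 - e)).succAbove x) = x) e (x k)⟩

lemma δ_one_upper : B ◁ SSet.stdSimplex.δ 1 ≫ upper e B = B ◁ SSet.stdSimplex.δ 1 ≫ lower e B :=
  square_hom_ext B fun n b x ↦ ⟨Eq.trans (b := b) rfl rfl,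
    fun k ↦ (by decide : ∀ e x : Fin 2, (1 - e).predAbove ((1 : Fin 3).succAbove x) =
      e.predAbove ((1 : Fin 3).succAbove x)) e (x k),
    fun k ↦ (by decide : ∀ e x : Fin 2, e.predAbove ((1 : Fin 3).succAbove x) =
      (1 - e).predAbove ((1 : Fin 3).succAbove x)) e (x k)⟩

lemma vtx_upper (j : Fin 3) : vtx j B ≫ upper e B =
    endIncl ((1 - e).predAbove j) B ≫ endIncl (e.predAbove j) (B ⊗ Δ[1]) := rfl

lemma vtx_lower (j : Fin 3) : vtx j B ≫ lower e B =
    endIncl (e.predAbove j) B ≫ endIncl ((1 - e).predAbove j) (B ⊗ Δ[1]) := rfl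

/-- The sum of two simplices of `Δ[1]`, as a simplex of `Δ[2]`. -/
def addSimplex {n : ℕ} (s t : (Δ[1] : SSet.{u}) _⦋n⦌) : (Δ[2] : SSet.{u}) _⦋n⦌ :=
  SSet.stdSimplex.objEquiv.symm (SimplexCategory.mkHom
    ⟨fun k ↦ ⟨(s k : ℕ) + t k, by have := (s k).2; have := (t k).2; omega⟩, fun i j hij ↦ by
      have h1 : (s i : ℕ) ≤ s j := SSet.stdSimplex.monotone_apply s hij
      have h2 : (t i : ℕ) ≤ t j := SSet.stdSimplex.monotone_apply t hij
      exact Fin.mk_le_mk.2 (by omega)⟩)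

/-- Two monotone sequences of zeros and ones are comparable, and their sum is the simplex of `Δ[2]`
from which the smaller and the larger one are recovered by the two degeneracies. -/
lemma isCover_square : IsCover (pairMaps (upper e B) (lower e B)) := by
  intro n x
  induction n using Opposite.rec with | op n =>
  induction n using SimplexCategory.rec with | _ n =>
  obtain ⟨⟨b, s⟩, t⟩ := x
  change (Δ[1] : SSet.{u}) _⦋n⦌ at s t
  have aux : ∀ (x : Fin 3) (a b : Fin 2), (x : ℕ) = a + b → a ≤ b →
    Fin.predAbove (0 : Fin 2) x = a ∧ Fin.predAbove (1 : Fin 2) x = b := by decide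
  have hab : (∀ k, s k ≤ t k) ∨ ∀ k, t k ≤ s k := by
    by_contra! h
    obtain ⟨⟨i, hi⟩, ⟨j, hj⟩⟩ := h
    obtain hij | hij := le_total i j
    · have h1 : s _ ≤ s _ := SSet.stdSimplex.monotone_apply s hij
      have h2 : t _ ≤ t _ := SSet.stdSimplex.monotone_apply t hij
      omega
    · have h1 : s _ ≤ s _ := SSet.stdSimplex.monotone_apply s hij
      have h2 : t _ ≤ t _ := SSet.stdSimplex.monotone_apply t hij
      omega
  have h1 : (∀ k, s k ≤ t k) → ∃ z : (B ⊗ Δ[2] : SSet.{u}) _⦋n⦌,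
      (lift (B ◁ SSet.stdSimplex.σ 0) (snd _ _ ≫ SSet.stdSimplex.σ 1) :
        B ⊗ Δ[2] ⟶ (B ⊗ Δ[1]) ⊗ Δ[1]).app _ z = ((b, s), t) := fun h ↦
    ⟨(b, addSimplex s t), Prod.ext (Prod.ext rfl (SSet.stdSimplex.ext _ _ fun k ↦
      (aux (addSimplex s t k) _ _ rfl (h k)).1)) (SSet.stdSimplex.ext _ _ fun k ↦
      (aux (addSimplex s t k) _ _ rfl (h k)).2)⟩
  have h2 : (∀ k, t k ≤ s k) → ∃ z : (B ⊗ Δ[2] : SSet.{u}) _⦋n⦌,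
      (lift (B ◁ SSet.stdSimplex.σ 1) (snd _ _ ≫ SSet.stdSimplex.σ 0) :
        B ⊗ Δ[2] ⟶ (B ⊗ Δ[1]) ⊗ Δ[1]).app _ z = ((b, s), t) := fun h ↦
    ⟨(b, addSimplex t s), Prod.ext (Prod.ext rfl (SSet.stdSimplex.ext _ _ fun k ↦
      (aux (addSimplex t s k) _ _ rfl (h k)).2)) (SSet.stdSimplex.ext _ _ fun k ↦
      (aux (addSimplex t s k) _ _ rfl (h k)).1)⟩
  fin_cases e <;> obtain h | h := hab
  · exact ⟨false, h1 h⟩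
  · exact ⟨true, h2 h⟩
  · exact ⟨true, h1 h⟩
  · exact ⟨false, h2 h⟩

instance : Mono (upper e B) := by
  refine @NatTrans.mono_of_mono_app _ _ _ _ _ _ _ fun n ↦ ?_
  rw [mono_iff_injective]
  induction n using Opposite.rec with | op n =>
  induction n using SimplexCategory.rec with | _ n =>
  intro a b h
  refine Prod.ext (congrArg (fun z ↦ z.1.1) h) (SSet.stdSimplex.ext _ _ fun k ↦ ?_)
  exact (by decide : ∀ (e : Fin 2) (x y : Fin 3), (1 - e).predAbove x = (1 - e).predAbove y →
    e.predAbove x = e.predAbove y → x = y) e _ _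
    (congrArg (fun z ↦ (z.1.2 : (Δ[1] : SSet.{u}) _⦋n⦌) k) h)
    (congrArg (fun z ↦ (z.2 : (Δ[1] : SSet.{u}) _⦋n⦌) k) h)

lemma lower_eq : lower e B = upper (1 - e) B := by
  fin_cases e <;> rfl

instance : Mono (lower e B) := by rw [lower_eq]; infer_instance

/-- The two triangles meet exactly in the diagonal, which is the face opposite to the vertex 1. -/
lemma overlap_square {n} {a b : (B ⊗ Δ[2] : SSet.{u}).obj n}
    (h : (upper e B).app n a = (lower e B).app n b) :
    a = b ∧ ∃ c, (B ◁ SSet.stdSimplex.δ 1).app n c = a := by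
  induction n using Opposite.rec with | op n =>
  induction n using SimplexCategory.rec with | _ n =>
  obtain ⟨a, x⟩ := a
  obtain ⟨b, y⟩ := b
  change (Δ[2] : SSet.{u}) _⦋n⦌ at x y
  obtain rfl : a = b := congrArg (fun z ↦ z.1.1) h
  have key : ∀ k, x k = y k ∧ x k ≠ 1 := fun k ↦
    (by decide : ∀ (e : Fin 2) (x y : Fin 3), (1 - e).predAbove x = e.predAbove y →
      e.predAbove x = (1 - e).predAbove y → x = y ∧ x ≠ 1) e _ _
      (congrArg (fun z ↦ (z.1.2 : (Δ[1] : SSet.{u}) _⦋n⦌) k) h)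
      (congrArg (fun z ↦ (z.2 : (Δ[1] : SSet.{u}) _⦋n⦌) k) h)
  obtain rfl : x = y := SSet.stdSimplex.ext _ _ fun k ↦ (key k).1
  obtain ⟨c, rfl⟩ := (mem_range_δ' (1 : Fin 3) x).2 fun k ↦ (key k).2
  exact ⟨rfl, (a, c), rfl⟩

/-- Maps on a square are pairs of maps on triangles that agree on the diagonal. -/
lemma exists_square {Y : SSet.{u}} (f g : B ⊗ Δ[2] ⟶ Y)
    (w : B ◁ SSet.stdSimplex.δ 1 ≫ f = B ◁ SSet.stdSimplex.δ 1 ≫ g) :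
    ∃ H, upper e B ≫ H = f ∧ lower e B ≫ H = g := by
  obtain ⟨H, hH⟩ := (isCover_square e B).exists_desc (compatible_pair _ _ f g fun n a b hab ↦ by
    obtain ⟨rfl, c, rfl⟩ := overlap_square e B hab
    exact app_congr w c)
  exact ⟨H, hH true, hH false⟩

lemma square_ext {Y : SSet.{u}} {f g : (B ⊗ Δ[1]) ⊗ Δ[1] ⟶ Y} (h : upper e B ≫ f = upper e B ≫ g)
    (h' : lower e B ≫ f = lower e B ≫ g) : f = g :=
  (isCover_square e B).hom_ext (by rintro (_ | _); exacts [h', h])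

end Square

section Cylinder

variable {X : SimplicialSpace.{u}} (hX : X.IsReedyFibrant) (hX' : X.IsSegal)

include hX hX'

/-- Transformations from or to a constant family of diagrams extend over a cylinder. -/
lemma trivFib_secMap_cylinder (e : Fin 2) {B : SSet.{u}} {χ : Fin 2 → (B ⊗ Δ[1] ⟶ X.base)}
    {c : B ⟶ X.base} (hc : χ (1 - e) = fst _ _ ≫ c) :
    TrivFib (secMap (χ := χ) (endIncl (1 - e) B) fun _ ↦ rfl) := by
  let vA : Fin 3 → (B ⟶ X.base) := fun j ↦ endIncl ((1 - e).predAbove j) B ≫ χ (e.predAbove j)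
  let vB : Fin 3 → (B ⟶ X.base) := fun j ↦ endIncl (e.predAbove j) B ≫ χ ((1 - e).predAbove j)
  have hvA : ∀ y, endIncl y B ≫ χ e = vA ((outer (1 - e)).succAbove y) := fun y ↦ by
    dsimp only [vA]
    rw [(by decide : ∀ e y : Fin 2, (1 - e).predAbove ((outer (1 - e)).succAbove y) = y),
      (by decide : ∀ e y : Fin 2, e.predAbove ((outer (1 - e)).succAbove y) = e)]
  have hvB : ∀ y, vB ((outer e).succAbove y) = c := fun y ↦ by
    dsimp only [vB]
    rw [(by decide : ∀ e y : Fin 2, (1 - e).predAbove ((outer e).succAbove y) = 1 - e), hc,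
      ← Category.assoc, endIncl_fst, Category.id_comp]
  have hdiag : ∀ x, vB ((1 : Fin 3).succAbove x) = vA ((1 : Fin 3).succAbove x) := fun x ↦ by
    dsimp only [vA, vB]
    rw [(by decide : ∀ e x : Fin 2, (1 - e).predAbove ((1 : Fin 3).succAbove x) =
      e.predAbove ((1 : Fin 3).succAbove x))]
  let fA : (Sec χ : SSet) ⟶ Tri (1 - e) vA (χ e) :=
    SSet.Subcomplex.lift ((Sec χ).ι ≫ X.res (upper e B)) (by
      rintro l _ ⟨H, rfl⟩
      refine (mem_tri _).2 ⟨?_, fun j ↦ ?_⟩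
      · change B ◁ SSet.stdSimplex.δ (outer (1 - e)) ≫ upper e B ≫ Sec.hom H = _
        rw [← Category.assoc, δ_outer'_upper, Sec.endIncl_hom]
      · change vtx j B ≫ upper e B ≫ Sec.hom H = _
        rw [← Category.assoc, vtx_upper, Category.assoc, Sec.endIncl_hom, Category.assoc])
  let fB : (Sec χ : SSet) ⟶ Tri e vB (fst _ _ ≫ c) :=
    SSet.Subcomplex.lift ((Sec χ).ι ≫ X.res (lower e B)) (by
      rintro l _ ⟨H, rfl⟩
      refine (mem_tri _).2 ⟨?_, fun j ↦ ?_⟩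
      · change B ◁ SSet.stdSimplex.δ (outer e) ≫ lower e B ≫ Sec.hom H = _
        rw [← Category.assoc, δ_outer_lower, Sec.endIncl_hom, hc]
      · change vtx j B ≫ lower e B ≫ Sec.hom H = _
        rw [← Category.assoc, vtx_lower, Category.assoc, Sec.endIncl_hom, Category.assoc])
  -- A square of transformations is a pair of triangles with the same diagonal.
  have sq : IsPullback fA fB (triFace 1 fun _ ↦ rfl) (triFace 1 hdiag) := by
    refine isPullback_of_levelwise (ext_app fun l H ↦ Sec.ext ?_) fun l HA HB hAB ↦ ?_
    · change B ◁ SSet.stdSimplex.δ 1 ≫ upper e B ≫ Sec.hom H =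
        B ◁ SSet.stdSimplex.δ 1 ≫ lower e B ≫ Sec.hom H
      rw [← Category.assoc, δ_one_upper, Category.assoc]
    · obtain ⟨H, h1, h2⟩ := exists_square e B (Tri.hom HA) (Tri.hom HB) (congrArg Sec.hom hAB)
      have hs : ∀ i, endIncl i (B ⊗ Δ[1]) ≫ H = χ i ≫ X.baseTo l := fun i ↦ by
        obtain rfl | rfl : i = e ∨ i = 1 - e :=
          (by decide : ∀ e i : Fin 2, i = e ∨ i = 1 - e) e i
        · rw [← δ_outer'_upper, Category.assoc, h1]
          exact ((mem_tri _).1 HA.2).1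
        · rw [← δ_outer_lower, Category.assoc, h2, hc]
          exact ((mem_tri _).1 HB.2).1
      refine ⟨⟨H, (mem_sec _).2 hs⟩, ⟨Tri.ext h1, Tri.ext h2⟩, fun H' h' ↦ Sec.ext ?_⟩
      exact square_ext e B ((congrArg Tri.hom h'.1).trans h1.symm)
        ((congrArg Tri.hom h'.2).trans h2.symm)
  -- The lower triangle has a degenerate outer edge, because one end is constant along the cylinder;
  -- hence it is determined by the diagonal up to a contractible choice. What remains is the upper
  -- triangle, which is filled from an inner horn.
  have t1 : TrivFib fA := (trivFib_triFace_one hX hX' hvB hdiag).of_isPullback sq.flip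
  have h1 : ∀ x, vA ((outer (1 - (1 - e))).succAbove x) = endIncl (1 - e) B ≫ χ x := fun x ↦ by
    dsimp only [vA]
    rw [(by decide : ∀ e y : Fin 2, (1 - e).predAbove ((outer (1 - (1 - e))).succAbove y) = 1 - e),
      (by decide : ∀ e y : Fin 2, e.predAbove ((outer (1 - (1 - e))).succAbove y) = y)]
  have t2 := trivFib_triFace_outer hX hX' hvA h1
  have e1 : fA ≫ triFace _ h1 = secMap (endIncl (1 - e) B) fun _ ↦ rfl :=
    ext_app fun l H ↦ Sec.ext (by
      change B ◁ SSet.stdSimplex.δ (outer (1 - (1 - e))) ≫ upper e B ≫ Sec.hom H =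
        endIncl (1 - e) B ▷ Δ[1] ≫ Sec.hom H
      rw [← δ_outer_upper, (by decide : ∀ e : Fin 2, 1 - (1 - e) = e), Category.assoc])
  rw [← e1]
  exact t1.comp t2

end Cylinder
end

/-! ### Spaces of cones and their restriction maps -/

noncomputable section

open CategoryTheory Simplicial Opposite MonoidalCategory CartesianMonoidalCategory

variable {X : SimplicialSpace.{u}}

/-- A diagram and a constant diagram, as the two ends of a transformation. -/
def ends (e : Fin 2) {K : SSet.{u}} (D : K ⟶ X.base) (w : X.base _⦋0⦌) (i : Fin 2) : K ⟶ X.base :=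
  if i = e then D else SSet.const w

lemma comp_ends (e : Fin 2) {K L : SSet.{u}} (g : L ⟶ K) {D : K ⟶ X.base} {D' : L ⟶ X.base}
    (h : g ≫ D = D') (w : X.base _⦋0⦌) (i : Fin 2) : g ≫ ends e D w i = ends e D' w i := by
  unfold ends
  split_ifs
  · exact h
  · exact SSet.comp_const _ _

/-- The space of cones over (`e = 1`) or cocones under (`e = 0`) the diagram `D`, with apex `w`. -/
abbrev cones (e : Fin 2) {K : SSet.{u}} (D : K ⟶ X.base) (w : X.base _⦋0⦌) : SSet.{u} :=
  (Sec (ends e D w) : SSet)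

/-- Restriction of cones. -/
abbrev conesRes (e : Fin 2) {K L : SSet.{u}} (g : L ⟶ K) {D : K ⟶ X.base} {D' : L ⟶ X.base}
    (h : g ≫ D = D') (w : X.base _⦋0⦌) : cones e D w ⟶ cones e D' w :=
  secMap g (comp_ends e g h w)

lemma conesRes_comp {e : Fin 2} {K L M : SSet.{u}} {g : L ⟶ K} {k : M ⟶ L} {m : M ⟶ K}
    {D : K ⟶ X.base} {D' : L ⟶ X.base} {D'' : M ⟶ X.base} (h : g ≫ D = D') (h' : k ≫ D' = D'')
    (hm : k ≫ g = m) (w : X.base _⦋0⦌) : conesRes e g h w ≫ conesRes e k h' w =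
      conesRes e m (by rw [← hm, Category.assoc, h, h']) w := by
  subst hm
  rfl

lemma conesRes_id {e : Fin 2} {K : SSet.{u}} {D : K ⟶ X.base} (h : 𝟙 K ≫ D = D)
    (w : X.base _⦋0⦌) : conesRes e (𝟙 K) h w = 𝟙 _ := rfl

instance (e : Fin 2) {K L : SSet.{u}} (g : L ⟶ K) [IsIso g] {D : K ⟶ X.base} {D' : L ⟶ X.base}
    (h : g ≫ D = D') (w : X.base _⦋0⦌) : IsIso (conesRes e g h w) := by
  refine ⟨conesRes e (inv g) (by rw [← h, IsIso.inv_hom_id_assoc]) w, ?_, ?_⟩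
  · exact (conesRes_comp h _ (IsIso.inv_hom_id g) w).trans (conesRes_id _ w)
  · exact (conesRes_comp _ h (IsIso.hom_inv_id g) w).trans (conesRes_id _ w)

/-- Restriction of cones along `g` is a trivial fibration. -/
def ConeTriv (e : Fin 2) {K L : SSet.{u}} (D : K ⟶ X.base) (g : L ⟶ K) : Prop :=
  ∀ w, TrivFib (conesRes e g (rfl : g ≫ D = _) w)

lemma ConeTriv.trivFib {e : Fin 2} {K L : SSet.{u}} {D : K ⟶ X.base} {g : L ⟶ K}
    (H : ConeTriv e D g) {D' : L ⟶ X.base} (h : g ≫ D = D') (w : X.base _⦋0⦌) :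
    TrivFib (conesRes e g h w) := by subst h; exact H w

lemma coneTriv_of_isIso (e : Fin 2) {K L : SSet.{u}} (D : K ⟶ X.base) (g : L ⟶ K) [IsIso g] :
    ConeTriv e D g := fun _ ↦ MorphismProperty.rlp_of_isIso _ _

lemma ConeTriv.comp {e : Fin 2} {K L M : SSet.{u}} {D : K ⟶ X.base} {D' : L ⟶ X.base} {g : L ⟶ K}
    {k : M ⟶ L} {m : M ⟶ K} (hg : ConeTriv e D g) (hk : ConeTriv e D' k) (hD : g ≫ D = D')
    (hm : k ≫ g = m) : ConeTriv e D m := by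
  subst hD hm
  exact fun w ↦ (hg w).comp (hk w)

lemma ConeTriv.of_comp_left {e : Fin 2} {K L M : SSet.{u}} {D : K ⟶ X.base} {D' : L ⟶ X.base}
    {g : L ⟶ K} {k : M ⟶ L} {m : M ⟶ K} (hg : ConeTriv e D g) (h : ConeTriv e D m)
    (hD : g ≫ D = D') (hm : k ≫ g = m) : ConeTriv e D' k := by
  subst hD hm
  exact fun w ↦ TrivFib.of_comp_left (hg w) (h w)

lemma ConeTriv.of_comp_right (hX : X.IsReedyFibrant) {e : Fin 2} {K L M : SSet.{u}} {D : K ⟶ X.base}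
    {D' : L ⟶ X.base} {g : L ⟶ K} {k : M ⟶ L} {m : M ⟶ K} [Mono g] (hk : ConeTriv e D' k)
    (h : ConeTriv e D m) (hD : g ≫ D = D') (hm : k ≫ g = m) : ConeTriv e D g := by
  subst hD hm
  exact fun w ↦ TrivFib.of_comp (kanFib_secMap hX g _) (hk w) (h w)

instance {K L : SSet.{u}} (f : K ⟶ L) [Mono f] (T : SSet.{u}) : Mono (f ▷ T) := by
  refine @NatTrans.mono_of_mono_app _ _ _ _ _ _ _ fun n ↦ ?_
  rw [mono_iff_injective]
  intro a b h
  exact Prod.ext (app_injective f n (congrArg (fun z : (L ⊗ T : SSet).obj n ↦ z.1) h))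
    (congrArg (fun z : (L ⊗ T : SSet).obj n ↦ z.2) h)

/-- Restriction of cones from a subcomplex to a smaller one is a trivial fibration. -/
def TrivPair (e : Fin 2) {L : SSet.{u}} (D : L ⟶ X.base) (A B : L.Subcomplex) : Prop :=
  ∃ h : B ≤ A, ConeTriv e (A.ι ≫ D) (SSet.Subcomplex.homOfLE h)

namespace TrivPair

variable {e : Fin 2} {L : SSet.{u}} {D : L ⟶ X.base} {A B C : L.Subcomplex}

lemma refl (A : L.Subcomplex) : TrivPair e D A A := ⟨le_rfl, coneTriv_of_isIso e _ (𝟙 _)⟩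

lemma trans (h : TrivPair e D A B) (h' : TrivPair e D B C) : TrivPair e D A C :=
  ⟨h'.1.trans h.1, h.2.comp h'.2 rfl rfl⟩

lemma of_trans_left (h : TrivPair e D A B) (h' : TrivPair e D A C) (hCB : C ≤ B) :
    TrivPair e D B C := ⟨hCB, h.2.of_comp_left h'.2 rfl rfl⟩

lemma of_trans_right (hX : X.IsReedyFibrant) (h : TrivPair e D B C) (h' : TrivPair e D A C)
    (hBA : B ≤ A) : TrivPair e D A B :=
  ⟨hBA, h.2.of_comp_right hX h'.2 rfl rfl⟩

/-- Each simplex of a union of subcomplexes lies in one of the two, so cones that agree strictly on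
the intersection glue uniquely. -/
lemma isPullback_cones (e : Fin 2) {L : SSet.{u}} (D : L ⟶ X.base) (A B : L.Subcomplex)
    (w : X.base _⦋0⦌) : IsPullback
      (conesRes e (SSet.Subcomplex.homOfLE le_sup_left : (A : SSet) ⟶ (A ⊔ B : L.Subcomplex))
        (rfl : _ ≫ (A ⊔ B).ι ≫ D = A.ι ≫ D) w)
      (conesRes e (SSet.Subcomplex.homOfLE le_sup_right : (B : SSet) ⟶ (A ⊔ B : L.Subcomplex))
        (rfl : _ ≫ (A ⊔ B).ι ≫ D = B.ι ≫ D) w)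
      (conesRes e (SSet.Subcomplex.homOfLE inf_le_left : ((A ⊓ B : L.Subcomplex) : SSet) ⟶ A)
        (rfl : _ ≫ A.ι ≫ D = (A ⊓ B).ι ≫ D) w)
      (conesRes e (SSet.Subcomplex.homOfLE inf_le_right : ((A ⊓ B : L.Subcomplex) : SSet) ⟶ B)
        (rfl : _ ≫ B.ι ≫ D = (A ⊓ B).ι ≫ D) w) := by
  let iA : (A : SSet) ⟶ (A ⊔ B : L.Subcomplex) := SSet.Subcomplex.homOfLE le_sup_left
  let iB : (B : SSet) ⟶ (A ⊔ B : L.Subcomplex) := SSet.Subcomplex.homOfLE le_sup_right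
  let jA : (A ⊓ B : L.Subcomplex).toSSet ⟶ A := SSet.Subcomplex.homOfLE inf_le_left
  let jB : (A ⊓ B : L.Subcomplex).toSSet ⟶ B := SSet.Subcomplex.homOfLE inf_le_right
  have hc : IsCover (pairMaps (iA ▷ Δ[1]) (iB ▷ Δ[1])) := by
    rintro n ⟨⟨x, hx | hx⟩, t⟩
    · exact ⟨true, (⟨x, hx⟩, t), rfl⟩
    · exact ⟨false, (⟨x, hx⟩, t), rfl⟩
  refine isPullback_of_levelwise rfl fun l x y hxy ↦ ?_
  obtain ⟨H, hH⟩ := hc.exists_desc (compatible_pair _ _ (Sec.hom x) (Sec.hom y) (by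
    rintro n ⟨⟨a, ha⟩, t⟩ ⟨⟨b, hb⟩, t'⟩ hab
    obtain rfl : a = b := congrArg (fun z ↦ z.1.1) hab
    obtain rfl : t = t' := congrArg (fun z ↦ z.2) hab
    exact app_congr (congrArg Sec.hom hxy) (⟨a, ha, hb⟩, t)))
  have h1 : iA ▷ Δ[1] ≫ H = Sec.hom x := hH true
  have h2 : iB ▷ Δ[1] ≫ H = Sec.hom y := hH false
  refine ⟨⟨H, (mem_sec _).2 fun i ↦ ?_⟩, ⟨Sec.ext h1, Sec.ext h2⟩, fun H' hH' ↦ Sec.ext ?_⟩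
  · have hc' : IsCover (pairMaps iA iB) := by
      rintro n ⟨x, hx | hx⟩
      · exact ⟨true, ⟨x, hx⟩, rfl⟩
      · exact ⟨false, ⟨x, hx⟩, rfl⟩
    refine hc'.hom_ext ?_
    rintro (_ | _)
    · change iB ≫ endIncl i _ ≫ H = iB ≫ _ ≫ _
      rw [← Category.assoc, endIncl_natural, Category.assoc, h2, Sec.endIncl_hom,
        ← Category.assoc iB]
      exact congrArg (· ≫ X.baseTo l)
        (comp_ends e iB (rfl : iB ≫ (A ⊔ B).ι ≫ D = B.ι ≫ D) w i).symm
    · change iA ≫ endIncl i _ ≫ H = iA ≫ _ ≫ _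
      rw [← Category.assoc, endIncl_natural, Category.assoc, h1, Sec.endIncl_hom,
        ← Category.assoc iA]
      exact congrArg (· ≫ X.baseTo l)
        (comp_ends e iA (rfl : iA ≫ (A ⊔ B).ι ≫ D = A.ι ≫ D) w i).symm
  · refine hc.hom_ext ?_
    rintro (_ | _)
    · exact (congrArg Sec.hom hH'.2).trans h2.symm
    · exact (congrArg Sec.hom hH'.1).trans h1.symm

/-- Excision. -/
lemma sup (h : TrivPair e D A (A ⊓ B)) : TrivPair e D (A ⊔ B) B :=
  ⟨le_sup_right, fun w ↦ TrivFib.of_isPullback (isPullback_cones e D A B w) (h.2 w)⟩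

end TrivPair

lemma coneTriv_iff_of_iso (e : Fin 2) {K L K' L' : SSet.{u}} {D : K ⟶ X.base} {D' : K' ⟶ X.base}
    {g : L ⟶ K} {g' : L' ⟶ K'} (a : K' ⟶ K) (b : L' ⟶ L) [IsIso a] [IsIso b] (h : a ≫ D = D')
    (w : g' ≫ a = b ≫ g) : ConeTriv e D g ↔ ConeTriv e D' g' := by
  subst h
  have ha := coneTriv_of_isIso e D a
  constructor
  · intro H
    exact ha.of_comp_left (H.comp (coneTriv_of_isIso e _ b) rfl rfl) rfl w
  · intro H
    have h1 : g = inv b ≫ g' ≫ a := by rw [w, IsIso.inv_hom_id_assoc]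
    exact (ha.comp H rfl rfl).comp (coneTriv_of_isIso e _ (inv b)) rfl h1.symm

lemma trivPair_range_iff {e : Fin 2} {K K' L : SSet.{u}} {D : L ⟶ X.base} (g : K ⟶ L) [Mono g]
    (k : K' ⟶ K) [Mono k] :
    TrivPair e D (SSet.Subcomplex.range g) (SSet.Subcomplex.range (k ≫ g)) ↔
      ConeTriv e (g ≫ D) k := by
  have h : SSet.Subcomplex.range (k ≫ g) ≤ SSet.Subcomplex.range g := by
    rintro n _ ⟨x, rfl⟩
    exact ⟨k.app n x, rfl⟩
  exact (exists_prop_of_true h).trans (coneTriv_iff_of_iso e (SSet.Subcomplex.toRange g)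
    (SSet.Subcomplex.toRange (k ≫ g)) rfl rfl)

lemma trivPair_image_iff {e : Fin 2} {K L : SSet.{u}} {D : L ⟶ X.base} (g : K ⟶ L) [Mono g]
    (A B : K.Subcomplex) (hBA : B ≤ A) :
    TrivPair e D (A.image g) (B.image g) ↔ TrivPair e (g ≫ D) A B := by
  have : Mono (A.ι ≫ g) := mono_comp _ _
  have h := trivPair_range_iff (D := D) (e := e) (A.ι ≫ g) (SSet.Subcomplex.homOfLE hBA)
  rw [SSet.Subcomplex.image_eq_range, SSet.Subcomplex.image_eq_range]
  rw [Category.assoc] at h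
  exact h.trans (exists_prop_of_true (p := B ≤ A) (q := fun h ↦ ConeTriv e (A.ι ≫ g ≫ D) (SSet.Subcomplex.homOfLE h)) hBA).symm

lemma trivPair_top_iff {e : Fin 2} {K : SSet.{u}} {D : K ⟶ X.base} (A : K.Subcomplex) :
    TrivPair e D ⊤ A ↔ ConeTriv e D A.ι :=
  (exists_prop_of_true le_top).trans
    (coneTriv_iff_of_iso e (D := D) (g := A.ι) (SSet.Subcomplex.topIso K).hom (𝟙 _) rfl rfl).symm

section

variable (hX : X.IsReedyFibrant) (hX' : X.IsSegal)

include hX hX'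

/-- Maps from an apex into the start of a cylinder extend by composition along it (`e = 1`), and
dually for maps from its end to an apex (`e = 0`). -/
lemma coneTriv_cylinder (e : Fin 2) {B : SSet.{u}} (D : B ⊗ Δ[1] ⟶ X.base) :
    ConeTriv e D (endIncl (1 - e) B) := fun w ↦ by
  have h := trivFib_secMap_cylinder hX hX' e (χ := ends e D w) (c := SSet.const w) (by
    rw [ends, if_neg ((by decide : ∀ e : Fin 2, 1 - e ≠ e) e), SSet.comp_const])
  have aux : ∀ (χ' : Fin 2 → (B ⟶ X.base)) (h' : ∀ i, endIncl (1 - e) B ≫ ends e D w i = χ' i),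
      TrivFib (secMap (endIncl (1 - e) B) h') := by
    intro χ' h'
    obtain rfl : (fun i ↦ endIncl (1 - e) B ≫ ends e D w i) = χ' := funext h'
    exact h
  exact aux _ _

/-- A deformation into `L` that preserves `L`, ending (for `e = 1`) or starting (for `e = 0`) at the
identity. -/
lemma coneTriv_of_deformation (e : Fin 2) {K L : SSet.{u}} (D : K ⟶ X.base) (g : L ⟶ K) [Mono g]
    (c : K ⊗ Δ[1] ⟶ K) (h₁ : endIncl e K ≫ c = 𝟙 K)
    (h₀ : SSet.Subcomplex.range (endIncl (1 - e) K ≫ c) ≤ SSet.Subcomplex.range g)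
    (hr : SSet.Subcomplex.range (g ▷ Δ[1] ≫ c) ≤ SSet.Subcomplex.range g) : ConeTriv e D g := by
  let R₁ := SSet.Subcomplex.range (endIncl (1 - e) K)
  let j : L ⊗ Δ[1] ⟶ K ⊗ Δ[1] := g ▷ Δ[1]
  let R₂ := SSet.Subcomplex.range j
  have hR : R₂ ⊓ R₁ = SSet.Subcomplex.range (endIncl (1 - e) L ≫ j) := by
    ext n x
    constructor
    · rintro ⟨⟨y, rfl⟩, ⟨z, hz⟩⟩
      have h := congrArg (fun z : (K ⊗ Δ[1] : SSet).obj n ↦ z.2) hz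
      exact ⟨y.1, Prod.ext rfl h⟩
    · rintro ⟨y, rfl⟩
      exact ⟨⟨_, rfl⟩, ⟨g.app n y, rfl⟩⟩
  -- Restriction to the end `K × {1 - e}` is trivial both from `K × Δ[1]` and from its union with `L
  -- × Δ[1]`, so the restriction between these two is trivial as well.
  have t₁ : TrivPair e (c ≫ D) ⊤ R₁ := by
    have := (trivPair_range_iff (e := e) (D := c ≫ D) (𝟙 _) (endIncl (1 - e) K)).2
      (by rw [Category.id_comp]; exact coneTriv_cylinder hX hX' e _)
    rwa [Category.comp_id, SSet.Subcomplex.range_eq_top] at this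
  have t₂ : TrivPair e (c ≫ D) (R₂ ⊔ R₁) R₁ := by
    refine TrivPair.sup ?_
    rw [hR]
    exact (trivPair_range_iff _ _).2 (coneTriv_cylinder hX hX' e _)
  have t₃ := (trivPair_top_iff _).1 (t₂.of_trans_right hX t₁ le_top)
  -- The deformation carries this union into `L`, by the two hypotheses on ranges.
  let cM : ((R₂ ⊔ R₁ : (K ⊗ Δ[1]).Subcomplex) : SSet) ⟶ L :=
    SSet.Subcomplex.lift ((R₂ ⊔ R₁).ι ≫ c) (by
      rintro n _ ⟨⟨_, ⟨y, rfl⟩ | ⟨y, rfl⟩⟩, rfl⟩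
      · exact hr _ ⟨y, rfl⟩
      · exact h₀ _ ⟨y, rfl⟩) ≫ inv (SSet.Subcomplex.toRange g)
  have hinv : inv (SSet.Subcomplex.toRange g) ≫ g = (SSet.Subcomplex.range g).ι :=
    (IsIso.inv_comp_eq _).2 rfl
  have hcM : cM ≫ g = (R₂ ⊔ R₁).ι ≫ c :=
    (Category.assoc _ _ _).trans ((congrArg (_ ≫ ·) hinv).trans rfl)
  let k : L ⟶ (R₂ ⊔ R₁ : (K ⊗ Δ[1]).Subcomplex) :=
    SSet.Subcomplex.lift (endIncl e _ ≫ j) (by rintro n _ ⟨x, rfl⟩; exact Or.inl ⟨_, rfl⟩)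
  have hk : k ≫ (R₂ ⊔ R₁).ι = g ≫ endIncl e K := rfl
  have hkc : k ≫ cM = 𝟙 _ := by
    rw [← cancel_mono g, Category.assoc, hcM, ← Category.assoc, hk, Category.assoc, h₁,
      Category.comp_id, Category.id_comp]
  have he : endIncl e K ≫ c ≫ D = D := by rw [← Category.assoc, h₁, Category.id_comp]
  have hM : cM ≫ g ≫ D = (R₂ ⊔ R₁).ι ≫ c ≫ D := by
    rw [← Category.assoc, hcM, Category.assoc]
  have hM' : k ≫ (R₂ ⊔ R₁).ι ≫ c ≫ D = g ≫ D := by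
    rw [← hM, ← Category.assoc, hkc, Category.id_comp]
  intro w
  -- The inclusion of the end `e`, followed by `c`, is the identity; so restriction along `g` is a
  -- retract of the restriction `t₃`.
  refine MorphismProperty.of_retract (P := SSet.modelCategoryQuillen.I.rlp)
    (f := conesRes e g (D := D) rfl w)
    (g := conesRes e (R₂ ⊔ R₁).ι (D := c ≫ D) rfl w) ?_ (t₃ w)
  refine ⟨Arrow.homMk (conesRes e c rfl w) (conesRes e cM hM w) ?_,
    Arrow.homMk (conesRes e (endIncl e K) he w) (conesRes e k hM' w) ?_, ?_⟩
  · exact (conesRes_comp rfl rfl rfl w).trans (conesRes_comp rfl hM hcM w).symm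
  · exact (conesRes_comp rfl hM' rfl w).trans (conesRes_comp he rfl hk.symm w).symm
  · refine Arrow.hom_ext _ _ ?_ ?_
    · exact (conesRes_comp rfl he h₁ w).trans (conesRes_id _ w)
    · exact (conesRes_comp hM hM' hkc w).trans (conesRes_id _ w)

end
end

/-! ### Factorization of cones through a given cone -/

noncomputable section

open CategoryTheory Simplicial Opposite MonoidalCategory CartesianMonoidalCategory

/-- The fibre product. -/
def FibProd {S T B : SSet.{u}} (f : S ⟶ B) (g : T ⟶ B) : (S ⊗ T : SSet).Subcomplex where
  obj n := {x | f.app n x.1 = g.app n x.2}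
  map a x hx := (app_map f a x.1).trans ((congrArg (B.map a) hx).trans (app_map g a x.2).symm)

namespace FibProd

variable {S T B : SSet.{u}} (f : S ⟶ B) (g : T ⟶ B)

/-- The first projection. -/
abbrev fst : (FibProd f g : SSet) ⟶ S := (FibProd f g).ι ≫ CartesianMonoidalCategory.fst S T

/-- The second projection. -/
abbrev snd : (FibProd f g : SSet) ⟶ T := (FibProd f g).ι ≫ CartesianMonoidalCategory.snd S T

lemma isPullback : IsPullback (fst f g) (snd f g) f g :=
  isPullback_of_levelwise (ext_app fun _ x ↦ x.2) fun _ x y h ↦ ⟨⟨(x, y), h⟩, ⟨rfl, rfl⟩,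
    fun _ h' ↦ Subtype.ext (Prod.ext h'.1 h'.2)⟩

variable {f g} in
lemma ext {n} {x y : (FibProd f g : SSet).obj n} (h : x.1.1 = y.1.1) (h' : x.1.2 = y.1.2) :
    x = y := Subtype.ext (Prod.ext h h')

end FibProd

variable {X : SimplicialSpace.{u}}

lemma anodyne_of_J {A B : SSet.{u}} {i : A ⟶ B} (hi : SSet.modelCategoryQuillen.J i) :
    SSet.anodyneExtensions i := MorphismProperty.le_llp_rlp _ _ hi

lemma kanFib_snd {S : SSet.{u}} (hS : Kan S) (T : SSet.{u}) : KanFib (snd S T) := by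
  refine fun A B i hi ↦ ⟨fun {φ ψ} sq ↦ ?_⟩
  obtain ⟨g, hg⟩ := hS (anodyne_of_J hi) (φ ≫ fst _ _)
  refine ⟨⟨⟨lift g ψ, ?_, lift_snd _ _⟩⟩⟩
  rw [comp_lift, hg, ← sq.w]
  exact CartesianMonoidalCategory.hom_ext _ _ (by simp) (by simp)

/-- The vertices of a triangle: `D` at the vertex `outer e`, and `w` at the other outer vertex. -/
def triVertex (e : Fin 2) {K : SSet.{u}} (D : K ⟶ X.base) (w : X.base _⦋0⦌) (m : K ⟶ X.base)
    (j : Fin 3) : K ⟶ X.base :=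
  if j = 1 then m else if j = outer e then D else SSet.const w

section

variable (e : Fin 2) {K : SSet.{u}} (D : K ⟶ X.base) (w : X.base _⦋0⦌) (m : K ⟶ X.base)

lemma triVertex_one (x : Fin 2) :
    triVertex e D w m ((1 : Fin 3).succAbove x) = ends e D w x := by
  fin_cases e <;> fin_cases x <;> rfl

lemma triVertex_outer (x : Fin 2) :
    triVertex e D w m ((outer e).succAbove x) = ends e m w x := by
  fin_cases e <;> fin_cases x <;> rfl

lemma triVertex_outer' (x : Fin 2) :
    triVertex e D w m ((outer (1 - e)).succAbove x) = if x = e then D else m := by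
  fin_cases e <;> fin_cases x <;> rfl

lemma triVertex_outer'_const (x : Fin 2) :
    triVertex e D w (SSet.const w) ((outer (1 - e)).succAbove x) = ends e D w x := by
  fin_cases e <;> fin_cases x <;> rfl

lemma triVertex_outer'_diagram (x : Fin 2) :
    triVertex e D w D ((outer (1 - e)).succAbove x) = D := by
  fin_cases e <;> fin_cases x <;> rfl

lemma triVertex_outer_const (x : Fin 2) :
    triVertex e D w (SSet.const w) ((outer e).succAbove x) = SSet.const w := by
  fin_cases e <;> fin_cases x <;> rfl

end

/-- The map to the point. -/
abbrev toPoint (K : SSet.{u}) : K ⟶ Δ[0] := SSet.stdSimplex.isTerminalObj₀.from K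

/-- A cone over (`e = 1`) or cocone under (`e = 0`) the diagram `D`. -/
structure ConeData (e : Fin 2) {K : SSet.{u}} (D : K ⟶ X.base) where
  apex : X.base _⦋0⦌
  hom : K ⊗ Δ[1] ⟶ X.base
  at_diagram : endIncl e K ≫ hom = D
  at_apex : endIncl (1 - e) K ≫ hom = SSet.const apex

namespace ConeData

variable {e : Fin 2} {K : SSet.{u}} {D : K ⟶ X.base} (c : ConeData e D) (w : X.base _⦋0⦌)

lemma endIncl_hom (y : Fin 2) : endIncl y K ≫ c.hom =
    triVertex e D w (SSet.const c.apex) ((outer (1 - e)).succAbove y) := by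
  rw [triVertex_outer']
  obtain rfl | rfl : y = e ∨ y = 1 - e := (by decide : ∀ e i : Fin 2, i = e ∨ i = 1 - e) e y
  · rw [if_pos rfl, c.at_diagram]
  · rw [if_neg ((by decide : ∀ e : Fin 2, 1 - e ≠ e) e), c.at_apex]

/-- Triangles that extend the cone `c`. -/
abbrev tri : SSet.{u} :=
  (Tri (1 - e) (triVertex e D w (SSet.const c.apex)) c.hom : SSet)

/-- Maps between `w` and the apex. -/
abbrev maps : SSet.{u} := cones e (SSet.const c.apex : Δ[0] ⟶ X.base) w

/-- Maps between the apexes, as constant transformations. -/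
abbrev mapsTo : c.maps w ⟶ Sec (ends e (SSet.const c.apex : K ⟶ X.base) w) :=
  conesRes e (toPoint K) (SSet.comp_const _ _) w

/-- Triangles that extend the cone `c`, the other outer edge of which is constant. -/
abbrev factor : SSet.{u} :=
  (FibProd (c.mapsTo w) (triFace (e := 1 - e) (v := triVertex e D w (SSet.const c.apex))
    (h := c.hom) (outer e) (triVertex_outer e D w _)) : SSet)

/-- The composite cone. -/
abbrev factorTo : c.factor w ⟶ cones e D w :=
  FibProd.snd _ _ ≫ triFace (e := 1 - e) 1 (triVertex_one e D w _)

section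

variable (hX : X.IsReedyFibrant)

include hX

/-- A map between `w` and the apex forms an inner horn with the cone `c`, so the composite is
determined up to a contractible choice. -/
lemma trivFib_factor (hX' : X.IsSegal) : TrivFib (FibProd.fst _ _ : c.factor w ⟶ c.maps w) :=
  ((isExtensionSpace_tri (c.endIncl_hom w) (outer e) 1 (outer_ne_one _)
    ((by decide : ∀ e : Fin 2, outer e ≠ outer (1 - e)) e)
    (outer_ne_one _).symm _).trivFib (isLocal_faceFamily hX hX' K)).of_isPullback
      (FibProd.isPullback _ _).flip

/-- Recording the map between apexes together with the composite prescribes all three faces of the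
triangle; this is a fibration onto a product, followed by a projection away from a Kan complex. -/
lemma kanFib_factorTo : KanFib (c.factorTo w) := by
  let π : c.factor w ⟶ c.maps w ⊗ cones e D w := lift (FibProd.fst _ _) (c.factorTo w)
  let η : ∀ s : {s : Fin 3 // True}, c.maps w ⊗ cones e D w ⟶ X.Map (K ⊗ Δ[1]) := fun s ↦
    if s.1 = 1 then snd _ _ ≫ (Sec (ends e D w)).ι
    else if s.1 = outer e then fst _ _ ≫ c.mapsTo w ≫ (Sec _).ι else constMap c.hom
  have h1 : ∀ s : {s : Fin 3 // True}, s.1 = 1 → η s = snd _ _ ≫ (Sec (ends e D w)).ι :=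
    fun s h ↦ if_pos h
  have h2 : ∀ s : {s : Fin 3 // True}, s.1 = outer e →
      η s = fst _ _ ≫ c.mapsTo w ≫ (Sec _).ι := fun s h ↦
    (if_neg (by rw [h]; exact outer_ne_one e)).trans (if_pos h)
  have h3 : ∀ s : {s : Fin 3 // True}, s.1 = outer (1 - e) → η s = constMap c.hom := fun s h ↦
    (if_neg (by rw [h]; exact outer_ne_one _)).trans (if_neg (by rw [h]; exact outer_ne e))
  have cases : ∀ s : {s : Fin 3 // True}, s.1 = 1 ∨ s.1 = outer e ∨ s.1 = outer (1 - e) :=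
    fun s ↦ (by decide : ∀ (e : Fin 2) (s : Fin 3), s = 1 ∨ s = outer e ∨ s = outer (1 - e)) e s.1
  have : IsExtensionSpace (faceFamily (fun _ ↦ True) K) η π (FibProd.snd _ _ ≫ (Tri _ _ _).ι) := by
    refine ⟨fun s ↦ ?_, fun l q ↦ compatible_faceFamily _ fun s t hst x y hxy ↦ ?_,
      fun l q H hH ↦ ?_⟩
    · obtain h | h | h := cases s
      · rw [h1 s h]
        obtain ⟨s, hs⟩ := s
        obtain rfl : s = 1 := h
        rfl
      · rw [h2 s h]
        obtain ⟨s, hs⟩ := s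
        obtain rfl : s = outer e := h
        exact ext_app fun l x ↦ (congrArg Sec.hom x.2).symm
      · rw [h3 s h]
        obtain ⟨s, hs⟩ := s
        obtain rfl : s = outer (1 - e) := h
        exact ext_app fun l x ↦ ((mem_tri _).1 x.1.2.2).1
    · have key : ∀ s : {s : Fin 3 // True}, ∀ x, endIncl x K ≫
          ((η s).app l q : K ⊗ Δ[1] ⟶ X.row l) =
            triVertex e D w (SSet.const c.apex) (s.1.succAbove x) ≫ X.baseTo l := by
        intro s x
        obtain h | h | h := cases s
        · rw [h1 s h, h, triVertex_one]
          exact Sec.endIncl_hom q.2 x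
        · rw [h2 s h, h, triVertex_outer]
          exact Sec.endIncl_hom ((c.mapsTo w).app l q.1) x
        · rw [h3 s h, h, ← c.endIncl_hom]
          exact (Category.assoc _ _ _).symm
      exact (key s x).trans ((congrArg (fun z ↦ triVertex e D w (SSet.const c.apex) z ≫
        X.baseTo l) hxy).trans (key t y).symm)
    · have w1 : K ◁ SSet.stdSimplex.δ 1 ≫ H = Sec.hom q.2 :=
        (hH ⟨1, trivial⟩).trans (by rw [h1 _ rfl]; rfl)
      have w2 : K ◁ SSet.stdSimplex.δ (outer e) ≫ H = Sec.hom ((c.mapsTo w).app l q.1) :=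
        (hH ⟨outer e, trivial⟩).trans (by rw [h2 _ rfl]; rfl)
      have w3 : K ◁ SSet.stdSimplex.δ (outer (1 - e)) ≫ H = c.hom ≫ X.baseTo l :=
        (hH ⟨outer (1 - e), trivial⟩).trans (by rw [h3 _ rfl]; rfl)
      have hv : ∀ j, vtx j K ≫ H = triVertex e D w (SSet.const c.apex) j ≫ X.baseTo l := by
        intro j
        obtain ⟨x, rfl⟩ | ⟨x, rfl⟩ := (by decide : ∀ (i k : Fin 3), i ≠ k → ∀ m : Fin 3,
          (∃ x : Fin 2, i.succAbove x = m) ∨ ∃ x : Fin 2, k.succAbove x = m) 1 (outer e)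
            (outer_ne_one e).symm j
        · rw [vtx, ← endIncl_whiskerLeft_δ, Category.assoc, w1, triVertex_one, Sec.endIncl_hom]
        · rw [vtx, ← endIncl_whiskerLeft_δ, Category.assoc, w2, triVertex_outer, Sec.endIncl_hom]
      refine ⟨⟨(q.1, ⟨H, (mem_tri _).2 ⟨w3, hv⟩⟩), Sec.ext w2.symm⟩, ⟨rfl, Prod.ext rfl (Sec.ext w1)⟩,
        fun p hp ↦ FibProd.ext (congrArg (fun z ↦ z.1) hp.2) (Tri.ext hp.1)⟩
  have h := this.kanFib hX
  have e1 : c.factorTo w = π ≫ snd _ _ := (lift_snd _ _).symm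
  rw [e1]
  exact h.comp (kanFib_snd (kan_sec hX _) _)

end

/-- Triangles with a degenerate edge at the diagram. -/
abbrev degDiagram (D : K ⟶ X.base) : SSet.{u} :=
  (Tri (1 - e) (triVertex e D w D) (fst _ _ ≫ D) : SSet)

/-- Triangles with a degenerate edge at `w`. -/
abbrev degApex (e : Fin 2) (D : K ⟶ X.base) : SSet.{u} :=
  (Tri e (triVertex e D w (SSet.const w)) (fst _ _ ≫ SSet.const w) : SSet)

section

variable (hX : X.IsReedyFibrant) (hX' : X.IsSegal)

include hX hX'

/-- Together with `trivFib_degDiagram_outer`, this presents the degenerate triangles as a span of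
trivial fibrations from `cones e D w` to itself, along which the base of a fibration can be moved.
The triangles `degApex` play the same role for the edge at `w`. -/
lemma trivFib_degDiagram_one :
    TrivFib (triFace 1 (triVertex_one e D w D) : degDiagram (e := e) w D ⟶ cones e D w) :=
  trivFib_triFace_one hX hX' (triVertex_outer'_diagram e D w) _

lemma trivFib_degApex_one :
    TrivFib (triFace 1 (triVertex_one e D w _) : degApex w e D ⟶ cones e D w) :=
  trivFib_triFace_one hX hX' (triVertex_outer_const e D w) _

lemma trivFib_degDiagram_outer :
    TrivFib (triFace (outer e) (triVertex_outer e D w D) :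
      degDiagram (e := e) w D ⟶ cones e D w) :=
  (isExtensionSpace_tri (fun y ↦ by
      rw [← Category.assoc, endIncl_fst, Category.id_comp, triVertex_outer'_diagram])
    (outer e) 1 (outer_ne_one _) ((by decide : ∀ e : Fin 2, outer e ≠ outer (1 - e)) e)
    (outer_ne_one _).symm _).trivFib (isLocal_faceFamily hX hX' K)

lemma trivFib_degApex_outer :
    TrivFib (triFace (outer (1 - e)) (triVertex_outer'_const e D w) :
      degApex w e D ⟶ cones e D w) :=
  (isExtensionSpace_tri (fun y ↦ by
      rw [← Category.assoc, endIncl_fst, Category.id_comp, triVertex_outer_const])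
    (outer (1 - e)) 1 (outer_ne_one _) (outer_ne e)
    (outer_ne_one _).symm _).trivFib (isLocal_faceFamily hX hX' K)

end

end ConeData

end

/-! ### Mapping spaces between cones as fibers -/

noncomputable section

open CategoryTheory Simplicial Opposite MonoidalCategory CartesianMonoidalCategory

variable {X : SimplicialSpace.{u}}

namespace ConeData

variable {e : Fin 2} {K : SSet.{u}} {D : K ⟶ X.base}

/-- A cone, as an object of the cone space. -/
def obj (c : ConeData e D) : (X.coneSpace e D).base _⦋0⦌ where
  apex := SSet.const c.apex
  homotopy := fst _ _ ≫ c.hom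
  at_diagram := by
    rw [whiskerRight_fst_assoc, c.at_diagram, baseTo_zero, Category.comp_id]
  at_apex := by
    rw [whiskerRight_fst_assoc, c.at_apex, SSet.comp_const, SSet.comp_const]

lemma point_eq {n} (x y : (Δ[0] : SSet.{u}).obj n) : x = y := by
  induction n using Opposite.rec with | op n =>
  induction n using SimplexCategory.rec with | _ n =>
  exact SSet.stdSimplex.ext _ _ fun k ↦ Subsingleton.elim (α := Fin 1) _ _

lemma hom_eq_fst {K Y : SSet.{u}} (H : K ⊗ Δ[0] ⟶ Y) :
    H = fst _ _ ≫ lift (𝟙 K) (toPoint K) ≫ H :=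
  ext_app fun _ x ↦ congrArg (fun y ↦ H.app _ (x.1, y)) (point_eq _ _)

lemma hom_point {Y : SSet.{u}} (H : Δ[0] ⟶ Y) :
    H = SSet.const (H.app _ (SSet.stdSimplex.obj₀Equiv.symm 0)) := by
  refine ext_app fun n x ↦ ?_
  refine (congrArg (fun y ↦ H.app _ y) (point_eq x _)).trans (app_map H _ _)

/-- A vertex of the cone space carries an extra factor `Δ[0]`, which is stripped by inserting its
only point. -/
lemma exists_obj (d : (X.coneSpace e D).base _⦋0⦌) : ∃ c : ConeData e D, c.obj = d := by
  change ConeSimplex X e D (op ⦋0⦌) (op ⦋0⦌) at d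
  refine ⟨⟨d.apex.app _ (SSet.stdSimplex.obj₀Equiv.symm 0), lift (𝟙 _) (toPoint _) ≫ d.homotopy,
    ?_, ?_⟩, ?_⟩
  · have h := congrArg (fun z ↦ lift (𝟙 _) (toPoint _) ≫ z) d.at_diagram
    simp only [baseTo_zero, Category.comp_id, lift_fst_assoc, Category.id_comp] at h
    exact Eq.trans (b := lift (𝟙 K) (toPoint K) ≫ endIncl e K ▷ Δ[0] ≫ d.homotopy) rfl h
  · have h := congrArg (fun z ↦ lift (𝟙 _) (toPoint _) ≫ z) d.at_apex
    simp only [lift_snd_assoc] at h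
    refine Eq.trans ?_ (h.trans ?_)
    · rfl
    · exact (congrArg (fun z ↦ toPoint K ≫ z) (hom_point d.apex)).trans (SSet.comp_const _ _)
  · exact ConeSimplex.ext (hom_point d.apex).symm (hom_eq_fst d.homotopy).symm

lemma δ_eq_iff (c : ConeData e D) {l : SimplexCategoryᵒᵖ} (W : ConeSimplex X e D (op ⦋1⦌) l)
    (i : Fin 2) : SimplicialObject.δ ((X.coneSpace e D).row l) (n := 0) (1 - i) W =
        ((X.coneSpace e D).baseTo l).app _ c.obj ↔
      SSet.stdSimplex.δ (1 - i) ≫ W.apex = SSet.const c.apex ≫ X.baseTo l ∧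
        endIncl i (K ⊗ Δ[1]) ≫ W.homotopy = c.hom ≫ X.baseTo l := by
  have hi : endIncl i (K ⊗ Δ[1]) =
      lift (𝟙 _) (toPoint _) ≫ (K ⊗ Δ[1]) ◁ SSet.stdSimplex.δ (1 - i) := by
    refine ext_app fun n x ↦ Prod.ext rfl ?_
    induction n using Opposite.rec with | op n =>
    induction n using SimplexCategory.rec with | _ n =>
    exact SSet.stdSimplex.ext _ _ fun k ↦
      (by decide : ∀ (i : Fin 2) (k : Fin 1), i = (1 - i).succAbove k) i
        (((toPoint (K ⊗ Δ[1])).app _ x : (Δ[0] : SSet.{u}) _⦋n⦌) k)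
  refine ConeSimplex.ext_iff.trans (and_congr Iff.rfl ?_)
  change (K ⊗ Δ[1]) ◁ SSet.stdSimplex.δ (1 - i) ≫ W.homotopy = (fst _ _ ≫ c.hom) ≫ X.baseTo l ↔ _
  rw [hi, Category.assoc, Category.assoc]
  constructor
  · intro h
    rw [h, lift_fst_assoc, Category.id_comp]
  · intro h
    rw [hom_eq_fst (_ ≫ W.homotopy), h]

/-- Two cones, as the ends of a map. -/
def pair (c d : ConeData e D) (i : Fin 2) : ConeData e D := if i = e then c else d

/-- The space of maps to (`e = 1`) or from (`e = 0`) the cone `c`. -/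
abbrev mapping (c d : ConeData e D) : SSet.{u} :=
  (X.coneSpace e D).mappingSpace (pair c d 0).obj (pair c d 1).obj

section

variable {c d : ConeData e D} {l : SimplexCategoryᵒᵖ}

/-- The underlying simplex. -/
abbrev mapping.simplex (W : (mapping c d).obj l) : ConeSimplex X e D (op ⦋1⦌) l := W.1

lemma mapping.spec (W : (mapping c d).obj l) (i : Fin 2) :
    SSet.stdSimplex.δ (1 - i) ≫ (mapping.simplex W).apex = SSet.const (pair c d i).apex ≫ X.baseTo l ∧
      endIncl i (K ⊗ Δ[1]) ≫ (mapping.simplex W).homotopy = (pair c d i).hom ≫ X.baseTo l := by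
  refine (δ_eq_iff _ _ _).1 ?_
  fin_cases i
  · exact W.2.1
  · exact W.2.2

lemma endIncl_pair (x y : Fin 2) : endIncl y K ≫ (pair c d x).hom =
    if y = e then D else SSet.const (if x = e then c.apex else d.apex) := by
  obtain rfl | rfl : y = e ∨ y = 1 - e := (by decide : ∀ e i : Fin 2, i = e ∨ i = 1 - e) e y
  · rw [if_pos rfl, ConeData.at_diagram]
  · rw [if_neg ((by decide : ∀ e : Fin 2, 1 - e ≠ e) e), ConeData.at_apex, pair]
    split_ifs <;> rfl

lemma triVertex_upper (w : X.base _⦋0⦌) (j : Fin 3) : triVertex e D w (SSet.const c.apex) j =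
    if (1 - e).predAbove j = e then D
      else SSet.const (if e.predAbove j = e then c.apex else w) := by
  fin_cases e <;> fin_cases j <;> rfl

lemma triVertex_lower (w : X.base _⦋0⦌) (j : Fin 3) : triVertex e D w D j =
    if e.predAbove j = e then D
      else SSet.const (if (1 - e).predAbove j = e then c.apex else w) := by
  fin_cases e <;> fin_cases j <;> rfl

lemma ends_pair (i : Fin 2) : ends e (SSet.const c.apex : Δ[0] ⟶ X.base) d.apex i =
    SSet.const (pair c d i).apex := by
  unfold ends pair
  split_ifs <;> rfl

end

/-- A point of the space of cones. -/
def ofCones {w : X.base _⦋0⦌} (b : (cones e D w) _⦋0⦌) : ConeData e D where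
  apex := w
  hom := Sec.hom b
  at_diagram := (Sec.endIncl_hom b e).trans (by
    rw [baseTo_zero, Category.comp_id, ends, if_pos rfl])
  at_apex := (Sec.endIncl_hom b (1 - e)).trans (by
    rw [baseTo_zero, Category.comp_id, ends, if_neg ((by decide : ∀ e : Fin 2, 1 - e ≠ e) e)])

variable (c : ConeData e D) (w : X.base _⦋0⦌)

/-- Squares that extend the cone `c`, with a constant edge and a degenerate edge. -/
abbrev squares : SSet.{u} := (FibProd (c.factorTo w)
  (triFace 1 (triVertex_one e D w D) : degDiagram (e := e) w D ⟶ cones e D w) : SSet)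

/-- The cone at the other end. -/
abbrev squaresTo : c.squares w ⟶ cones e D w :=
  FibProd.snd _ _ ≫ triFace (outer e) (triVertex_outer e D w D)

lemma endIncl_point (i : Fin 2) : endIncl i Δ[0] ≫ snd _ _ = SSet.stdSimplex.{u}.δ (1 - i) := by
  refine ext_app fun n x ↦ ?_
  induction n using Opposite.rec with | op n =>
  induction n using SimplexCategory.rec with | _ n =>
  exact SSet.stdSimplex.ext _ _ fun k ↦
    (by decide : ∀ (i : Fin 2) (k : Fin 1), i = (1 - i).succAbove k) i
      ((x : (Δ[0] : SSet.{u}) _⦋n⦌) k)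

variable {w} in
/-- A map of cones gives a square. -/
def mappingTo (d : ConeData e D) : mapping c d ⟶ c.squares d.apex where
  app l := ↾fun W ↦ by
    refine ⟨(⟨(⟨snd _ _ ≫ (mapping.simplex W).apex, ?_⟩, ⟨upper e K ≫ (mapping.simplex W).homotopy, ?_⟩), ?_⟩,
      ⟨lower e K ≫ (mapping.simplex W).homotopy, ?_⟩), ?_⟩
    · refine (mem_sec _).2 fun i ↦ ?_
      rw [ends_pair, ← (mapping.spec W i).1, ← endIncl_point, Category.assoc]
    · refine (mem_tri _).2 ⟨?_, fun j ↦ ?_⟩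
      · rw [← Category.assoc, δ_outer'_upper, (mapping.spec W e).2, pair, if_pos rfl]
      · rw [← Category.assoc, vtx_upper, Category.assoc, (mapping.spec W _).2, ← Category.assoc,
          endIncl_pair, ← triVertex_upper]
    · refine Sec.ext ?_
      change toPoint K ▷ Δ[1] ≫ snd _ _ ≫ (mapping.simplex W).apex =
        K ◁ SSet.stdSimplex.δ (outer e) ≫ upper e K ≫ (mapping.simplex W).homotopy
      rw [← Category.assoc, ← Category.assoc, δ_outer_upper, (mapping.simplex W).at_apex, whiskerRight_snd]
    · refine (mem_tri _).2 ⟨?_, fun j ↦ ?_⟩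
      · rw [← Category.assoc, δ_outer'_lower, (mapping.simplex W).at_diagram, Category.assoc]
      · rw [← Category.assoc, vtx_lower, Category.assoc, (mapping.spec W _).2, ← Category.assoc,
          endIncl_pair, ← triVertex_lower]
    · refine Sec.ext ?_
      change K ◁ SSet.stdSimplex.δ 1 ≫ upper e K ≫ (mapping.simplex W).homotopy =
        K ◁ SSet.stdSimplex.δ 1 ≫ lower e K ≫ (mapping.simplex W).homotopy
      rw [← Category.assoc, δ_one_upper, Category.assoc]
  naturality _ _ _ := rfl

/-- A map of cones is a square of transformations with a constant edge between the apexes and a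
degenerate edge at the diagram. Cut along the diagonal, this is a point of `squares`, and
`squaresTo` reads off the second cone; so the mapping space is the strict fiber. -/
lemma isPullback_mapping (b : (cones e D w) _⦋0⦌) :
    IsPullback (c.mappingTo (ofCones b)) (toPoint _) (c.squaresTo w) (SSet.const b) := by
  refine isPullback_of_levelwise (ext_app fun l W ↦ Sec.ext ?_) fun l x y hxy ↦ ?_
  · change K ◁ SSet.stdSimplex.δ (outer e) ≫ lower e K ≫ (mapping.simplex W).homotopy = Sec.hom b ≫ X.baseTo l
    rw [← Category.assoc, δ_outer_lower, (mapping.spec W _).2, pair,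
      if_neg ((by decide : ∀ e : Fin 2, 1 - e ≠ e) e)]
    rfl
  · obtain ⟨⟨⟨⟨z, U⟩, hzU⟩, L⟩, hUL⟩ := x
    obtain ⟨H, h1, h2⟩ := exists_square e K (Tri.hom U) (Tri.hom L) (congrArg Sec.hom hUL)
    have hz : toPoint K ▷ Δ[1] ≫ Sec.hom z = endIncl (1 - e) K ▷ Δ[1] ≫ H := by
      rw [← δ_outer_upper, Category.assoc, h1]
      exact congrArg Sec.hom hzU
    have hend : ∀ i, endIncl i (K ⊗ Δ[1]) ≫ H = (pair c (ofCones b) i).hom ≫ X.baseTo l := by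
      intro i
      obtain rfl | rfl : i = e ∨ i = 1 - e := (by decide : ∀ e i : Fin 2, i = e ∨ i = 1 - e) e i
      · rw [← δ_outer'_upper, Category.assoc, h1, pair, if_pos rfl]
        exact ((mem_tri _).1 U.2).1
      · rw [← δ_outer_lower, Category.assoc, h2, pair,
          if_neg ((by decide : ∀ e : Fin 2, 1 - e ≠ e) e)]
        exact congrArg Sec.hom hxy
    let W : ConeSimplex X e D (op ⦋1⦌) l :=
      { apex := lift (toPoint _) (𝟙 _) ≫ Sec.hom z
        homotopy := H
        at_diagram := by
          rw [← Category.assoc (fst _ _)]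
          refine Eq.trans ?_ ((mem_tri _).1 L.2).1
          change endIncl e K ▷ Δ[1] ≫ H = K ◁ SSet.stdSimplex.δ (outer (1 - e)) ≫ Tri.hom L
          rw [← h2, ← δ_outer'_lower, Category.assoc]
        at_apex := by
          refine hz.symm.trans ?_
          rfl }
    have hW : ∀ i, SimplicialObject.δ ((X.coneSpace e D).row l) (n := 0) (1 - i) W =
        ((X.coneSpace e D).baseTo l).app _ (pair c (ofCones b) i).obj := by
      refine fun i ↦ (δ_eq_iff _ _ _).2 ⟨?_, hend i⟩
      rw [← ends_pair]
      refine Eq.trans ?_ (Sec.endIncl_hom z i)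
      rw [← endIncl_point]
      refine ext_app fun n p ↦ congrArg (fun q ↦ (Sec.hom z).app n q) (Prod.ext ?_ ?_)
      · exact point_eq _ _
      · rfl
    refine ⟨⟨W, hW 0, hW 1⟩, ⟨FibProd.ext (FibProd.ext (Sec.ext ?_) (Tri.ext h1)) (Tri.ext h2),
      point_eq _ _⟩, fun W' hW' ↦ Subtype.ext (ConeSimplex.ext ?_ ?_)⟩
    · exact ext_app fun n p ↦ congrArg (fun q ↦ (Sec.hom z).app n q) (Prod.ext (point_eq _ _) rfl)
    · have := congrArg (fun x ↦ Sec.hom x.1.1.1.1) hW'.1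
      change snd _ _ ≫ (mapping.simplex W').apex = Sec.hom z at this
      change (mapping.simplex W').apex = lift (toPoint _) (𝟙 _) ≫ Sec.hom z
      rw [← this, lift_snd_assoc, Category.id_comp]
    · refine square_ext e K (Eq.trans ?_ h1.symm) (Eq.trans ?_ h2.symm)
      · exact congrArg (fun x ↦ Tri.hom x.1.1.1.2) hW'.1
      · exact congrArg (fun x ↦ Tri.hom x.1.2) hW'.1

section

variable (hX : X.IsReedyFibrant) (hX' : X.IsSegal)

include hX hX'

/-- The span of degenerate triangles replaces `factorTo` by `squaresTo`, the fibers of which are the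
mapping spaces; for boundary inclusions, lifting can be tested on fibers. A single `n` is kept in
order to treat truncatedness as well as contractibility. -/
lemma hasLift_factorTo_iff (n : ℕ) : HasLiftingProperty ∂Δ[n].ι (c.factorTo w) ↔
    ∀ (b : (cones e D w) _⦋0⦌) (φ : (∂Δ[n] : SSet.{u}) ⟶ mapping c (ofCones b)),
      ∃ ψ : Δ[n] ⟶ mapping c (ofCones b), ∂Δ[n].ι ≫ ψ = φ := by
  have sq := FibProd.isPullback (c.factorTo w)
    (triFace 1 (triVertex_one e D w D) : degDiagram (e := e) w D ⟶ cones e D w)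
  rw [← hasLift_span_iff sq (c.kanFib_factorTo w hX) (trivFib_degDiagram_one w hX hX')
    (trivFib_degDiagram_outer w hX hX')]
  constructor
  · intro h b φ
    have := hasLift_of_isPullback (c.isPullback_mapping w b) _ h
    obtain ⟨ψ, h1, -⟩ := exists_lift_of ∂Δ[n].ι (toPoint (mapping c (ofCones b))) (f := φ)
      (g := toPoint _) (SSet.stdSimplex.isTerminalObj₀.hom_ext _ _)
    exact ⟨ψ, h1⟩
  · intro h
    refine KanFib.hasLift_of_fibers (((c.kanFib_factorTo w hX).of_isPullback sq).comp
      (trivFib_degDiagram_outer w hX hX').kanFib) n fun b φ hφ ↦ ?_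
    have hφ' : φ ≫ c.squaresTo w = toPoint _ ≫ SSet.const b := hφ.trans (SSet.comp_const _ _).symm
    obtain ⟨ψ, hψ⟩ := h b ((c.isPullback_mapping w b).lift φ (toPoint _) hφ')
    refine ⟨ψ ≫ c.mappingTo (ofCones b), ?_, ?_⟩
    · exact (Category.assoc _ _ _).symm.trans ((congrArg (fun z ↦ z ≫ c.mappingTo (ofCones b))
        hψ).trans (IsPullback.lift_fst _ _ _ _))
    · exact (Category.assoc _ _ _).trans ((congrArg (fun z ↦ ψ ≫ z)
        (c.isPullback_mapping w b).w).trans rfl)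

lemma contractible_iff : (∀ d, IsContractible (mapping c d)) ↔ ∀ w, TrivFib (c.factorTo w) := by
  constructor
  · intro h w
    exact trivFib_iff.2 fun n ↦ (c.hasLift_factorTo_iff w hX hX' n).2 fun b φ ↦ h _ n φ
  · intro h d n φ
    have hd : ∀ i, endIncl i K ≫ d.hom = ends e D d.apex i ≫ X.baseTo (op ⦋0⦌) := by
      intro i
      rw [baseTo_zero, Category.comp_id]
      obtain rfl | rfl : i = e ∨ i = 1 - e := (by decide : ∀ e i : Fin 2, i = e ∨ i = 1 - e) e i
      · rw [d.at_diagram, ends, if_pos rfl]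
      · rw [d.at_apex, ends, if_neg ((by decide : ∀ e : Fin 2, 1 - e ≠ e) e)]
    exact (c.hasLift_factorTo_iff d.apex hX hX' n).1 ((h d.apex).hasLift _)
      ⟨d.hom, (mem_sec _).2 hd⟩ φ

/-- The boundary of `Δ[n + 1]` has a vertex, so a sphere in a mapping space excludes that it is
empty. Only the empty boundary, of `Δ[0]`, is lost. -/
lemma hasLift_factorTo_of_emptyOrContractible
    (h : ∀ d, IsEmpty ((mapping c d) _⦋0⦌) ∨ IsContractible (mapping c d)) (n : ℕ) :
    HasLiftingProperty ∂Δ[n + 1].ι (c.factorTo w) := by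
  refine (c.hasLift_factorTo_iff w hX hX' _).2 fun b φ ↦ ?_
  obtain h | h := h (ofCones b)
  · refine (h.elim (φ.app _ ⟨SSet.stdSimplex.obj₀Equiv.symm 0, ?_⟩))
    rw [SSet.boundary_obj_eq_univ _ _ (by omega)]
    trivial
  · exact h _ φ

end

end ConeData

end

/-! ### Finality of a cone in terms of restriction of cones -/

noncomputable section

open CategoryTheory Simplicial Opposite MonoidalCategory CartesianMonoidalCategory

variable {X : SimplicialSpace.{u}}

/-- A simplicial set `C` that looks like a cone over `K`. -/
structure ConeShape (e : Fin 2) (K C : SSet.{u}) where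
  incl : K ⟶ C
  cyl : K ⊗ Δ[1] ⟶ C
  vert : C _⦋0⦌
  endIncl_cyl : endIncl e K ≫ cyl = incl
  endIncl_cyl' : endIncl (1 - e) K ≫ cyl = SSet.const vert

namespace ConeShape

variable {e : Fin 2} {K C : SSet.{u}} (s : ConeShape e K C) (D : C ⟶ X.base) (w : X.base _⦋0⦌)

/-- The cone given by a diagram. -/
def cone : ConeData e (s.incl ≫ D) where
  apex := D.app _ s.vert
  hom := s.cyl ≫ D
  at_diagram := by rw [← s.endIncl_cyl, Category.assoc]
  at_apex := by rw [← Category.assoc, s.endIncl_cyl', SSet.const_comp]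

/-- The inclusion of the cone point. -/
abbrev point : Δ[0] ⟶ C := SSet.const s.vert

lemma toPoint_point : toPoint K ≫ s.point = endIncl (1 - e) K ≫ s.cyl :=
  (SSet.comp_const _ _).trans s.endIncl_cyl'.symm

lemma triVertex_upper' {K : SSet.{u}} (D : K ⟶ X.base) (w ℓ : X.base _⦋0⦌) (j : Fin 3) :
    triVertex e D w (SSet.const ℓ) j = if e.predAbove j = e then
      (if (1 - e).predAbove j = e then D else SSet.const ℓ) else SSet.const w := by
  fin_cases e <;> fin_cases j <;> rfl

lemma triVertex_lower' {K : SSet.{u}} (D : K ⟶ X.base) (w ℓ : X.base _⦋0⦌) (j : Fin 3) :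
    triVertex e D w (SSet.const w) j = if (1 - e).predAbove j = e then
      (if e.predAbove j = e then D else SSet.const ℓ) else SSet.const w := by
  fin_cases e <;> fin_cases j <;> rfl

lemma endIncl_cyl_ends (a b : Fin 2) : endIncl a K ≫ s.cyl ≫ ends e D w b =
    if b = e then (if a = e then s.incl ≫ D else SSet.const (D.app _ s.vert))
      else SSet.const w := by
  by_cases hb : b = e
  · rw [if_pos hb, ends, if_pos hb]
    by_cases ha : a = e
    · rw [if_pos ha, ha, ← s.endIncl_cyl, Category.assoc]
    · obtain rfl : a = 1 - e := (by decide : ∀ e i : Fin 2, i ≠ e → i = 1 - e) e a ha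
      rw [if_neg ha, ← Category.assoc, s.endIncl_cyl', SSet.const_comp]
  · rw [if_neg hb, ends, if_neg hb, SSet.comp_const, SSet.comp_const]

/-- The two triangles of a cone over a cone: the nondegenerate one. -/
def toTri : cones e D w ⟶ (s.cone D).tri w :=
  SSet.Subcomplex.lift ((Sec (ends e D w)).ι ≫ X.res (upper e K ≫ s.cyl ▷ Δ[1])) (by
    rintro l _ ⟨H, rfl⟩
    refine (mem_tri _).2 ⟨?_, fun j ↦ ?_⟩
    · change K ◁ SSet.stdSimplex.δ (outer (1 - e)) ≫ (upper e K ≫ s.cyl ▷ Δ[1]) ≫ Sec.hom H = _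
      rw [Category.assoc, ← Category.assoc (K ◁ _), δ_outer'_upper, ← Category.assoc,
        ← endIncl_natural, Category.assoc, Sec.endIncl_hom, ends, if_pos rfl]
      exact (Category.assoc _ _ _).symm
    · change vtx j K ≫ (upper e K ≫ s.cyl ▷ Δ[1]) ≫ Sec.hom H = _
      rw [Category.assoc, ← Category.assoc (vtx j K), vtx_upper, Category.assoc,
        ← Category.assoc (endIncl (e.predAbove j) _), ← endIncl_natural, Category.assoc,
        Sec.endIncl_hom, ← Category.assoc, ← Category.assoc, Category.assoc _ s.cyl,
        endIncl_cyl_ends, ← triVertex_upper']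
      rfl)

/-- The two triangles of a cone over a cone: the degenerate one. -/
def toDeg : cones e D w ⟶ ConeData.degApex w e (s.incl ≫ D) :=
  SSet.Subcomplex.lift ((Sec (ends e D w)).ι ≫ X.res (lower e K ≫ s.cyl ▷ Δ[1])) (by
    rintro l _ ⟨H, rfl⟩
    refine (mem_tri _).2 ⟨?_, fun j ↦ ?_⟩
    · change K ◁ SSet.stdSimplex.δ (outer e) ≫ (lower e K ≫ s.cyl ▷ Δ[1]) ≫ Sec.hom H = _
      rw [Category.assoc, ← Category.assoc (K ◁ _), δ_outer_lower, ← Category.assoc,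
        ← endIncl_natural, Category.assoc, Sec.endIncl_hom, ends,
        if_neg ((by decide : ∀ e : Fin 2, 1 - e ≠ e) e), SSet.comp_const, ← Category.assoc,
        SSet.comp_const]
    · change vtx j K ≫ (lower e K ≫ s.cyl ▷ Δ[1]) ≫ Sec.hom H = _
      rw [Category.assoc, ← Category.assoc (vtx j K), vtx_lower, Category.assoc,
        ← Category.assoc (endIncl ((1 - e).predAbove j) _), ← endIncl_natural, Category.assoc,
        Sec.endIncl_hom, ← Category.assoc, ← Category.assoc, Category.assoc _ s.cyl,
        endIncl_cyl_ends, ← triVertex_lower'])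

/-- Restriction to the cone point. -/
abbrev toMaps : cones e D w ⟶ (s.cone D).maps w :=
  conesRes e s.point (SSet.const_comp _ _) w

/-- A cone over a cone, as a factorization. -/
def toFactor : cones e D w ⟶ (s.cone D).factor w :=
  SSet.Subcomplex.lift (lift (s.toMaps D w) (s.toTri D w)) (by
    rintro l _ ⟨H, rfl⟩
    refine Sec.ext ?_
    change toPoint K ▷ Δ[1] ≫ s.point ▷ Δ[1] ≫ Sec.hom H =
      K ◁ SSet.stdSimplex.δ (outer e) ≫ (upper e K ≫ s.cyl ▷ Δ[1]) ≫ Sec.hom H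
    rw [Category.assoc, ← Category.assoc (K ◁ _), δ_outer_upper, ← Category.assoc,
      ← comp_whiskerRight, toPoint_point, comp_whiskerRight, Category.assoc])

lemma toFactor_comm : s.toFactor D w ≫ (s.cone D).factorTo w =
    s.toDeg D w ≫ triFace 1 (triVertex_one e (s.incl ≫ D) w _) := by
  refine ext_app fun l H ↦ Sec.ext ?_
  change K ◁ SSet.stdSimplex.δ 1 ≫ (upper e K ≫ s.cyl ▷ Δ[1]) ≫ Sec.hom H =
    K ◁ SSet.stdSimplex.δ 1 ≫ (lower e K ≫ s.cyl ▷ Δ[1]) ≫ Sec.hom H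
  rw [Category.assoc, Category.assoc, ← Category.assoc, δ_one_upper, Category.assoc]

lemma toDeg_outer : s.toDeg D w ≫ triFace (outer (1 - e)) (triVertex_outer'_const e _ w) =
    conesRes e s.incl rfl w := by
  refine ext_app fun l H ↦ Sec.ext ?_
  change K ◁ SSet.stdSimplex.δ (outer (1 - e)) ≫ (lower e K ≫ s.cyl ▷ Δ[1]) ≫ Sec.hom H =
    s.incl ▷ Δ[1] ≫ Sec.hom H
  rw [Category.assoc, ← Category.assoc, δ_outer'_lower, ← Category.assoc, ← comp_whiskerRight,
    s.endIncl_cyl]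

section

variable (hX : X.IsReedyFibrant) (hX' : X.IsSegal)

include hX hX'

/-- Factorization through the cone point, in terms of restriction of cones. -/
lemma coneTriv_iff (hs : ConeTriv e D s.point) [Mono s.incl] :
    (∀ w, TrivFib ((s.cone D).factorTo w)) ↔ ConeTriv e D s.incl := by
  refine forall_congr' fun w ↦ ?_
  -- Cones over the whole shape are equivalent to factorizations, as both are determined by their
  -- restriction to the cone point.
  have h1 : WE (s.toFactor D w) :=
    ((s.cone D).trivFib_factor w hX hX').we.of_comp_right (hs.trivFib (SSet.const_comp _ _) w).we
  have h2 := (ConeData.trivFib_degApex_one (e := e) (D := s.incl ≫ D) w hX hX').we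
  have h3 := (ConeData.trivFib_degApex_outer (e := e) (D := s.incl ≫ D) w hX hX').we
  -- Through the degenerate triangles, which are equivalent to cones in two ways, `factorTo` and the
  -- restriction along `incl` become homotopy equivalences simultaneously, by two-out-of-three.
  have e1 := s.toFactor_comm D w
  have e2 := s.toDeg_outer D w
  constructor
  · intro h
    refine (kanFib_secMap hX _ _).trivFib (kan_sec hX _) ?_
    have h4 := h1.comp h.we
    rw [e1] at h4
    have h5 := (h2.of_comp_right h4).comp h3
    rwa [e2] at h5
  · intro h
    refine ((s.cone D).kanFib_factorTo w hX).trivFib (kan_sec hX _) ?_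
    have h4 := h.we
    rw [← e2] at h4
    have h5 := (h3.of_comp_right h4).comp h2
    rw [← e1] at h5
    exact h1.of_comp_left h5

end

/-- The cylinder over a point, as a cone. -/
def cylinder (e : Fin 2) : ConeShape e Δ[0] (Δ[0] ⊗ Δ[1] : SSet.{u}) where
  incl := endIncl e _
  cyl := 𝟙 _
  vert := (endIncl (1 - e) Δ[0]).app _ (SSet.stdSimplex.obj₀Equiv.symm 0)
  endIncl_cyl := Category.comp_id _
  endIncl_cyl' := (Category.comp_id _).trans (ConeData.hom_point _)

/-- For a cylinder over a point, the comparison of cones with factorizations is a strict pullback.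
This gives an equivalence of lifting problems for each `n` separately, where `coneTriv_iff` only
treats all `n` together. -/
lemma isPullback_cylinder (e : Fin 2) (D : (Δ[0] ⊗ Δ[1] : SSet.{u}) ⟶ X.base) (w : X.base _⦋0⦌) :
    IsPullback ((cylinder e).toFactor D w) ((cylinder e).toDeg D w)
      (((cylinder e).cone D).factorTo w) (triFace 1 (triVertex_one e _ w _)) := by
  refine isPullback_of_levelwise (toFactor_comm _ D w) fun l x y hxy ↦ ?_
  obtain ⟨⟨z, U⟩, hzU⟩ := x
  obtain ⟨H, h1, h2⟩ := exists_square e Δ[0] (Tri.hom U) (Tri.hom y) (congrArg Sec.hom hxy)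
  have hs : ∀ i, endIncl i _ ≫ H = ends e D w i ≫ X.baseTo l := by
    intro i
    obtain rfl | rfl : i = e ∨ i = 1 - e := (by decide : ∀ e i : Fin 2, i = e ∨ i = 1 - e) e i
    · rw [← δ_outer'_upper, Category.assoc, h1, ends, if_pos rfl]
      exact ((mem_tri _).1 U.2).1
    · rw [← δ_outer_lower, Category.assoc, h2, ends,
        if_neg ((by decide : ∀ e : Fin 2, 1 - e ≠ e) e)]
      exact ((mem_tri _).1 y.2).1
  have hc : ∀ (f : Δ[0] ⊗ Δ[2] ⟶ (Δ[0] ⊗ Δ[1]) ⊗ Δ[1]),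
      (f ≫ (cylinder.{u} e).cyl ▷ Δ[1]) ≫ H = f ≫ H := fun f ↦ by
    rw [Category.assoc]
    change f ≫ 𝟙 _ ▷ Δ[1] ≫ H = _
    rw [id_whiskerRight, Category.id_comp]
  refine ⟨⟨H, (mem_sec _).2 hs⟩, ⟨FibProd.ext (Sec.ext ?_) (Tri.ext ((hc _).trans h1)),
    Tri.ext ((hc _).trans h2)⟩, fun H' hH' ↦ Sec.ext (square_ext e _ ?_ ?_)⟩
  · change (cylinder.{u} e).point ▷ Δ[1] ≫ H = Sec.hom z
    have h3 : toPoint Δ[0] ▷ Δ[1] ≫ Sec.hom z =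
        Δ[0] ◁ SSet.stdSimplex.δ (outer e) ≫ Tri.hom U := congrArg Sec.hom hzU
    have h4 : toPoint Δ[0] = 𝟙 _ := SSet.stdSimplex.isTerminalObj₀.hom_ext _ _
    rw [h4, id_whiskerRight, Category.id_comp, ← h1, ← Category.assoc, δ_outer_upper] at h3
    rw [h3]
    exact congrArg (fun f ↦ f ▷ Δ[1] ≫ H) (ConeData.hom_point _).symm
  · have : (upper e _ ≫ (cylinder.{u} e).cyl ▷ Δ[1]) ≫ Sec.hom H' = Tri.hom U :=
      congrArg (fun x ↦ Tri.hom x.1.2) hH'.1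
    change (upper e _ ≫ 𝟙 _ ▷ Δ[1]) ≫ Sec.hom H' = Tri.hom U at this
    rw [id_whiskerRight, Category.comp_id] at this
    exact this.trans h1.symm
  · have : (lower e _ ≫ (cylinder.{u} e).cyl ▷ Δ[1]) ≫ Sec.hom H' = Tri.hom y :=
      congrArg Tri.hom hH'.2
    change (lower e _ ≫ 𝟙 _ ▷ Δ[1]) ≫ Sec.hom H' = Tri.hom y at this
    rw [id_whiskerRight, Category.comp_id] at this
    exact this.trans h2.symm

lemma hasLift_cylinder_iff (hX : X.IsReedyFibrant) (hX' : X.IsSegal) (e : Fin 2)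
    (D : (Δ[0] ⊗ Δ[1] : SSet.{u}) ⟶ X.base) (w : X.base _⦋0⦌) (n : ℕ) :
    HasLiftingProperty ∂Δ[n].ι (conesRes e (endIncl e Δ[0]) (rfl : _ ≫ D = _) w) ↔
      HasLiftingProperty ∂Δ[n].ι (((cylinder e).cone D).factorTo w) := by
  rw [← hasLift_span_iff (isPullback_cylinder e D w) (ConeData.kanFib_factorTo _ w hX)
    (ConeData.trivFib_degApex_one w hX hX') (ConeData.trivFib_degApex_outer w hX hX'), toDeg_outer]
  rfl

end ConeShape

end

/-! ### Diagrams on posets: excision and deformation -/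

noncomputable section

open CategoryTheory Simplicial Opposite MonoidalCategory CartesianMonoidalCategory

variable {X : SimplicialSpace.{u}}

section Posets

variable {P Q : Type} [PartialOrder P] [PartialOrder Q]

lemma N_ext {n} {x y : (N.{u} Q).obj n} (h : ∀ i : Fin (n.unop.len + 1), x.down.obj i = y.down.obj i) : x = y :=
  congrArg ULift.up (CategoryTheory.Functor.ext h fun _ _ _ ↦ Subsingleton.elim _ _)

/-- The simplices of the nerve with vertices in a given set. -/
def NS (R : Set Q) : (N.{u} Q).Subcomplex where
  obj _ := {x | ∀ i, x.down.obj i ∈ R}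
  map _ _ hx _ := hx _

lemma mem_NS {R : Set Q} {n} (x : (N.{u} Q).obj n) : x ∈ (NS R).obj n ↔ ∀ i, x.down.obj i ∈ R :=
  Iff.rfl

lemma NS_mono {R R' : Set Q} (h : R ⊆ R') : NS.{u} R ≤ NS R' := fun _ _ hx i ↦ h (hx i)

lemma NS_inter (R R' : Set Q) : NS.{u} R ⊓ NS R' = NS (R ∩ R') := by
  ext n x
  exact ⟨fun h i ↦ ⟨h.1 i, h.2 i⟩, fun h ↦ ⟨fun i ↦ (h i).1, fun i ↦ (h i).2⟩⟩

lemma NS_univ : NS.{u} (Set.univ : Set Q) = ⊤ := by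
  ext n x
  exact ⟨fun _ ↦ trivial, fun _ _ ↦ trivial⟩

/-- A chain in the union that lies in neither part contains an element of `R \ R'` and one of `R' \
R`, and elements of a chain are comparable. -/
lemma NS_union {R R' : Set Q} (h : ∀ a ∈ R, a ∉ R' → ∀ b ∈ R', b ∉ R → ¬ a ≤ b ∧ ¬ b ≤ a) :
    NS.{u} R ⊔ NS R' = NS (R ∪ R') := by
  refine le_antisymm (sup_le (NS_mono Set.subset_union_left) (NS_mono Set.subset_union_right))
    fun n x hx ↦ ?_
  by_contra hc
  have h1 : ¬ ∀ i, x.down.obj i ∈ R := fun h ↦ hc (Or.inl h)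
  have h2 : ¬ ∀ i, x.down.obj i ∈ R' := fun h ↦ hc (Or.inr h)
  obtain ⟨i, hi⟩ := not_forall.1 h1
  obtain ⟨j, hj⟩ := not_forall.1 h2
  have := h _ ((hx j).resolve_right hj) hj _ ((hx i).resolve_left hi) hi
  obtain hij | hij := le_total i j
  · exact this.2 (leOfHom (x.down.map (homOfLE hij)))
  · exact this.1 (leOfHom (x.down.map (homOfLE hij)))

lemma NS_image (p : P →o Q) (hp : ∀ a b, p a ≤ p b → a ≤ b) (R : Set P) :
    (NS.{u} R).image (posetNmap p) = NS (p '' R) := by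
  ext n x
  constructor
  · rintro ⟨y, hy, rfl⟩ i
    exact ⟨_, hy i, rfl⟩
  · intro hx
    choose f hf hf' using hx
    refine ⟨ULift.up (Monotone.functor (f := f) fun i j hij ↦ hp _ _ ?_), hf, N_ext hf'⟩
    rw [hf', hf']
    exact leOfHom (x.down.map (homOfLE hij))

lemma mono_posetNmap (p : P →o Q) (hp : ∀ a b, p a ≤ p b → a ≤ b) : Mono (posetNmap.{u} p) := by
  refine @NatTrans.mono_of_mono_app _ _ _ _ _ _ _ fun n ↦ ?_
  rw [mono_iff_injective]
  intro a b h
  refine N_ext fun i ↦ ?_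
  have h' : p (a.down.obj i) = p (b.down.obj i) :=
    congrArg (fun z : (N.{u} Q).obj n ↦ z.down.obj i) h
  exact le_antisymm (hp _ _ h'.le) (hp _ _ h'.ge)

/-- `r` is the least (`e = 1`) or greatest (`e = 0`) element of `R`. -/
def IsExtremal (e : Fin 2) (r : Q) (R : Set Q) : Prop :=
  r ∈ R ∧ ∀ q ∈ R, (e = 1 → r ≤ q) ∧ (e = 0 → q ≤ r)

/-- `r` moves the elements of `R` down (`e = 1`) or up (`e = 0`), into `R'`. -/
structure IsDeformation (e : Fin 2) (R R' : Set Q) (r : Q → Q) : Prop where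
  subset : R' ⊆ R
  mem : ∀ a ∈ R, r a ∈ R'
  mono : ∀ a ∈ R, ∀ b ∈ R, a ≤ b → r a ≤ r b
  le : ∀ a ∈ R, (e = 1 → r a ≤ a) ∧ (e = 0 → a ≤ r a)

/-- The homotopy given by a deformation, as a map to the nerve. -/
def deformAux {e : Fin 2} {R R' : Set Q} {r : Q → Q} (h : IsDeformation e R R' r) :
    (NS.{u} R : SSet) ⊗ Δ[1] ⟶ N.{u} Q where
  app m := ↾fun x ↦ ULift.up (Monotone.functor
    (f := fun i ↦ if (SSet.stdSimplex.objEquiv x.2).toOrderHom i = e then x.1.1.down.obj i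
      else r (x.1.1.down.obj i)) (by
        intro i j hij
        have h1 := (SSet.stdSimplex.objEquiv x.2).toOrderHom.monotone hij
        have h2 := leOfHom (x.1.1.down.map (homOfLE hij))
        have h3 : ∀ (e a b : Fin 2), a ≤ b → a = e → b ≠ e → e = 0 := by decide
        have h4 : ∀ (e a b : Fin 2), a ≤ b → a ≠ e → b = e → e = 1 := by decide
        dsimp only
        split_ifs with h₁ h₂ h₂
        · exact h2
        · exact h2.trans ((h.le _ (x.1.2 j)).2 (h3 _ _ _ h1 h₁ h₂))
        · exact le_trans ((h.le _ (x.1.2 i)).1 (h4 _ _ _ h1 h₁ h₂)) h2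
        · exact h.mono _ (x.1.2 i) _ (x.1.2 j) h2))
  naturality m m' g := ConcreteCategory.hom_ext _ _ fun x ↦ N_ext fun i ↦ rfl

/-- The homotopy given by a deformation. -/
def deform {e : Fin 2} {R R' : Set Q} {r : Q → Q} (h : IsDeformation e R R' r) :
    (NS.{u} R : SSet) ⊗ Δ[1] ⟶ NS R :=
  SSet.Subcomplex.lift (deformAux h) (by
    rintro n _ ⟨x, rfl⟩
    refine (mem_NS _).2 fun i ↦ ?_
    change (if _ then _ else _) ∈ R
    split_ifs
    · exact x.1.2 i
    · exact h.subset (h.mem _ (x.1.2 i)))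

lemma deform_obj {e : Fin 2} {R R' : Set Q} {r : Q → Q} (h : IsDeformation e R R' r) {n}
    (x : ((NS.{u} R : SSet) ⊗ Δ[1] : SSet).obj n) (i) :
    ((deform h).app n x).1.down.obj i =
      if (SSet.stdSimplex.objEquiv x.2).toOrderHom i = e then x.1.1.down.obj i
      else r (x.1.1.down.obj i) := rfl

variable {e : Fin 2} {D : N.{u} Q ⟶ X.base}

/-- Restriction of cones from the part of the diagram on `R` to the part on `R'` is a trivial
fibration. -/
abbrev TrivOn (e : Fin 2) (D : N.{u} Q ⟶ X.base) (R R' : Set Q) : Prop :=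
  TrivPair e D (NS R) (NS R')

lemma trivOn_sup {R R' : Set Q} (h : TrivOn e D R (R ∩ R'))
    (hR : ∀ a ∈ R, a ∉ R' → ∀ b ∈ R', b ∉ R → ¬ a ≤ b ∧ ¬ b ≤ a) : TrivOn e D (R ∪ R') R' := by
  have h' : TrivPair e D (NS R) (NS R ⊓ NS R') := by rwa [NS_inter]
  have := h'.sup
  rwa [NS_union hR] at this

/-- A pointwise inequality between monotone maps is a homotopy on nerves; here its end `e` is the
identity and its other end lands in `R'`. -/
lemma trivOn_of_isDeformation (hX : X.IsReedyFibrant) (hX' : X.IsSegal) {R R' : Set Q} {r : Q → Q}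
    (h : IsDeformation e R R' r) : TrivOn e D R R' := by
  have key {m} {x : (NS.{u} R : SSet).obj m} (hx : ∀ i, x.1.down.obj i ∈ R') :
      x ∈ (SSet.Subcomplex.range (SSet.Subcomplex.homOfLE (NS_mono.{u} h.subset))).obj m :=
    ⟨⟨x.1, hx⟩, rfl⟩
  refine ⟨NS_mono h.subset, coneTriv_of_deformation hX hX' e _ _ (deform h)
    (ext_app fun n x ↦ Subtype.ext (N_ext fun i ↦ (deform_obj h _ i).trans (if_pos rfl))) ?_ ?_⟩
  · rintro n _ ⟨x, rfl⟩
    refine key fun i ↦ ?_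
    have := (deform_obj h ((endIncl (1 - e) _).app n x) i).trans
      (if_neg ((by decide : ∀ e : Fin 2, 1 - e ≠ e) e))
    exact this ▸ h.mem _ (x.2 i)
  · rintro n _ ⟨x, rfl⟩
    refine key fun i ↦ ?_
    change (if _ then _ else _) ∈ R'
    split_ifs
    · exact x.1.2 i
    · exact h.mem _ (h.subset (x.1.2 i))

lemma trivOn_of_isExtremal (hX : X.IsReedyFibrant) (hX' : X.IsSegal) {r : Q} {R : Set Q}
    (h : IsExtremal e r R) : TrivOn e D R {r} :=
  trivOn_of_isDeformation hX hX' (r := fun _ ↦ r) ⟨Set.singleton_subset_iff.2 h.1, fun _ _ ↦ rfl,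
    fun _ _ _ _ _ ↦ le_rfl, h.2⟩

lemma trivOn_image_iff (p : P →o Q) (hp : ∀ a b, p a ≤ p b → a ≤ b) {R R' : Set P} (h : R' ⊆ R) :
    TrivOn e D (p '' R) (p '' R') ↔ TrivOn e (posetNmap p ≫ D) R R' := by
  have := mono_posetNmap.{u} p hp
  rw [TrivOn, ← NS_image p hp, ← NS_image p hp]
  exact trivPair_image_iff _ _ _ (NS_mono h)

lemma trivOn_univ_iff (p : P →o Q) (hp : ∀ a b, p a ≤ p b → a ≤ b) {R : Set Q}
    (hR : Set.range p = R) : TrivOn e D Set.univ R ↔ ConeTriv e D (posetNmap p) := by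
  have := mono_posetNmap.{u} p hp
  have h1 := trivPair_range_iff (e := e) (D := D) (𝟙 (N Q)) (posetNmap p)
  have h2 : SSet.Subcomplex.range (posetNmap.{u} p) = NS R := by
    rw [← hR, ← Set.image_univ, ← NS_image p hp, NS_univ, SSet.Subcomplex.image_top]
  rw [Category.comp_id, Category.id_comp, h2, SSet.Subcomplex.range_eq_top, ← NS_univ] at h1
  exact h1

end Posets

end

/-! ### Arrows and limit cones in terms of restriction of cones -/

noncomputable section

open CategoryTheory Simplicial Opposite MonoidalCategory CartesianMonoidalCategory

variable {X : SimplicialSpace.{u}}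

/-- Both sections invert pullback along `q` on cones up to homotopy, so triviality passes from one
section to the other. -/
lemma ConeTriv.of_retraction (hX : X.IsReedyFibrant) {e : Fin 2} {K L : SSet.{u}} {D : L ⟶ X.base}
    (q : K ⟶ L) {g₁ g₂ : L ⟶ K} [Mono g₂] (h₁ : g₁ ≫ q = 𝟙 L) (h₂ : g₂ ≫ q = 𝟙 L)
    (h : ConeTriv e (q ≫ D) g₁) : ConeTriv e (q ≫ D) g₂ := fun w ↦ by
  have k₁ : g₁ ≫ q ≫ D = D := by rw [← Category.assoc, h₁, Category.id_comp]
  have k₂ : g₂ ≫ q ≫ D = D := by rw [← Category.assoc, h₂, Category.id_comp]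
  have w₁ : WE (conesRes e q (rfl : q ≫ D = _) w) :=
    (h.trivFib k₁ w).we.of_comp_right (by rw [conesRes_comp rfl k₁ h₁, WE]; infer_instance)
  have w₂ : WE (conesRes e g₂ k₂ w) :=
    w₁.of_comp_left (by rw [conesRes_comp rfl k₂ h₂, WE]; infer_instance)
  have key : ∀ (D' : L ⟶ X.base) (k : g₂ ≫ q ≫ D = D'), D' = D →
      TrivFib (conesRes e g₂ k w) := by
    rintro D' k rfl
    exact (kanFib_secMap hX g₂ _).trivFib (kan_sec hX _) w₂
  exact key _ rfl k₂

/-- The nerve of a linear order, as a simplex. -/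
def toSimplex (n : ℕ) : N.{u} (Fin (n + 1)) ⟶ Δ[n] where
  app _ := ↾fun x ↦ SSet.stdSimplex.objEquiv.symm (SimplexCategory.mkHom
    ⟨fun i ↦ x.down.obj i, fun _ _ h ↦ leOfHom (x.down.map (homOfLE h))⟩)
  naturality _ _ _ := rfl

/-- A simplex, as the nerve of a linear order. -/
def ofSimplex (n : ℕ) : Δ[n] ⟶ N.{u} (Fin (n + 1)) where
  app _ := ↾fun x ↦ ULift.up (Monotone.functor (f := (SSet.stdSimplex.objEquiv x).toOrderHom)
    (SSet.stdSimplex.objEquiv x).toOrderHom.monotone)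
  naturality _ _ _ := rfl

instance (n : ℕ) : IsIso (toSimplex.{u} n) :=
  ⟨ofSimplex n, ext_app fun _ _ ↦ N_ext fun _ ↦ rfl, ext_app fun m x ↦ by
    induction m using Opposite.rec with | op m =>
    induction m using SimplexCategory.rec with | _ m =>
    exact SSet.stdSimplex.ext _ _ fun k ↦ rfl⟩

/-- A map of `X`, as a diagram. -/
abbrev edgeMap (f : X.base _⦋1⦌) : N.{u} (Fin 2) ⟶ X.base :=
  toSimplex 1 ≫ SSet.yonedaEquiv.symm f

/-- The map `f` induces equivalences of spaces of maps to it (`e = 1`) or from it (`e = 0`). -/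
def EquivTriv (e : Fin 2) (f : X.base _⦋1⦌) : Prop :=
  TrivOn (Q := Fin 2) e (edgeMap f) Set.univ {e}

section Edge

variable {Q : Type} [PartialOrder Q] {e : Fin 2} {D : N.{u} Q ⟶ X.base}

lemma posetNmap_edge (p : Fin 2 →o Q) (h : p 0 ≤ p 1) :
    posetNmap p ≫ D = edgeMap (D.app _ (arrow (homOfLE h))) := by
  refine ext_app fun n x ↦ ?_
  have h1 : (posetNmap.{u} p).app n x =
      (N.{u} Q).map (SSet.stdSimplex.objEquiv ((toSimplex 1).app n x)).op (arrow (homOfLE h)) := by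
    refine N_ext fun i ↦ ?_
    change p (x.down.obj i) = (ComposableArrows.mk₁ (homOfLE h)).obj (x.down.obj i)
    generalize x.down.obj i = j
    fin_cases j <;> rfl
  exact (congrArg (fun z ↦ D.app n z) h1).trans (app_map D _ _)

lemma trivOn_pair_iff {a b : Q} (h : a ≤ b) (h' : ¬ b ≤ a) :
    TrivOn e D {a, b} {![a, b] e} ↔ EquivTriv e (D.app _ (arrow (homOfLE h))) := by
  let p : Fin 2 →o Q := ⟨![a, b], by
    intro i j hij
    fin_cases i <;> fin_cases j
    exacts [le_rfl, h, absurd hij (by decide), le_rfl]⟩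
  have hp : ∀ i j, p i ≤ p j → i ≤ j := by
    intro i j hij
    fin_cases i <;> fin_cases j
    exacts [le_rfl, by decide, absurd hij h', le_rfl]
  have h1 : p '' Set.univ = {a, b} := by
    ext q
    simp only [Set.image_univ, Set.mem_range, Fin.exists_fin_two, Set.mem_insert_iff,
      Set.mem_singleton_iff, eq_comm (a := q)]
    rfl
  have h2 := trivOn_image_iff (D := D) (e := e) p hp (Set.subset_univ {e})
  rw [h1, Set.image_singleton, posetNmap_edge p h] at h2
  exact h2

lemma trivOn_pair_one {a b : Q} (h : a ≤ b) (h' : ¬ b ≤ a) :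
    TrivOn 1 D {a, b} {b} ↔ EquivTriv 1 (D.app _ (arrow (homOfLE h))) := trivOn_pair_iff h h'

lemma trivOn_pair_zero {a b : Q} (h : a ≤ b) (h' : ¬ b ≤ a) :
    TrivOn 0 D {a, b} {a} ↔ EquivTriv 0 (D.app _ (arrow (homOfLE h))) := trivOn_pair_iff h h'

end Edge

lemma trivOn_range_iff {Q : Type} [PartialOrder Q] {e : Fin 2} {D : N.{u} Q ⟶ X.base} {R : Set Q}
    {K : SSet.{u}} (g : K ⟶ N Q) [Mono g] (h : SSet.Subcomplex.range g = NS R) :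
    TrivOn e D Set.univ R ↔ ConeTriv e D g := by
  have h1 := trivPair_range_iff (e := e) (D := D) (𝟙 (N Q)) g
  rw [Category.comp_id, Category.id_comp, h, SSet.Subcomplex.range_eq_top, ← NS_univ] at h1
  exact h1

instance mono_point {K : SSet.{u}} (g : Δ[0] ⟶ K) : Mono g :=
  ⟨fun _ _ _ ↦ SSet.stdSimplex.isTerminalObj₀.hom_ext _ _⟩

lemma NS_vertex {Q : Type} [PartialOrder Q] (r : Q) :
    SSet.Subcomplex.range (SSet.const (vertex r) : Δ[0] ⟶ N.{u} Q) = NS {r} := by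
  ext n x
  constructor
  · rintro ⟨y, rfl⟩ i
    exact rfl
  · intro hx
    exact ⟨(SSet.stdSimplex.isTerminalObj₀.from (SSet.stdSimplex.obj n.unop)).app n
      (SSet.stdSimplex.objEquiv.symm (𝟙 _)), N_ext fun i ↦ (hx i).symm⟩

lemma trivOn_vertex_iff {Q : Type} [PartialOrder Q] {e : Fin 2} {D : N.{u} Q ⟶ X.base} {r : Q} :
    TrivOn e D Set.univ {r} ↔ ConeTriv e D (SSet.const (vertex r) : Δ[0] ⟶ N.{u} Q) :=
  trivOn_range_iff _ (NS_vertex r)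

lemma isExtremal_fin (e : Fin 2) : IsExtremal e (1 - e) (Set.univ : Set (Fin 2)) :=
  ⟨trivial, fun q _ ↦ (by decide : ∀ e q : Fin 2, (e = 1 → 1 - e ≤ q) ∧ (e = 0 → q ≤ 1 - e)) e q⟩

lemma edgeMap_σ (x : X.base _⦋0⦌) : edgeMap (X.base.σ 0 x) = toPoint _ ≫ SSet.const x := by
  have h : SSet.yonedaEquiv.symm (X.base.σ 0 x) = SSet.stdSimplex.σ 0 ≫ SSet.const x := by
    refine (SSet.yonedaEquiv_symm_naturality_left (SimplexCategory.σ 0) x).symm.trans ?_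
    rw [SSet.yonedaEquiv_symm_zero]
    rfl
  rw [edgeMap, h, SSet.comp_const, SSet.comp_const, SSet.comp_const]

section

variable (hX : X.IsReedyFibrant) (hX' : X.IsSegal)

include hX hX'

/-- The diagram is pulled back from a point, and both vertices are sections of the map to the point;
for the extremal vertex, restriction is always trivial. -/
lemma equivTriv_σ (e : Fin 2) (x : X.base _⦋0⦌) : EquivTriv e (X.base.σ 0 x) := by
  have h := trivOn_vertex_iff.1 (trivOn_of_isExtremal (e := e) (D := edgeMap (X.base.σ 0 x))
    hX hX' (isExtremal_fin e))
  refine trivOn_vertex_iff.2 ?_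
  rw [edgeMap_σ] at h ⊢
  exact h.of_retraction hX (toPoint _) (SSet.stdSimplex.isTerminalObj₀.hom_ext _ _)
    (SSet.stdSimplex.isTerminalObj₀.hom_ext _ _)

/-- The cone shape of a poset with least element. -/
def coneShape (Q : Type) [PartialOrder Q] [OrderBot Q] :
    ConeShape 1 (N.{u} (NonBot Q)) (N Q) where
  incl := subtypeIncl Q (· ≠ ⊥)
  cyl := coneMap Q
  vert := vertex ⊥
  endIncl_cyl := endIncl_one_coneMap Q
  endIncl_cyl' := endIncl_zero_coneMap Q

/-- The cone shape of a poset with greatest element. -/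
def coconeShape (Q : Type) [PartialOrder Q] [OrderTop Q] :
    ConeShape 0 (N.{u} (NonTop Q)) (N Q) where
  incl := subtypeIncl Q (· ≠ ⊤)
  cyl := coconeMap Q
  vert := vertex ⊤
  endIncl_cyl := endIncl_zero_coconeMap Q
  endIncl_cyl' := endIncl_one_coconeMap Q

omit hX hX' in
lemma mono_subtypeIncl {Q : Type} [PartialOrder Q] (R : Q → Prop) : Mono (subtypeIncl.{u} Q R) :=
  mono_posetNmap.{u} ⟨Subtype.val, Subtype.mono_coe R⟩ fun _ _ h ↦ h

omit hX hX' in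
lemma range_subtypeIncl {Q : Type} [PartialOrder Q] (R : Q → Prop) :
    SSet.Subcomplex.range (subtypeIncl.{u} Q R) = NS {q | R q} := by
  have := NS_image.{u} ⟨(Subtype.val : {q // R q} → Q), Subtype.mono_coe R⟩ (fun _ _ h ↦ h) Set.univ
  rw [NS_univ, SSet.Subcomplex.image_top, Set.image_univ] at this
  refine this.trans (congrArg NS ?_)
  exact Subtype.range_coe

/-- Cones over all of `Q` are determined at the least element, where the apex of `D` sits. Hence
factorization through `D` can be traded for restriction to the rest of `Q`, by
`ConeShape.coneTriv_iff`. -/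
lemma isLimitCone_iff {Q : Type} [PartialOrder Q] [OrderBot Q] (D : N.{u} Q ⟶ X.base) :
    X.IsLimitCone D ↔ TrivOn 1 D Set.univ {q | q ≠ ⊥} := by
  have := mono_subtypeIncl.{u} fun q : Q ↦ q ≠ ⊥
  have h0 : TrivOn 1 D Set.univ {⊥} := trivOn_of_isExtremal hX hX'
    ⟨trivial, fun q _ ↦ ⟨fun _ ↦ bot_le, fun h ↦ absurd h (by decide)⟩⟩
  rw [trivOn_range_iff _ (range_subtypeIncl _)]
  have : Mono (coneShape.{u} Q).incl := this
  have h1 := (coneShape Q).coneTriv_iff D hX hX' (trivOn_vertex_iff.1 h0)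
  refine Iff.trans ?_ h1
  rw [← ConeData.contractible_iff _ hX hX']
  constructor
  · intro h d
    exact h d.obj
  · intro h y
    obtain ⟨d, rfl⟩ := ConeData.exists_obj y
    exact h d

lemma isColimitCocone_iff {Q : Type} [PartialOrder Q] [OrderTop Q] (D : N.{u} Q ⟶ X.base) :
    X.IsColimitCocone D ↔ TrivOn 0 D Set.univ {q | q ≠ ⊤} := by
  have := mono_subtypeIncl.{u} fun q : Q ↦ q ≠ ⊤
  have h0 : TrivOn 0 D Set.univ {⊤} := trivOn_of_isExtremal hX hX'
    ⟨trivial, fun q _ ↦ ⟨fun h ↦ absurd h (by decide), fun _ ↦ le_top⟩⟩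
  rw [trivOn_range_iff _ (range_subtypeIncl _)]
  have : Mono (coconeShape.{u} Q).incl := this
  have h1 := (coconeShape Q).coneTriv_iff D hX hX' (trivOn_vertex_iff.1 h0)
  refine Iff.trans ?_ h1
  rw [← ConeData.contractible_iff _ hX hX']
  constructor
  · intro h d
    exact h d.obj
  · intro h y
    obtain ⟨d, rfl⟩ := ConeData.exists_obj y
    exact h d

end

end

/-! ### Equivalences and truncated maps in terms of restriction of cones -/

noncomputable section

open CategoryTheory Simplicial Opposite MonoidalCategory CartesianMonoidalCategory

variable {X : SimplicialSpace.{u}}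

section Edges

variable {P Q : Type} [PartialOrder P] [PartialOrder Q]

lemma posetNmap_arrow (p : P →o Q) {a b : P} (h : a ≤ b) :
    (posetNmap.{u} p).app _ (arrow (homOfLE h)) = arrow (homOfLE (p.monotone h)) :=
  N_ext fun i ↦ by
    change Fin 2 at i
    fin_cases i <;> rfl

lemma arrow_refl {a b : Q} (h : a ≤ b) (h' : a = b) :
    (arrow (homOfLE h) : (N.{u} Q) _⦋1⦌) = (N.{u} Q).σ 0 (vertex a) := by
  subst h'
  exact N_ext fun i ↦ by
    change Fin 2 at i
    fin_cases i <;> rfl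

lemma arrow_congr {a b c d : Q} (h : a ≤ b) (h' : c ≤ d) (h₁ : a = c) (h₂ : b = d) :
    (arrow (homOfLE h) : (N.{u} Q) _⦋1⦌) = arrow (homOfLE h') := by
  subst h₁ h₂
  rfl

lemma equivTriv_of_eq (hX : X.IsReedyFibrant) (hX' : X.IsSegal) (e : Fin 2)
    (D : N.{u} Q ⟶ X.base) {a b : Q} (h : a ≤ b) (h' : a = b) :
    EquivTriv e (D.app _ (arrow (homOfLE h))) := by
  rw [arrow_refl h h']
  have := equivTriv_σ hX hX' e (D.app _ (vertex a))
  exact (app_map D (SimplexCategory.σ 0).op (vertex a)).symm ▸ this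

lemma simplex_arrow {n : ℕ} (σ : X.base _⦋n⦌) {i j : Fin (n + 1)} (h : i ≤ j)
    (θ : ⦋1⦌ ⟶ ⦋n⦌) (h₀ : θ.toOrderHom 0 = i) (h₁ : θ.toOrderHom 1 = j) :
    (toSimplex.{u} n ≫ SSet.yonedaEquiv.symm σ).app _ (arrow (homOfLE h)) = X.base.map θ.op σ := by
  have : SSet.stdSimplex.objEquiv ((toSimplex.{u} n).app (op ⦋1⦌) (arrow (homOfLE h))) = θ := by
    refine SimplexCategory.Hom.ext _ _ (OrderHom.ext _ _ (funext fun k ↦ ?_))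
    change Fin 2 at k
    fin_cases k
    · exact h₀.symm
    · exact h₁.symm
  exact congrArg (fun θ : ⦋1⦌ ⟶ ⦋n⦌ ↦ X.base.map θ.op σ) this

lemma edgeMap_arrow (f : X.base _⦋1⦌) (h : (0 : Fin 2) ≤ 1) :
    (edgeMap f).app _ (arrow (homOfLE h)) = f :=
  (simplex_arrow f h (𝟙 _) rfl rfl).trans (by
    rw [op_id, CategoryTheory.Functor.map_id]
    rfl)

end Edges

/-- The map `f`, as a cone or cocone. -/
def ConeData.ofArr (e : Fin 2) (f : X.base _⦋1⦌) :
    ConeData e (SSet.const (X.base.δ (1 - e) f) : Δ[0] ⟶ X.base) where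
  apex := X.base.δ e f
  hom := snd _ _ ≫ SSet.yonedaEquiv.symm f
  at_diagram := by
    rw [← Category.assoc, ConeData.endIncl_point, ← SSet.yonedaEquiv_symm_zero]
    exact SSet.yonedaEquiv_symm_naturality_left _ _
  at_apex := by
    rw [← Category.assoc, ConeData.endIncl_point, ← SSet.yonedaEquiv_symm_zero,
      (by decide : ∀ e : Fin 2, 1 - (1 - e) = e) e]
    exact SSet.yonedaEquiv_symm_naturality_left _ _

lemma ConeData.hasLift_conesRes_iff (hX : X.IsReedyFibrant) (hX' : X.IsSegal) {e : Fin 2}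
    {D : Δ[0] ⟶ X.base} (c : ConeData e D) (w : X.base _⦋0⦌) (n : ℕ) :
    HasLiftingProperty ∂Δ[n].ι (conesRes e (endIncl e Δ[0]) c.at_diagram w) ↔
      HasLiftingProperty ∂Δ[n].ι (c.factorTo w) := by
  obtain ⟨a, H, h, h'⟩ := c
  subst h
  have ha : a = H.app _ (ConeShape.cylinder e).vert := by
    have h1 := congrArg SSet.yonedaEquiv h'
    rw [SSet.yonedaEquiv_const] at h1
    exact h1.symm.trans (congrArg (fun p ↦ H.app _ ((endIncl (1 - e) Δ[0]).app _ p))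
      (ConeData.point_eq _ _))
  subst ha
  exact ConeShape.hasLift_cylinder_iff hX hX' e H w n

/-- Restriction of cones along isomorphic maps. -/
def conesResIso (e : Fin 2) {K L K' L' : SSet.{u}} {D : K ⟶ X.base} {E : L ⟶ X.base}
    {D' : K' ⟶ X.base} {E' : L' ⟶ X.base}
    {g : L ⟶ K} {g' : L' ⟶ K'} (h : g ≫ D = E) (h' : g' ≫ D' = E') (a : K' ⟶ K) (b : L' ⟶ L)
    [IsIso a] [IsIso b] (ha : a ≫ D = D') (hb : b ≫ E = E') (comm : g' ≫ a = b ≫ g)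
    (w : X.base _⦋0⦌) : Arrow.mk (conesRes e g h w) ≅ Arrow.mk (conesRes e g' h' w) :=
  Arrow.isoMk (asIso (conesRes e a ha w)) (asIso (conesRes e b hb w))
    ((conesRes_comp ha h' comm w).trans (conesRes_comp h hb rfl w).symm)

instance : IsIso (lift (toPoint (N.{u} (Fin 2))) (toSimplex.{u} 1)) := by
  refine ⟨snd _ _ ≫ inv (toSimplex.{u} 1), ?_, ?_⟩
  · rw [lift_snd_assoc, IsIso.hom_inv_id]
  · refine CartesianMonoidalCategory.hom_ext _ _
      (SSet.stdSimplex.isTerminalObj₀.hom_ext _ _) ?_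
    rw [Category.assoc, lift_snd, Category.assoc, IsIso.inv_hom_id, Category.comp_id,
      Category.id_comp]

lemma vertex_toSimplex (e : Fin 2) :
    (SSet.const (vertex e) : Δ[0] ⟶ N.{u} (Fin 2)) ≫ lift (toPoint _) (toSimplex.{u} 1) =
    endIncl e Δ[0] := by
  refine CartesianMonoidalCategory.hom_ext _ _ (SSet.stdSimplex.isTerminalObj₀.hom_ext _ _) ?_
  rw [Category.assoc, lift_snd]
  refine ext_app fun n x ↦ ?_
  induction n using Opposite.rec with | op n =>
  induction n using SimplexCategory.rec with | _ n =>
  exact SSet.stdSimplex.ext _ _ fun k ↦ rfl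

section

variable (hX : X.IsReedyFibrant) (hX' : X.IsSegal)

include hX hX'

/-- Composition with `f` becomes a restriction of cones over the arrow `f`, again for each `n`
separately. -/
lemma hasLift_ofArr_iff (e : Fin 2) (f : X.base _⦋1⦌) (w : X.base _⦋0⦌) (n : ℕ) :
    HasLiftingProperty ∂Δ[n].ι ((ConeData.ofArr e f).factorTo w) ↔ HasLiftingProperty ∂Δ[n].ι
      (conesRes e (SSet.const (vertex e) : Δ[0] ⟶ N.{u} (Fin 2))
        (rfl : _ ≫ edgeMap f = SSet.const (vertex e) ≫ edgeMap f) w) := by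
  rw [← ConeData.hasLift_conesRes_iff hX hX']
  have h1 : lift (toPoint _) (toSimplex.{u} 1) ≫ (ConeData.ofArr e f).hom = edgeMap f :=
    lift_snd_assoc _ _ _
  have i := conesResIso e (ConeData.ofArr e f).at_diagram (rfl : _ ≫ edgeMap f = _)
    (lift (toPoint _) (toSimplex.{u} 1)) (𝟙 _) h1 (by
      rw [Category.id_comp, ← (ConeData.ofArr e f).at_diagram, ← h1, ← Category.assoc,
        vertex_toSimplex]) ((vertex_toSimplex e).trans (Category.id_comp _).symm) w
  exact ⟨fun h ↦ HasLiftingProperty.of_arrow_iso_right _ i,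
    fun h ↦ HasLiftingProperty.of_arrow_iso_right _ i.symm⟩

lemma EquivTriv.trivFib_factorTo {e : Fin 2} {f : X.base _⦋1⦌} (h : EquivTriv e f)
    (w : X.base _⦋0⦌) : TrivFib ((ConeData.ofArr e f).factorTo w) :=
  trivFib_iff.2 fun n ↦ (hasLift_ofArr_iff hX hX' e f w n).2 ((trivOn_vertex_iff.1 h w).hasLift _)

/-- A one-sided inverse. -/
lemma EquivTriv.exists_triangle {e : Fin 2} {f : X.base _⦋1⦌} (h : EquivTriv e f) :
    ∃ τ : X.base _⦋2⦌, X.base.δ (outer (1 - e)) τ = f ∧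
      X.base.δ 1 τ = X.base.σ 0 (X.base.δ (1 - e) f) := by
  obtain ⟨s, hs⟩ := (h.trivFib_factorTo hX hX' (X.base.δ (1 - e) f)).section
  let y := X.base.δ (1 - e) f
  -- The point `b` is the identity of the vertex at which `f` is regarded as a cone; the section
  -- factors it through `f`.
  let b : (cones e (SSet.const y : Δ[0] ⟶ X.base) y) _⦋0⦌ := ⟨SSet.const y, (mem_sec _).2 fun i ↦ by
    rw [baseTo_zero, Category.comp_id, ends, ite_self]
    exact SSet.comp_const _ _⟩
  let x := s.app _ b
  have hx : Δ[0] ◁ SSet.stdSimplex.δ 1 ≫ Tri.hom x.1.2 = SSet.const y :=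
    congrArg Sec.hom (app_congr hs b)
  have hx' : Δ[0] ◁ SSet.stdSimplex.δ (outer (1 - e)) ≫ Tri.hom x.1.2 =
      snd _ _ ≫ SSet.yonedaEquiv.symm f :=
    ((mem_tri _).1 x.1.2.2).1.trans (by rw [baseTo_zero]; rfl)
  have key : ∀ i, X.base.δ i (SSet.yonedaEquiv (lift (toPoint _) (𝟙 _) ≫ Tri.hom x.1.2)) =
      SSet.yonedaEquiv (lift (toPoint _) (𝟙 _) ≫
        Δ[0] ◁ SSet.stdSimplex.δ i ≫ Tri.hom x.1.2) := by
    intro i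
    refine (SSet.yonedaEquiv_naturality (SimplexCategory.δ i) _).trans (congrArg SSet.yonedaEquiv ?_)
    refine ext_app fun n z ↦ congrArg (fun q ↦ (Tri.hom x.1.2).app n q) (Prod.ext ?_ rfl)
    exact ConeData.point_eq _ _
  refine ⟨SSet.yonedaEquiv (lift (toPoint _) (𝟙 _) ≫ Tri.hom x.1.2), ?_, ?_⟩
  · rw [key, hx', lift_snd_assoc, Category.id_comp, Equiv.apply_symm_apply]
  · rw [key, hx, SSet.comp_const]
    exact (congrArg SSet.yonedaEquiv (SSet.comp_const _ _).symm).trans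
      ((SSet.yonedaEquiv_naturality (SimplexCategory.σ 0) (SSet.const y)).symm.trans
        (congrArg (X.base.σ 0) (SSet.yonedaEquiv_const y)))

lemma isEquivalence_of_equivTriv {f : X.base _⦋1⦌} (h₀ : EquivTriv 0 f) (h₁ : EquivTriv 1 f) :
    X.IsEquivalence f := ⟨h₀.exists_triangle hX hX', h₁.exists_triangle hX hX'⟩

lemma IsNegOneTruncated.of_equivTriv {f : X.base _⦋1⦌} (h : EquivTriv 1 f) :
    X.IsNegOneTruncated f := by
  intro g
  obtain ⟨d, rfl⟩ := ConeData.exists_obj g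
  exact Or.inr (((ConeData.ofArr 1 f).contractible_iff hX hX').2
    (h.trivFib_factorTo hX hX') d)

lemma IsNegOneTruncated.hasLift {f : X.base _⦋1⦌} (h : X.IsNegOneTruncated f) (w : X.base _⦋0⦌)
    (n : ℕ) : HasLiftingProperty ∂Δ[n + 1].ι
      (conesRes 1 (SSet.const (vertex 1) : Δ[0] ⟶ N.{u} (Fin 2))
        (rfl : _ ≫ edgeMap f = SSet.const (vertex 1) ≫ edgeMap f) w) :=
  (hasLift_ofArr_iff hX hX' 1 f w _).1
    (ConeData.hasLift_factorTo_of_emptyOrContractible (ConeData.ofArr 1 f) w hX hX' (fun d ↦ h d.obj) n)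

end

end

/-! ### Finite posets, and invertible maps by two-out-of-six -/

noncomputable section

open CategoryTheory Simplicial Opposite MonoidalCategory CartesianMonoidalCategory

variable {X : SimplicialSpace.{u}}

/-- The condition `TrivOn`, for finite sets. -/
abbrev FinTriv {Q : Type} [PartialOrder Q] (e : Fin 2) (D : N.{u} Q ⟶ X.base) (s t : Finset Q) :
    Prop :=
  TrivOn e D (s : Set Q) (t : Set Q)

section FinTriv

variable {Q : Type} [PartialOrder Q] {e : Fin 2} {D : N.{u} Q ⟶ X.base} {r s t v : Finset Q}

lemma FinTriv.drop_left (h : FinTriv e D s t) (h' : FinTriv e D s v) (hs : v ⊆ t) :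
    FinTriv e D t v :=
  TrivPair.of_trans_left h h' (NS_mono (Finset.coe_subset.2 hs))

lemma FinTriv.drop_right (hX : X.IsReedyFibrant) (h : FinTriv e D t v) (h' : FinTriv e D s v)
    (hs : t ⊆ s) : FinTriv e D s t :=
  TrivPair.of_trans_right hX h h' (NS_mono (Finset.coe_subset.2 hs))

lemma finTriv_least (hX : X.IsReedyFibrant) (hX' : X.IsSegal) {a : Q} (ha : a ∈ s)
    (h : ∀ b ∈ s, a ≤ b) : FinTriv 1 D s {a} := by
  rw [FinTriv, Finset.coe_singleton]
  exact trivOn_of_isExtremal hX hX' ⟨ha, fun q hq ↦ ⟨fun _ ↦ h q hq, fun h ↦ by simp at h⟩⟩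

lemma finTriv_greatest (hX : X.IsReedyFibrant) (hX' : X.IsSegal) {a : Q} (ha : a ∈ s)
    (h : ∀ b ∈ s, b ≤ a) : FinTriv 0 D s {a} := by
  rw [FinTriv, Finset.coe_singleton]
  exact trivOn_of_isExtremal hX hX' ⟨ha, fun q hq ↦ ⟨fun h ↦ by simp at h, fun _ ↦ h q hq⟩⟩

variable [DecidableEq Q]

lemma FinTriv.excision (h : FinTriv e D s r) (hr : r = s ∩ t) (hv : s ∪ t = v)
    (hst : ∀ a ∈ s, a ∉ t → ∀ b ∈ t, b ∉ s → ¬ a ≤ b ∧ ¬ b ≤ a) : FinTriv e D v t := by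
  subst hr hv
  have := trivOn_sup (R := (s : Set Q)) (R' := (t : Set Q)) (e := e) (D := D)
    (by rw [← Finset.coe_inter]; exact h) (by simpa using hst)
  rwa [← Finset.coe_union] at this

lemma finTriv_pair_one {a b : Q} (h : a ≤ b) (h' : ¬ b ≤ a) :
    FinTriv 1 D {a, b} {b} ↔ EquivTriv 1 (D.app _ (arrow (homOfLE h))) := by
  rw [FinTriv, Finset.coe_pair, Finset.coe_singleton]
  exact trivOn_pair_one h h'

lemma finTriv_pair_zero {a b : Q} (h : a ≤ b) (h' : ¬ b ≤ a) :
    FinTriv 0 D {a, b} {a} ↔ EquivTriv 0 (D.app _ (arrow (homOfLE h))) := by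
  rw [FinTriv, Finset.coe_pair, Finset.coe_singleton]
  exact trivOn_pair_zero h h'

/-- A map that starts at the least element, and the target of which determines cones. -/
lemma finTriv_pair_one_of_greatest (hX : X.IsReedyFibrant) (hX' : X.IsSegal) {a b : Q}
    (h : FinTriv 1 D s {b}) (ha : a ∈ s) (hs : ∀ b ∈ s, a ≤ b) (hb : b ∈ s) :
    FinTriv 1 D {a, b} {b} := by
  have h1 : FinTriv 1 D {a, b} {a} := finTriv_least hX hX' (by simp) (by simpa using hs b hb)
  have h2 : FinTriv 1 D s {a, b} := h1.drop_right hX (finTriv_least hX hX' ha hs)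
    (by simp [Finset.insert_subset_iff, ha, hb])
  exact h2.drop_left h (by simp)

lemma finTriv_pair_zero_of_least (hX : X.IsReedyFibrant) (hX' : X.IsSegal) {a b : Q}
    (h : FinTriv 0 D s {a}) (hb : b ∈ s) (hs : ∀ a ∈ s, a ≤ b) (ha : a ∈ s) :
    FinTriv 0 D {a, b} {a} := by
  have h1 : FinTriv 0 D {a, b} {b} := finTriv_greatest hX hX' (by simp) (by simpa using hs a ha)
  have h2 : FinTriv 0 D s {a, b} := h1.drop_right hX (finTriv_greatest hX hX' hb hs)
    (by simp [Finset.insert_subset_iff, ha, hb])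
  exact h2.drop_left h (by simp)

/-- A map with trivial restriction of cones can be added at the least element. -/
lemma finTriv_of_pair_one (hX : X.IsReedyFibrant) (hX' : X.IsSegal) {a b : Q}
    (h : FinTriv 1 D {a, b} {b}) (ha : a ∈ s) (hs : ∀ b ∈ s, a ≤ b) (hb : b ∈ s) :
    FinTriv 1 D s {b} := by
  have h1 : FinTriv 1 D {a, b} {a} := finTriv_least hX hX' (by simp) (by simpa using hs b hb)
  have h2 : FinTriv 1 D s {a, b} := h1.drop_right hX (finTriv_least hX hX' ha hs)
    (by simp [Finset.insert_subset_iff, ha, hb])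
  exact h2.trans h

lemma finTriv_of_pair_zero (hX : X.IsReedyFibrant) (hX' : X.IsSegal) {a b : Q}
    (h : FinTriv 0 D {a, b} {a}) (hb : b ∈ s) (hs : ∀ a ∈ s, a ≤ b) (ha : a ∈ s) :
    FinTriv 0 D s {a} := by
  have h1 : FinTriv 0 D {a, b} {b} := finTriv_greatest hX hX' (by simp) (by simpa using hs a ha)
  have h2 : FinTriv 0 D s {a, b} := h1.drop_right hX (finTriv_greatest hX hX' hb hs)
    (by simp [Finset.insert_subset_iff, ha, hb])
  exact h2.trans h

end FinTriv

/-- The isomorphism `k ≫ c` makes `k`, and thereby `p`, a monomorphism, while `d ≫ p` makes `p` a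
split epimorphism. -/
lemma isIso_of_two_of_six {C : Type*} [Category C] {a₀ a₁ a₂ a₃ a₄ a₅ : C} {a : a₀ ⟶ a₁}
    {p : a₁ ⟶ a₂} {k : a₀ ⟶ a₃} {b : a₃ ⟶ a₂} {c : a₃ ⟶ a₄} {d : a₅ ⟶ a₁} (w : a ≫ p = k ≫ b)
    (ha : IsIso a) (hb : IsIso b) (hc : IsIso (k ≫ c)) (hd : IsIso (d ≫ p)) : IsIso p := by
  have := mono_of_mono k c
  have : Mono p := by
    rw [← IsIso.inv_hom_id_assoc a p, w]
    infer_instance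
  have : IsSplitEpi p := IsSplitEpi.mk' ⟨inv (d ≫ p) ≫ d, by simp⟩
  exact isIso_of_mono_of_isSplitEpi p

lemma vertex_posetNmap {P Q : Type} [PartialOrder P] [PartialOrder Q] (p : P →o Q) {a : P} {b : Q}
    (h : p a = b) : (SSet.const (vertex a) : Δ[0] ⟶ N.{u} P) ≫ posetNmap p =
      SSet.const (vertex b) := by
  subst h
  refine (SSet.const_comp _ _).trans (congrArg SSet.const (N_ext fun _ ↦ rfl))

section

variable (hX : X.IsReedyFibrant) (hX' : X.IsSegal)

include hX hX'

lemma trivOn_two {D : N.{u} (Fin 3) ⟶ X.base} {h : (0 : Fin 3) ≤ 2}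
    (H : EquivTriv 1 (D.app _ (arrow (homOfLE h)))) :
    ConeTriv 1 D (SSet.const (vertex 2) : Δ[0] ⟶ N.{u} (Fin 3)) := by
  rw [← trivOn_vertex_iff, ← Finset.coe_univ, ← Finset.coe_singleton]
  exact finTriv_of_pair_one hX hX' ((finTriv_pair_one _ (by decide)).2 H) (by decide)
    (by decide) (by decide)

lemma coneTriv_edge_zero (f : X.base _⦋1⦌) :
    ConeTriv 1 (edgeMap f) (SSet.const (vertex 0) : Δ[0] ⟶ N.{u} (Fin 2)) :=
  trivOn_vertex_iff.1 (trivOn_of_isExtremal hX hX' (isExtremal_fin 1))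

omit hX hX' in
lemma exists_triangle_diagram (σ : X.base _⦋2⦌) : ∃ D : N.{u} (Fin 3) ⟶ X.base,
    D.app _ (arrow (homOfLE (by decide : (0 : Fin 3) ≤ 1))) = X.base.δ 2 σ ∧
    D.app _ (arrow (homOfLE (by decide : (1 : Fin 3) ≤ 2))) = X.base.δ 0 σ ∧
    D.app _ (arrow (homOfLE (by decide : (0 : Fin 3) ≤ 2))) = X.base.δ 1 σ :=
  ⟨toSimplex 2 ≫ SSet.yonedaEquiv.symm σ, simplex_arrow σ _ (SimplexCategory.δ 2) rfl rfl,
    simplex_arrow σ _ (SimplexCategory.δ 0) rfl rfl,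
    simplex_arrow σ _ (SimplexCategory.δ 1) rfl rfl⟩

/-- Cones over the triangle `σ` are determined at its vertex 2, as its long edge is degenerate; so
restriction to the edge `12`, which passes through vertex 1, is injective in the homotopy category.
In the same way, `τ` provides a section of restriction from `f` to its target. Two-out-of-six
concludes. -/
lemma IsEquivalence.equivTriv {f : X.base _⦋1⦌} (h : X.IsEquivalence f) : EquivTriv 1 f := by
  obtain ⟨⟨σ, hσ, hσ'⟩, ⟨τ, hτ, hτ'⟩⟩ := h
  obtain ⟨D, hD, -, hD'⟩ := exists_triangle_diagram σ
  obtain ⟨E, -, hE, hE'⟩ := exists_triangle_diagram τ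
  let d₂ : Fin 2 →o Fin 3 := (Fin.succAboveOrderEmb 2).toOrderHom
  let d₀ : Fin 2 →o Fin 3 := (Fin.succAboveOrderEmb 0).toOrderHom
  have H : ConeTriv 1 D (SSet.const (vertex 2) : Δ[0] ⟶ N.{u} (Fin 3)) :=
    trivOn_two hX hX' (h := by decide) (by
      rw [hD', hσ']
      exact equivTriv_σ hX hX' 1 _)
  have H' : ConeTriv 1 E (SSet.const (vertex 2) : Δ[0] ⟶ N.{u} (Fin 3)) :=
    trivOn_two hX hX' (h := by decide) (by
      rw [hE', hτ']
      exact equivTriv_σ hX hX' 1 _)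
  have h₂ : posetNmap d₂ ≫ D = edgeMap f :=
    (posetNmap_edge d₂ (by decide)).trans (congrArg edgeMap (hD.trans hσ))
  have h₀ : posetNmap d₀ ≫ E = edgeMap f :=
    (posetNmap_edge d₀ (by decide)).trans (congrArg edgeMap (hE.trans hτ))
  have v₂ : (SSet.const (vertex 1) : Δ[0] ⟶ N.{u} (Fin 2)) ≫ posetNmap d₂ = SSet.const (vertex 1) :=
    vertex_posetNmap d₂ rfl
  have v₀ : (SSet.const (vertex 0) : Δ[0] ⟶ N.{u} (Fin 2)) ≫ posetNmap d₀ = SSet.const (vertex 1) :=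
    vertex_posetNmap d₀ rfl
  have v₀' : (SSet.const (vertex 1) : Δ[0] ⟶ N.{u} (Fin 2)) ≫ posetNmap d₀ = SSet.const (vertex 2) :=
    vertex_posetNmap d₀ rfl
  have hv : (SSet.const (vertex 0) : Δ[0] ⟶ N.{u} (Fin 2)) ≫ posetNmap d₀ ≫ D =
      SSet.const (vertex 1) ≫ edgeMap f :=
    (Category.assoc _ _ _).symm.trans ((congrArg (· ≫ D) (v₀.trans v₂.symm)).trans
      ((Category.assoc _ _ _).trans (congrArg (SSet.const (vertex 1) ≫ ·) h₂)))
  have := mono_posetNmap.{u} d₂ fun a b ↦ (Fin.succAboveOrderEmb 2).map_rel_iff.1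
  have K : ConeTriv 1 D (posetNmap d₂) :=
    ConeTriv.of_comp_right (m := SSet.const (vertex 0)) hX (coneTriv_edge_zero hX hX' f)
      (trivOn_vertex_iff.1 (trivOn_of_isExtremal hX hX' ⟨trivial, fun q _ ↦
        ⟨fun _ ↦ Fin.zero_le q, fun h ↦ by simp at h⟩⟩)) h₂ (vertex_posetNmap d₂ rfl)
  have K₀ : ConeTriv 1 (posetNmap d₀ ≫ D) (SSet.const (vertex 0) : Δ[0] ⟶ N.{u} (Fin 2)) := by
    rw [posetNmap_edge d₀ (by decide)]
    exact coneTriv_edge_zero hX hX' _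
  refine trivOn_vertex_iff.2 fun w ↦ (kanFib_secMap hX _ _).trivFib (kan_sec hX _) ?_
  refine isIso_of_two_of_six (a := hoFunctor.map (conesRes 1 (posetNmap d₂) h₂ w))
    (k := hoFunctor.map (conesRes 1 (posetNmap d₀) rfl w))
    (b := hoFunctor.map (conesRes 1 (SSet.const (vertex 0) : Δ[0] ⟶ N.{u} (Fin 2)) hv w))
    (c := hoFunctor.map (conesRes 1 (SSet.const (vertex 1) : Δ[0] ⟶ N.{u} (Fin 2)) rfl w))
    (d := hoFunctor.map (conesRes 1 (posetNmap d₀) h₀ w))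
    ?_ (K.trivFib _ _).we (K₀.trivFib _ _).we ?_ ?_
  · exact (hoFunctor.map_comp _ _).symm.trans ((congrArg hoFunctor.map
      ((conesRes_comp h₂ rfl v₂ w).trans (conesRes_comp rfl hv v₀ w).symm)).trans
        (hoFunctor.map_comp _ _))
  · have := (H.trivFib (D' := SSet.const (vertex 1) ≫ posetNmap d₀ ≫ D)
      (by rw [← v₀', Category.assoc]) w).we
    rw [← hoFunctor.map_comp, conesRes_comp rfl rfl v₀']
    exact this
  · have := (H'.trivFib (D' := SSet.const (vertex 1) ≫ edgeMap f)
      (by rw [← v₀', Category.assoc, h₀]) w).we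
    rw [← hoFunctor.map_comp]
    refine (congrArg (fun z ↦ IsIso (hoFunctor.map z)) (conesRes_comp h₀ rfl v₀' w)).mpr this

end

end

/-! ### (-1)-truncated maps in a stable complete Segal space -/

noncomputable section

open CategoryTheory Simplicial Opposite MonoidalCategory CartesianMonoidalCategory

variable {X : SimplicialSpace.{u}}

lemma hasLift_conesRes_range {e : Fin 2} {K K' L : SSet.{u}} {D : L ⟶ X.base} (g : K ⟶ L) [Mono g]
    (k : K' ⟶ K) [Mono k] {A C : L.Subcomplex} (hA : A = SSet.Subcomplex.range g)
    (hC : C = SSet.Subcomplex.range (k ≫ g)) (hCA : C ≤ A) (w : X.base _⦋0⦌) (n : ℕ)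
    (h : HasLiftingProperty ∂Δ[n].ι (conesRes e k (rfl : k ≫ g ≫ D = _) w)) :
    HasLiftingProperty ∂Δ[n].ι
      (conesRes e (SSet.Subcomplex.homOfLE hCA) (rfl : _ ≫ A.ι ≫ D = C.ι ≫ D) w) := by
  subst hA hC
  exact HasLiftingProperty.of_arrow_iso_right _ (conesResIso e
    (rfl : SSet.Subcomplex.homOfLE hCA ≫ (SSet.Subcomplex.range g).ι ≫ D = _)
    (rfl : k ≫ g ≫ D = _) (SSet.Subcomplex.toRange g) (SSet.Subcomplex.toRange (k ≫ g))
    rfl rfl rfl w).symm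

lemma hasLift_boundary_zero {S T : SSet.{u}} {p : S ⟶ T} {s : T ⟶ S} (h : s ≫ p = 𝟙 T) :
    HasLiftingProperty (∂Δ[0] : (Δ[0] : SSet.{u}).Subcomplex).ι p where
  sq_hasLift {f g} sq := ⟨⟨⟨g ≫ s, SSet.boundary.hom_ext₀, by rw [Category.assoc, h, Category.comp_id]⟩⟩⟩

lemma exists_comap (hX : X.IsReedyFibrant) (hX' : X.IsSegal) {Q : Type} [PartialOrder Q]
    (p : Q →o Fin 2) (f : X.base _⦋1⦌) : ∃ D : posetN.{u} Q ⟶ X.base, D = posetNmap p ≫ edgeMap f ∧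
      (∀ e {a b} (h : a ≤ b), p a = p b → EquivTriv e (D.app _ (arrow (homOfLE h)))) ∧
      (∀ {a b} (h : a ≤ b), p a = 0 → p b = 1 → D.app _ (arrow (homOfLE h)) = f) := by
  have key {a b} (h : a ≤ b) : (posetNmap p ≫ edgeMap f).app _ (arrow (homOfLE h)) =
      (edgeMap f).app _ (arrow (homOfLE (p.monotone h))) :=
    congrArg (fun z ↦ (edgeMap f).app _ z) (posetNmap_arrow p h)
  refine ⟨_, rfl, fun e a b h h' ↦ ?_, fun {a b} h ha hb ↦ ?_⟩
  · rw [key]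
    exact equivTriv_of_eq hX hX' e _ _ h'
  · refine (key h).trans (Eq.trans ?_ (edgeMap_arrow f (by decide)))
    exact congrArg (fun z ↦ (edgeMap f).app _ z) (arrow_congr _ _ ha hb)

/-- The square that is constant, up to the first vertex. -/
def squareMin : Square →o Fin 2 := ⟨fun x ↦ min x.1 x.2, by decide⟩

/-- The square that is constant, up to the last vertex. -/
def squareMax : Square →o Fin 2 := ⟨fun x ↦ max x.1 x.2, by decide⟩

section

variable (hX : X.IsReedyFibrant) (hX' : X.IsSegal)

include hX hX'

lemma IsNegOneTruncated.hasLift_square {f : X.base _⦋1⦌} (h : X.IsNegOneTruncated f)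
    {D : posetN.{u} Square ⟶ X.base} (hD : D = posetNmap squareMin ≫ edgeMap f)
    (w : X.base _⦋0⦌) (n : ℕ) {A C : (posetN.{u} Square).Subcomplex}
    (hA : A = NS {((0, 1) : Square), (1, 1)}) (hC : C = NS {((1, 1) : Square)}) (hCA : C ≤ A) :
    HasLiftingProperty ∂Δ[n + 1].ι (conesRes 1 (SSet.Subcomplex.homOfLE hCA)
      (rfl : SSet.Subcomplex.homOfLE hCA ≫ A.ι ≫ D = C.ι ≫ D) w) := by
  let p : Fin 2 →o Square := ⟨fun i ↦ (i, 1), by decide⟩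
  have hp : ∀ a b, p a ≤ p b → a ≤ b := by decide
  have := mono_posetNmap.{u} p hp
  have hpm : posetNmap.{u} p ≫ posetNmap squareMin = 𝟙 _ := ext_app fun n x ↦ N_ext fun i ↦
    (by decide : ∀ i : Fin 2, min i 1 = i) _
  refine hasLift_conesRes_range (posetNmap p)
    (SSet.const (vertex 1) : Δ[0] ⟶ N.{u} (Fin 2)) (hA.trans ?_) (hC.trans ?_) hCA w (n + 1) ?_
  · rw [← SSet.Subcomplex.image_top, ← NS_univ, NS_image p hp, Set.image_univ]
    congr 1
    ext x
    revert x
    simp only [Set.mem_insert_iff, Set.mem_singleton_iff, Set.mem_range]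
    decide
  · rw [vertex_posetNmap p (b := (1, 1)) rfl, NS_vertex]
  · have h1 : posetNmap.{u} p ≫ D = edgeMap f := by
      rw [hD, ← Category.assoc, hpm, Category.id_comp]
    have key : ∀ D : N.{u} (Fin 2) ⟶ X.base, D = edgeMap f →
        HasLiftingProperty ∂Δ[n + 1].ι (conesRes 1 (SSet.const (vertex 1) : Δ[0] ⟶ N.{u} (Fin 2))
          (rfl : _ ≫ D = _) w) := by
      rintro _ rfl
      exact h.hasLift hX hX' w n
    exact key _ h1

/-- Adding the second leg to a cospan of two copies of `f` is a base change of restriction along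
`f`, which lifts against all nonempty boundaries. The empty boundary is handled by a section, which
uses the given leg twice. -/
lemma IsNegOneTruncated.cospan {f : X.base _⦋1⦌} (h : X.IsNegOneTruncated f) :
    FinTriv (Q := Square) 1 (posetNmap squareMin ≫ edgeMap f) {(0, 1), (1, 0), (1, 1)}
      {(1, 0), (1, 1)} := by
  obtain ⟨D, hD⟩ : ∃ D : posetN.{u} Square ⟶ X.base, D = posetNmap squareMin ≫ edgeMap f := ⟨_, rfl⟩
  rw [← hD]
  let A : (posetN.{u} Square).Subcomplex := NS {(0, 1), (1, 1)}
  let B : (posetN.{u} Square).Subcomplex := NS {(1, 0), (1, 1)}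
  have hAB : A ⊓ B = NS {((1, 1) : Square)} := by
    refine (NS_inter _ _).trans (congrArg NS ?_)
    ext x
    revert x
    simp only [Set.mem_inter_iff, Set.mem_insert_iff, Set.mem_singleton_iff]
    decide
  have hAB' : A ⊔ B = NS {((0, 1) : Square), (1, 0), (1, 1)} := by
    refine (NS_union ?_).trans (congrArg NS ?_)
    · simp only [Set.mem_insert_iff, Set.mem_singleton_iff]
      decide
    · ext x
      revert x
      simp only [Set.mem_union, Set.mem_insert_iff, Set.mem_singleton_iff]
      decide
  have key : TrivPair 1 D (A ⊔ B) B := by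
    refine ⟨le_sup_right, fun w ↦ trivFib_iff.2 fun n ↦ ?_⟩
    obtain _ | n := n
    · let q : Square →o Square := ⟨fun x ↦ (1, min x.1 x.2), by decide⟩
      let κ : ((A ⊔ B : (posetN.{u} Square).Subcomplex) : SSet) ⟶ B :=
        SSet.Subcomplex.lift ((A ⊔ B).ι ≫ posetNmap q) (by
          rintro n _ ⟨x, rfl⟩
          refine (mem_NS _).2 fun i ↦ ?_
          exact (by decide : ∀ x : Square, q x = (1, 0) ∨ q x = (1, 1)) _)
      have hκ : κ ≫ B.ι ≫ D = (A ⊔ B).ι ≫ D := by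
        rw [hD]
        refine ext_app fun n x ↦ congrArg (fun z ↦ (edgeMap f).app n z) (N_ext fun i ↦ ?_)
        exact (by decide : ∀ x : Square, squareMin (q x) = squareMin x) _
      have hκ' : SSet.Subcomplex.homOfLE le_sup_right ≫ κ = 𝟙 _ := by
        refine ext_app fun n x ↦ Subtype.ext (N_ext fun i ↦ ?_)
        have := (mem_NS _).1 x.2 i
        exact (by decide : ∀ x : Square, x = (1, 0) ∨ x = (1, 1) → q x = x) _ this
      exact hasLift_boundary_zero (s := conesRes 1 κ hκ w)
        ((conesRes_comp hκ rfl hκ' w).trans (conesRes_id _ w))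
    · exact hasLift_of_isPullback (TrivPair.isPullback_cones 1 D A B w) _
        (h.hasLift_square hX hX' hD w n rfl hAB inf_le_left)
  rw [hAB'] at key
  rw [FinTriv, Finset.coe_insert, Finset.coe_pair]
  exact key

/-- The diagonal of the square and one of its legs are both sections of `squareMin`. Restriction to
the diagonal is trivial because it contains the least element; by `ConeTriv.of_retraction` so is
restriction to the leg, and the other leg is added by `cospan`. -/
lemma IsNegOneTruncated.isPullback {f : X.base _⦋1⦌} (h : X.IsNegOneTruncated f) :
    FinTriv (Q := Square) 1 (posetNmap squareMin ≫ edgeMap f) Finset.univ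
      {(0, 1), (1, 0), (1, 1)} := by
  have h1 : FinTriv (Q := Square) 1 (posetNmap squareMin ≫ edgeMap f) Finset.univ
      {(0, 0), (1, 1)} :=
    (finTriv_least hX hX' (by decide) (by decide)).drop_right hX
      (finTriv_least hX hX' (a := (0, 0)) (by decide) (by decide)) (by decide)
  let p : Fin 2 →o Square := ⟨fun i ↦ (i, i), by decide⟩
  let p' : Fin 2 →o Square := ⟨fun i ↦ (1, i), by decide⟩
  have hp : ∀ a b, p a ≤ p b → a ≤ b := by decide
  have hp' : ∀ a b, p' a ≤ p' b → a ≤ b := by decide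
  have := mono_posetNmap.{u} p' hp'
  rw [FinTriv, Finset.coe_univ, Finset.coe_pair, trivOn_univ_iff p hp (by
    ext x
    revert x
    simp only [Set.mem_insert_iff, Set.mem_singleton_iff, Set.mem_range]
    decide)] at h1
  have h2 := ConeTriv.of_retraction hX (posetNmap squareMin) (g₂ := posetNmap p')
    (ext_app fun n x ↦ N_ext fun i ↦ (by decide : ∀ i, squareMin (p i) = i) _)
    (ext_app fun n x ↦ N_ext fun i ↦ (by decide : ∀ i, squareMin (p' i) = i) _) h1
  have h3 : FinTriv (Q := Square) 1 (posetNmap squareMin ≫ edgeMap f) Finset.univ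
      {(1, 0), (1, 1)} := by
    rw [FinTriv, Finset.coe_univ, Finset.coe_pair, trivOn_univ_iff p' hp' (by
      ext x
      revert x
      simp only [Set.mem_insert_iff, Set.mem_singleton_iff, Set.mem_range]
      decide)]
    exact h2
  exact (h.cospan hX hX').drop_right hX h3 (Finset.subset_univ _)

end

lemma square_ne_bot : ({q | q ≠ ⊥} : Set Square) =
    (({(0, 1), (1, 0), (1, 1)} : Finset Square) : Set Square) := by
  ext x
  rw [Finset.mem_coe]
  revert x
  exact (by decide : ∀ x : Square, x ≠ ⊥ ↔ x ∈ ({(0, 1), (1, 0), (1, 1)} : Finset Square))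

section

variable (hC : X.IsStable)

include hC

lemma IsStable.univ_iff (S : posetN.{u} Square ⟶ X.base) :
    FinTriv (Q := Square) 1 S Finset.univ {(0, 1), (1, 0), (1, 1)} ↔
      FinTriv (Q := Square) 0 S Finset.univ {(0, 0), (0, 1), (1, 0)} := by
  have h := hC.pullback_iff_pushout S
  rw [IsPullbackSquare, IsPushoutSquare, isLimitCone_iff hC.1.1 hC.1.2,
    isColimitCocone_iff hC.1.1 hC.1.2] at h
  have h2 : ({q | q ≠ ⊤} : Set Square) = (({(0, 0), (0, 1), (1, 0)} : Finset Square) : Set Square) := by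
    ext x
    rw [Finset.mem_coe]
    revert x
    exact (by decide : ∀ x : Square, x ≠ ⊤ ↔ x ∈ ({(0, 0), (0, 1), (1, 0)} : Finset Square))
  rw [FinTriv, FinTriv, ← square_ne_bot, ← h2, Finset.coe_univ]
  exact h

/-- In a stable complete Segal space, the maps with trivial fibers are equivalences. -/
lemma IsNegOneTruncated.equivTriv {f : X.base _⦋1⦌} (h : X.IsNegOneTruncated f) :
    EquivTriv 0 f := by
  have hX := hC.1.1
  have hX' := hC.1.2
  obtain ⟨D, hD, hdeg, hf⟩ := exists_comap hX hX' squareMin f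
  -- The corners are `x, x, x, y`, with `y` at `(1, 1)`; the pullback square is now used as a
  -- pushout.
  have h1 := (hC.univ_iff D).1 (by rw [hD]; exact h.isPullback hX hX')
  have h2 : FinTriv (Q := Square) 0 D {(0, 0), (0, 1)} {(0, 0)} :=
    (finTriv_pair_zero (by decide) (by decide)).2
      (hdeg 0 _ rfl)
  have h3 : FinTriv (Q := Square) 0 D {(0, 0), (0, 1), (1, 0)} {(0, 0), (1, 0)} :=
    h2.excision (by decide) (by decide) (by decide)
  have h4 : FinTriv (Q := Square) 0 D {(0, 0), (1, 0)} {(1, 0)} :=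
    finTriv_greatest hX hX' (by decide) (by decide)
  -- An identity edge was removed by excision, so cocones under the square are determined at the
  -- corner `(1, 0)`, whose edge to `(1, 1)` is `f`.
  have h5 := finTriv_pair_zero_of_least hX hX' (b := ((1, 1) : Square)) (h1.trans (h3.trans h4))
    (by decide) (by decide) (by decide)
  rw [finTriv_pair_zero (by decide) (by decide)] at h5
  rwa [hf _ rfl rfl] at h5

/-- In the square with `x` at `(0, 0)` and `y` elsewhere, all edges from `(0, 0)` are `f` and the
others are identities. The hypothesis makes it a pushout; as a pullback, it shows `f` as a base
change of an identity. -/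
lemma EquivTriv.equivTriv_one {f : X.base _⦋1⦌} (h : EquivTriv 0 f) : EquivTriv 1 f := by
  have hX := hC.1.1
  have hX' := hC.1.2
  obtain ⟨D, -, hdeg, hf⟩ := exists_comap hX hX' squareMax f
  have h1 : FinTriv (Q := Square) 0 D {(0, 0), (0, 1)} {(0, 0)} :=
    (finTriv_pair_zero (by decide) (by decide)).2 (by rwa [hf _ rfl rfl])
  have h2 : FinTriv (Q := Square) 0 D {(0, 0), (1, 0)} {(0, 0)} :=
    (finTriv_pair_zero (by decide) (by decide)).2 (by rwa [hf _ rfl rfl])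
  have h3 : FinTriv (Q := Square) 0 D {(0, 0), (1, 1)} {(0, 0)} :=
    (finTriv_pair_zero (by decide) (by decide)).2 (by rwa [hf _ rfl rfl])
  have h4 : FinTriv (Q := Square) 0 D {(0, 0), (0, 1), (1, 0)} {(0, 0), (1, 0)} :=
    h1.excision (by decide) (by decide) (by decide)
  have h5 : FinTriv (Q := Square) 0 D Finset.univ {(0, 0)} :=
    finTriv_of_pair_zero hX hX' h3 (by decide) (by decide) (by decide)
  have h6 := (hC.univ_iff D).2 (FinTriv.drop_right hX (h4.trans h2) h5 (by decide))
  have h7 : FinTriv (Q := Square) 1 D {(1, 0), (1, 1)} {(1, 1)} :=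
    (finTriv_pair_one (by decide) (by decide)).2
      (hdeg 1 _ rfl)
  have h8 : FinTriv (Q := Square) 1 D {(0, 1), (1, 0), (1, 1)} {(0, 1), (1, 1)} :=
    h7.excision (by decide) (by decide) (by decide)
  have h9 : FinTriv (Q := Square) 1 D {(0, 1), (1, 1)} {(0, 1)} :=
    finTriv_least hX hX' (by decide) (by decide)
  have h10 := finTriv_pair_one_of_greatest hX hX' (a := ((0, 0) : Square)) (h6.trans (h8.trans h9))
    (by decide) (by decide) (by decide)
  rwa [finTriv_pair_one (by decide) (by decide), hf _ rfl rfl] at h10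

lemma IsNegOneTruncated.isEquivalence {f : X.base _⦋1⦌} (h : X.IsNegOneTruncated f) :
    X.IsEquivalence f :=
  isEquivalence_of_equivTriv hC.1.1 hC.1.2 (h.equivTriv hC) ((h.equivTriv hC).equivTriv_one hC)

lemma EquivTriv.isNegOneTruncated {f : X.base _⦋1⦌} (h : EquivTriv 1 f) : X.IsNegOneTruncated f :=
  .of_equivTriv hC.1.1 hC.1.2 h

end

end

/-! ### Outer Segal squares in a stable setting -/

/-- The shape used to express the object of `2`-simplices as a pullback along the maps to the first
two vertices. -/
inductive SegalShape : Type
  | W₁ | W₀ | W₂ | e₁₂ | e₀₁ | v₁ | e₀₂ | v₂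
  deriving DecidableEq

namespace SegalShape

instance : Fintype SegalShape where
  elems := {W₁, W₀, W₂, e₁₂, e₀₁, v₁, e₀₂, v₂}
  complete q := by cases q <;> decide

/-- The order. -/
def leBool : SegalShape → SegalShape → Bool
  | W₁, _ => true
  | W₀, q => q == W₀ || q == e₁₂ || q == v₁ || q == v₂
  | W₂, q => q != W₁ && q != W₀
  | e₁₂, q => q == e₁₂ || q == v₁ || q == v₂
  | e₀₁, q => q == e₀₁ || q == v₁
  | e₀₂, q => q == e₀₂ || q == v₂
  | v₁, q => q == v₁
  | v₂, q => q == v₂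

instance : PartialOrder SegalShape where
  le p q := leBool p q = true
  le_refl := by decide
  le_trans := by decide
  le_antisymm := by decide

instance : DecidableLE SegalShape := fun p q ↦ inferInstanceAs (Decidable (leBool p q = true))

end SegalShape

noncomputable section

open CategoryTheory Simplicial Opposite MonoidalCategory CartesianMonoidalCategory

variable {X : SimplicialSpace.{u}}

section

variable {Q : Type} [PartialOrder Q] {s t : Finset Q}

lemma finTriv_of_le (hX : X.IsReedyFibrant) (hX' : X.IsSegal) {D : N.{u} Q ⟶ X.base} (r : Q → Q)
    (h : t ⊆ s ∧ (∀ a ∈ s, r a ∈ t) ∧ (∀ a ∈ s, ∀ b ∈ s, a ≤ b → r a ≤ r b) ∧ ∀ a ∈ s, r a ≤ a) :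
    FinTriv 1 D s t :=
  trivOn_of_isDeformation hX hX' (r := r) ⟨Finset.coe_subset.2 h.1, h.2.1, h.2.2.1,
    fun a ha ↦ ⟨fun _ ↦ h.2.2.2 a ha, fun h ↦ by simp at h⟩⟩

lemma finTriv_of_ge (hX : X.IsReedyFibrant) (hX' : X.IsSegal) {D : N.{u} Q ⟶ X.base} (r : Q → Q)
    (h : t ⊆ s ∧ (∀ a ∈ s, r a ∈ t) ∧ (∀ a ∈ s, ∀ b ∈ s, a ≤ b → r a ≤ r b) ∧ ∀ a ∈ s, a ≤ r a) :
    FinTriv 0 D s t :=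
  trivOn_of_isDeformation hX hX' (r := r) ⟨Finset.coe_subset.2 h.1, h.2.1, h.2.2.1,
    fun a ha ↦ ⟨fun h ↦ by simp at h, fun _ ↦ h.2.2.2 a ha⟩⟩

lemma finTriv_image_iff {P : Type} [PartialOrder P] [DecidableEq Q] {e : Fin 2} (p : P →o Q)
    (hp : ∀ a b, p a ≤ p b → a ≤ b) {D : N.{u} Q ⟶ X.base} {s' t' : Finset P} (hs : s'.image p = s)
    (ht : t'.image p = t) (h : t' ⊆ s') :
    FinTriv e D s t ↔ FinTriv e (posetNmap p ≫ D) s' t' := by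
  subst hs ht
  rw [FinTriv, FinTriv, Finset.coe_image, Finset.coe_image]
  exact trivOn_image_iff p hp (Finset.coe_subset.2 h)

/-- A commutative square in a poset. -/
def squareMap (a b c d : Q) (h : a ≤ b ∧ a ≤ c ∧ b ≤ d ∧ c ≤ d) : Square →o Q where
  toFun x := ![![a, b], ![c, d]] x.1 x.2
  monotone' := by
    obtain ⟨h₁, h₂, h₃, h₄⟩ := h
    rintro ⟨i, j⟩ ⟨i', j'⟩ ⟨hi, hj⟩
    change i ≤ i' at hi
    change j ≤ j' at hj
    fin_cases i <;> fin_cases j <;> fin_cases i' <;> fin_cases j' <;>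
      first
      | exact absurd hi (by decide)
      | exact absurd hj (by decide)
      | assumption
      | exact le_rfl
      | exact h₁.trans h₃

lemma IsStable.square_iff (hC : X.IsStable) [DecidableEq Q] {D : N.{u} Q ⟶ X.base} {a b c d : Q}
    (h : a ≤ b ∧ a ≤ c ∧ b ≤ d ∧ c ≤ d) (hp : ∀ x y, squareMap a b c d h x ≤ squareMap a b c d h y → x ≤ y) :
    FinTriv 1 D {a, b, c, d} {b, c, d} ↔ FinTriv 0 D {a, b, c, d} {a, b, c} := by
  have h1 := finTriv_image_iff (e := 1) (D := D) (s := {a, b, c, d}) (t := {b, c, d})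
    (squareMap a b c d h) hp (s' := {(0, 0), (0, 1), (1, 0), (1, 1)})
    (t' := {(0, 1), (1, 0), (1, 1)}) (by simp [squareMap]) (by simp [squareMap]) (by decide)
  have h0 := finTriv_image_iff (e := 0) (D := D) (s := {a, b, c, d}) (t := {a, b, c})
    (squareMap a b c d h) hp (s' := {(0, 0), (0, 1), (1, 0), (1, 1)})
    (t' := {(0, 0), (0, 1), (1, 0)}) (by simp [squareMap]) (by simp [squareMap]) (by decide)
  exact h1.trans ((hC.univ_iff _).trans h0.symm)

end

/-- Part of the simplicial structure: the objects of a poset, regarded as simplices, with maps. -/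
structure Shape (Q : Type) [PartialOrder Q] where
  dim : Q → ℕ
  map : ∀ p q, Fin (dim q + 1) → Fin (dim p + 1)
  monotone : ∀ p q, p ≤ q → Monotone (map p q)
  map_self : ∀ q i, map q q i = i
  map_comp : ∀ p q r, p ≤ q → q ≤ r → ∀ i, map p q (map q r i) = map p r i

namespace Shape

variable {P Q : Type} [PartialOrder P] [PartialOrder Q] (S : Shape Q)

/-- The maps of the simplex category in the diagram. -/
def hom {p q : Q} (h : p ≤ q) : ⦋S.dim q⦌ ⟶ ⦋S.dim p⦌ :=
  SimplexCategory.mkHom ⟨S.map p q, S.monotone _ _ h⟩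

/-- The diagram in the opposite simplex category. -/
def functor : Q ⥤ SimplexCategoryᵒᵖ where
  obj q := op ⦋S.dim q⦌
  map f := (S.hom (leOfHom f)).op
  map_id q := Quiver.Hom.unop_inj
    (SimplexCategory.Hom.ext _ _ (OrderHom.ext _ _ (funext fun i ↦ S.map_self q i)))
  map_comp f g := Quiver.Hom.unop_inj (SimplexCategory.Hom.ext _ _
    (OrderHom.ext _ _ (funext fun i ↦ (S.map_comp _ _ _ (leOfHom f) (leOfHom g) i).symm)))

/-- Restriction along a map of posets. -/
def comap (p : P →o Q) : Shape P where
  dim a := S.dim (p a)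
  map a b := S.map (p a) (p b)
  monotone _ _ h := S.monotone _ _ (p.monotone h)
  map_self _ := S.map_self _
  map_comp _ _ _ h h' := S.map_comp _ _ _ (p.monotone h) (p.monotone h')

/-- The dimensions agree only propositionally, so vertices are compared as natural numbers. -/
lemma functor_congr {S T : Shape Q} (h : ∀ q, S.dim q = T.dim q)
    (h' : ∀ p q, p ≤ q → ∀ (i : Fin (S.dim q + 1)) (j : Fin (T.dim q + 1)), (i : ℕ) = j → (S.map p q i : ℕ) = T.map p q j) :
    S.functor = T.functor := by
  obtain ⟨d, f, _⟩ := S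
  obtain ⟨d', f', _⟩ := T
  obtain rfl : d = d' := funext h
  refine CategoryTheory.Functor.ext (fun _ ↦ rfl) fun p q g ↦ ?_
  refine Eq.trans ?_ ((Category.id_comp _).trans (Category.comp_id _)).symm
  exact Quiver.Hom.unop_inj (SimplexCategory.Hom.ext _ _
    (OrderHom.ext _ _ (funext fun i ↦ Fin.ext (h' p q (leOfHom g) i i rfl))))

end Shape

namespace SimplicialObj

variable (W : X.SimplicialObj)

/-- The diagram given by a simplicial object. -/
abbrev diagram {Q : Type} [PartialOrder Q] (S : Shape Q) : posetN.{u} Q ⟶ X.base :=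
  Nmap S.functor ≫ W

lemma diagram_arrow {Q : Type} [PartialOrder Q] (S : Shape Q) {p q : Q} (h : p ≤ q) :
    (W.diagram S).app _ (arrow (homOfLE h)) = W.structureMap (S.hom h) :=
  congrArg (fun z ↦ W.app _ (ULift.up z)) (ComposableArrows.ext₁ rfl rfl (by simp; rfl))

lemma structureMap_id (n : SimplexCategory) : W.structureMap (𝟙 n) =
    X.base.σ 0 (W.app _ (vertex (op n))) := by
  refine Eq.trans ?_ (app_map W (SimplexCategory.σ 0).op (vertex (op n)))
  exact congrArg (fun z ↦ W.app _ (ULift.up z)) (ComposableArrows.ext₁ rfl rfl (by simp; rfl))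

/-- The map `c` has to respect order and simplices only on `s`, so the comparison passes through the
subposet `s`. -/
lemma trivOn_diagram_iff {P Q : Type} [PartialOrder P] [PartialOrder Q] {e : Fin 2} (S : Shape Q)
    (T : Shape P) (c : P → Q) {s t : Finset P} (hts : t ⊆ s)
    (hc : ∀ a ∈ s, ∀ b ∈ s, a ≤ b ↔ c a ≤ c b) (h : ∀ a ∈ s, T.dim a = S.dim (c a))
    (h' : ∀ a ∈ s, ∀ b ∈ s, a ≤ b → ∀ (i : Fin (T.dim b + 1)) (j : Fin (S.dim (c b) + 1)), (i : ℕ) = j →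
      (T.map a b i : ℕ) = S.map (c a) (c b) j) :
    TrivOn e (W.diagram S) (c '' s) (c '' t) ↔ FinTriv e (W.diagram T) s t := by
  let p : {a // a ∈ s} →o Q := ⟨fun a ↦ c a.1, fun a b h ↦ (hc _ a.2 _ b.2).1 h⟩
  let j : {a // a ∈ s} →o P := ⟨fun a ↦ a.1, fun a b h ↦ h⟩
  have e₁ : c '' s = p '' Set.univ := by
    ext x
    exact ⟨fun ⟨a, ha, hx⟩ ↦ ⟨⟨a, ha⟩, trivial, hx⟩, fun ⟨a, _, hx⟩ ↦ ⟨a.1, a.2, hx⟩⟩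
  have e₂ : c '' t = p '' {a | a.1 ∈ t} := by
    ext x
    exact ⟨fun ⟨a, ha, hx⟩ ↦ ⟨⟨a, hts ha⟩, ha, hx⟩, fun ⟨a, ha, hx⟩ ↦ ⟨a.1, ha, hx⟩⟩
  have e₃ : (s : Set P) = j '' Set.univ := by
    ext x
    exact ⟨fun hx ↦ ⟨⟨x, hx⟩, trivial, rfl⟩, fun ⟨a, _, hx⟩ ↦ hx ▸ a.2⟩
  have e₄ : (t : Set P) = j '' {a | a.1 ∈ t} := by
    ext x
    exact ⟨fun hx ↦ ⟨⟨x, hts hx⟩, hx, rfl⟩, fun ⟨a, ha, hx⟩ ↦ hx ▸ ha⟩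
  have key : posetNmap.{u} p ≫ W.diagram S = posetNmap j ≫ W.diagram T := by
    change Nmap (S.comap p).functor ≫ W = Nmap (T.comap j).functor ≫ W
    rw [Shape.functor_congr (S := T.comap j) (T := S.comap p) (fun a ↦ h _ a.2)
      fun a b hab ↦ h' _ a.2 _ b.2 hab]
  rw [FinTriv, e₁, e₂, e₃, e₄, trivOn_image_iff p (fun a b h ↦ (hc _ a.2 _ b.2).2 h)
    (Set.subset_univ _), trivOn_image_iff j (fun a b h ↦ h) (Set.subset_univ _), key]

lemma finTriv_diagram_iff {P Q : Type} [PartialOrder P] [PartialOrder Q] [DecidableEq Q] {e : Fin 2}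
    {S : Shape Q} {T : Shape P} (c : P → Q) {s t : Finset P} {s' t' : Finset Q}
    (hs : s.image c = s') (ht : t.image c = t') (hts : t ⊆ s)
    (hc : ∀ a ∈ s, ∀ b ∈ s, a ≤ b ↔ c a ≤ c b) (h : ∀ a ∈ s, T.dim a = S.dim (c a))
    (h' : ∀ a ∈ s, ∀ b ∈ s, a ≤ b → ∀ (i : Fin (T.dim b + 1)) (j : Fin (S.dim (c b) + 1)), (i : ℕ) = j →
      (T.map a b i : ℕ) = S.map (c a) (c b) j) :
    FinTriv e (W.diagram S) s' t' ↔ FinTriv e (W.diagram T) s t := by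
  rw [← W.trivOn_diagram_iff S T c hts hc h h', FinTriv, ← hs, ← ht, Finset.coe_image,
    Finset.coe_image]

end SimplicialObj

namespace SegalShape

/-- The rectangle has rows `W₁ → W₂ → e` and `W₀ → e₁₂ → v`, where both composites are identities,
and the last column is either `e₀₁ → v₁` or `e₀₂ → v₂`. With the first column, pullback pasting
gives that the left square is a pullback; with the second, pushout pasting from the same left square
gives that the right square is a pushout. Stability is used once in each direction. -/
lemma pasting (hC : X.IsStable) {D : N.{u} SegalShape ⟶ X.base} (h₁ : FinTriv 1 D {W₁, e₀₁} {e₀₁})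
    (h₂ : FinTriv 1 D {W₀, v₁} {v₁}) (h₃ : FinTriv 0 D {W₁, e₀₂} {W₁})
    (h₄ : FinTriv 0 D {W₀, v₂} {W₀}) (h : FinTriv 1 D {W₂, e₁₂, e₀₁, v₁} {e₁₂, e₀₁, v₁}) :
    FinTriv 1 D {W₂, e₁₂, e₀₂, v₂} {e₁₂, e₀₂, v₂} := by
  have hX := hC.1.1
  have hX' := hC.1.2
  have x₁ : FinTriv 1 D {W₀, e₀₁, v₁} {e₀₁, v₁} :=
    h₂.excision (by decide) (by decide) (by decide)
  have x₂ : FinTriv 1 D {e₀₁, v₁} {e₀₁} := finTriv_least hX hX' (by decide) (by decide)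
  have x₃ : FinTriv 1 D {W₁, W₀, e₀₁, v₁} {e₀₁} :=
    finTriv_of_pair_one hX hX' h₁ (by decide) (by decide) (by decide)
  have x₄ : FinTriv 1 D {W₁, W₀, e₀₁, v₁} {W₀, e₀₁, v₁} :=
    FinTriv.drop_right hX (x₁.trans x₂) x₃ (by decide)
  have x₅ : FinTriv 1 D {W₁, W₀, W₂, e₁₂, e₀₁, v₁} {W₁, W₀, e₀₁, v₁} :=
    finTriv_of_le hX hX' (fun q ↦ if q = W₂ then W₁ else if q = e₁₂ then W₀ else q) (by decide)
  have x₆ : FinTriv 1 D {W₀, W₂, e₁₂, e₀₁, v₁} {W₀, e₁₂, e₀₁, v₁} :=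
    h.excision (by decide) (by decide) (by decide)
  have x₇ : FinTriv 1 D {W₀, e₁₂, e₀₁, v₁} {W₀, e₀₁, v₁} :=
    finTriv_of_le hX hX' (fun q ↦ if q = e₁₂ then W₀ else q) (by decide)
  -- The outer rectangle and the Segal square on the right are limits; this cancels the latter.
  have x₈ : FinTriv 1 D {W₁, W₀, W₂, e₁₂, e₀₁, v₁} {W₀, W₂, e₁₂, e₀₁, v₁} :=
    FinTriv.drop_right hX (x₆.trans x₇) (x₅.trans x₄) (by decide)
  have x₉ : FinTriv 1 D {W₀, W₂, e₁₂, e₀₁, v₁} {W₀, W₂, e₁₂} :=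
    finTriv_of_le hX hX' (fun q ↦ if q = e₀₁ then W₂ else if q = v₁ then e₁₂ else q) (by decide)
  have x₁₀ : FinTriv 1 D {W₁, W₀, W₂, e₁₂, e₀₁, v₁} {W₁, W₀, W₂, e₁₂} :=
    finTriv_of_le hX hX' (fun q ↦ if q = e₀₁ then W₂ else if q = v₁ then e₁₂ else q) (by decide)
  have x₁₁ : FinTriv 1 D {W₁, W₀, W₂, e₁₂} {W₀, W₂, e₁₂} :=
    FinTriv.drop_left x₁₀ (x₈.trans x₉) (by decide)
  -- The left square turns from a pullback into a pushout, and the dual pasting begins.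
  have y₁ := (hC.square_iff (by decide) (by decide)).1 x₁₁
  have y₂ : FinTriv 0 D {W₁, W₀, e₀₂} {W₁, W₀} := h₃.excision (by decide) (by decide) (by decide)
  have y₃ : FinTriv 0 D {W₁, W₀} {W₀} := finTriv_greatest hX hX' (by decide) (by decide)
  have y₄ : FinTriv 0 D {W₁, W₀, e₀₂, v₂} {W₀} :=
    finTriv_of_pair_zero hX hX' h₄ (by decide) (by decide) (by decide)
  have y₅ : FinTriv 0 D {W₁, W₀, e₀₂, v₂} {W₁, W₀, e₀₂} :=
    FinTriv.drop_right hX (y₂.trans y₃) y₄ (by decide)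
  have y₆ : FinTriv 0 D {W₁, W₀, W₂, e₁₂, e₀₂, v₂} {W₁, W₀, e₀₂, v₂} :=
    finTriv_of_ge hX hX' (fun q ↦ if q = W₂ then e₀₂ else if q = e₁₂ then v₂ else q) (by decide)
  have y₇ : FinTriv 0 D {W₁, W₀, W₂, e₁₂, e₀₂} {W₁, W₀, W₂, e₀₂} :=
    y₁.excision (by decide) (by decide) (by decide)
  have y₈ : FinTriv 0 D {W₁, W₀, W₂, e₀₂} {W₁, W₀, e₀₂} :=
    finTriv_of_ge hX hX' (fun q ↦ if q = W₂ then e₀₂ else q) (by decide)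
  have y₉ : FinTriv 0 D {W₁, W₀, W₂, e₁₂, e₀₂, v₂} {W₁, W₀, W₂, e₁₂, e₀₂} :=
    FinTriv.drop_right hX (y₇.trans y₈) (y₆.trans y₅) (by decide)
  have y₁₀ : FinTriv 0 D {W₁, W₀, W₂, e₁₂, e₀₂} {W₂, e₁₂, e₀₂} :=
    finTriv_of_ge hX hX' (fun q ↦ if q = W₁ then W₂ else if q = W₀ then e₁₂ else q) (by decide)
  have y₁₁ : FinTriv 0 D {W₁, W₀, W₂, e₁₂, e₀₂, v₂} {W₂, e₁₂, e₀₂, v₂} :=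
    finTriv_of_ge hX hX' (fun q ↦ if q = W₁ then W₂ else if q = W₀ then e₁₂ else q) (by decide)
  exact (hC.square_iff (by decide) (by decide)).2 (FinTriv.drop_left y₁₁ (y₉.trans y₁₀) (by decide))

end SegalShape

end

namespace SegalShape

/-- The object `q` is sent to the simplex `[dim q]`. -/
def dim : SegalShape → ℕ
  | W₂ => 2
  | W₁ | e₁₂ | e₀₁ | e₀₂ => 1
  | W₀ | v₁ | v₂ => 0

/-- The vertices of `[dim q]` as vertices of `[2]`. -/
def toTwo : (q : SegalShape) → Fin (dim q + 1) → Fin 3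
  | W₂ => ![0, 1, 2]
  | W₁ | e₀₁ => ![0, 1]
  | e₁₂ => ![1, 2]
  | e₀₂ => ![0, 2]
  | W₀ | v₁ => ![1]
  | v₂ => ![2]

/-- Maps backwards. On `W₁`, it makes the last edge of `[2]` degenerate. -/
def ofTwo : (q : SegalShape) → Fin 3 → Fin (dim q + 1)
  | W₂ => ![0, 1, 2]
  | W₁ | e₀₁ => ![0, 1, 1]
  | e₁₂ | e₀₂ => ![0, 0, 1]
  | W₀ | v₁ | v₂ => fun _ ↦ 0

/-- The maps, or those in which the order of the vertices is reversed. -/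
def vertexMap (m : Bool) (p q : SegalShape) (i : Fin (dim q + 1)) : Fin (dim p + 1) :=
  if m then (ofTwo p (toTwo q i.rev)).rev else ofTwo p (toTwo q i)

/-- The simplices in `SegalShape`. -/
def shape (m : Bool) : Shape SegalShape where
  dim := dim
  map := vertexMap m
  monotone := by revert m; decide
  map_self := by revert m; decide
  map_comp := by revert m; decide

/-- The edges and the vertex in the spine of `[2]`, as intervals. -/
def interval (m : Bool) (q : SegalShape) : ConeG 2 :=
  if q = W₂ then ⟨0, 2, by decide⟩
  else if q = (if m then e₀₁ else e₁₂) then ⟨1, 2, by decide⟩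
  else if q = (if m then e₁₂ else e₀₁) then ⟨0, 1, by decide⟩
  else ⟨1, 1, by decide⟩

end SegalShape

instance (n : ℕ) : DecidableLE (ConeG n) :=
  fun p q ↦ inferInstanceAs (Decidable (p.fst ≤ q.fst ∧ q.snd ≤ p.snd))

noncomputable section

open CategoryTheory Simplicial Opposite MonoidalCategory CartesianMonoidalCategory

variable {X : SimplicialSpace.{u}}

/-- The simplices in `ConeG n`. -/
def ConeG.shape (n : ℕ) : Shape (ConeG n) where
  dim q := q.snd - q.fst
  map p q k := ⟨min (k + (q.fst - p.fst)) (p.snd - p.fst), by omega⟩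
  monotone p q _ i j h := Fin.mk_le_mk.2 (by
    have : (i : ℕ) ≤ j := h
    omega)
  map_self q i := Fin.ext (by
    change min ((i : ℕ) + _) _ = i
    omega)
  map_comp p q r h h' i := Fin.ext (by
    have h₁ : (p.fst : ℕ) ≤ q.fst := h.1
    have h₂ : (q.fst : ℕ) ≤ r.fst := h'.1
    have h₃ : (q.snd : ℕ) ≤ p.snd := h.2
    have h₄ : (r.snd : ℕ) ≤ q.snd := h'.2
    have := r.fst_le_snd
    have := q.fst_le_snd
    change min (min ((i : ℕ) + _) _ + _) _ = min ((i : ℕ) + _) _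
    omega)

lemma ConeG.shape_functor (n : ℕ) : (ConeG.shape n).functor = ConeG.toSimplexOp n := by
  refine CategoryTheory.Functor.ext (fun _ ↦ rfl) fun p q g ↦ ?_
  refine Eq.trans ?_ ((Category.id_comp _).trans (Category.comp_id _)).symm
  refine Quiver.Hom.unop_inj (SimplexCategory.Hom.ext _ _ (OrderHom.ext _ _ (funext fun i ↦
    Fin.ext ?_)))
  have h₁ : (p.fst : ℕ) ≤ q.fst := (leOfHom g).1
  have h₂ : (q.snd : ℕ) ≤ p.snd := (leOfHom g).2
  have := q.fst_le_snd
  have h₃ : (i : ℕ) < (q.snd - q.fst : ℕ) + 1 := i.2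
  change min ((i : ℕ) + _) _ = (i : ℕ) + _
  omega

namespace SimplicialObj

variable {W : X.SimplicialObj}

lemma IsSegalObject.trivOn (hX : X.IsReedyFibrant) (hX' : X.IsSegal) (hW : W.IsSegalObject) {n : ℕ}
    (hn : 2 ≤ n) : TrivOn 1 (W.diagram (ConeG.shape n)) Set.univ {q | q ≠ ⊥} := by
  have := (isLimitCone_iff hX hX' _).1 (hW n hn)
  rwa [← ConeG.shape_functor] at this

/-- A finite part of any shape that looks like the intervals of `[n]` inherits the Segal condition.
Surjectivity is stated on endpoints, so that the hypotheses are finite checks. -/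
lemma IsSegalObject.finTriv (hX : X.IsReedyFibrant) (hX' : X.IsSegal) (hW : W.IsSegalObject) {n : ℕ}
    (hn : 2 ≤ n) {Q : Type} [PartialOrder Q] (S : Shape Q) (c : Q → ConeG n) {s t : Finset Q}
    (h₁ : ∀ a ∈ s, ∀ b ∈ s, a ≤ b ↔ c a ≤ c b)
    (h₂ : ∀ i j : Fin (n + 1), ((i = 0 ∧ j = Fin.last n) ∨
      ((i : ℕ) ≤ j ∧ (j : ℕ) ≤ i + 1 ∧ ¬ (j : ℕ) = 0 ∧ ¬ (i : ℕ) = n)) →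
        ∃ a ∈ s, (c a).fst = i ∧ (c a).snd = j)
    (h₃ : t ⊆ s ∧ ∀ a ∈ s, a ∈ t ↔ ¬ c a ≤ ⊥)
    (h₄ : ∀ a ∈ s, S.dim a = (ConeG.shape n).dim (c a))
    (h₅ : ∀ a ∈ s, ∀ b ∈ s, a ≤ b → ∀ (i : Fin (S.dim b + 1)) (j : Fin ((ConeG.shape n).dim (c b) + 1)), (i : ℕ) = j →
      (S.map a b i : ℕ) = (ConeG.shape n).map (c a) (c b) j) :
    FinTriv 1 (W.diagram S) s t := by
  rw [← W.trivOn_diagram_iff (ConeG.shape n) S c h₃.1 h₁ h₄ h₅]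
  have hc (x : ConeG n) : ∃ a ∈ s, c a = x := by
    obtain ⟨i, j, h⟩ := x
    obtain ⟨a, ha, rfl, rfl⟩ := h₂ i j h
    exact ⟨a, ha, rfl⟩
  have e₁ : c '' s = Set.univ := Set.eq_univ_of_forall hc
  have e₂ : c '' t = {q | q ≠ ⊥} := by
    ext x
    constructor
    · rintro ⟨a, ha, rfl⟩ h
      exact (h₃.2 a (h₃.1 ha)).1 ha h.le
    · intro hx
      obtain ⟨a, ha, rfl⟩ := hc x
      exact ⟨a, (h₃.2 a ha).2 fun h ↦ hx (le_bot_iff.1 h), rfl⟩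
  rw [e₁, e₂]
  exact hW.trivOn hX hX' hn

lemma equivTriv_structureMap_id (hX : X.IsReedyFibrant) (hX' : X.IsSegal) (e : Fin 2) {n : ℕ}
    (W : X.SimplicialObj) (θ : ⦋n⦌ ⟶ ⦋n⦌) (h : ∀ i : Fin (n + 1), θ.toOrderHom i = i) :
    EquivTriv e (W.structureMap θ) := by
  obtain rfl : θ = 𝟙 _ := SimplexCategory.Hom.ext _ _ (OrderHom.ext _ _ (funext h))
  rw [structureMap_id]
  exact equivTriv_σ hX hX' e _

-- The Segal square over the middle vertex yields the square over an end vertex, as for a groupoid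
-- object. The flag `m` reverses the vertices, which gives both outer horns from one pasting
-- argument.
open SegalShape in
lemma IsSegalObject.finTriv_outer (hC : X.IsStable) (hW : W.IsSegalObject) (m : Bool) :
    FinTriv 1 (W.diagram (SegalShape.shape m)) {W₂, e₁₂, e₀₂, v₂} {e₁₂, e₀₂, v₂} := by
  have hX := hC.1.1
  have hX' := hC.1.2
  have key {n : ℕ} (e) {p q : SegalShape} (h : p ≤ q) (θ : ⦋n⦌ ⟶ ⦋n⦌)
      (h₁ : W.structureMap ((SegalShape.shape m).hom h) = W.structureMap θ)
      (h₂ : ∀ i : Fin (n + 1), θ.toOrderHom i = i) :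
      EquivTriv e ((W.diagram (SegalShape.shape m)).app _ (arrow (homOfLE h))) := by
    rw [diagram_arrow, h₁]
    exact equivTriv_structureMap_id hX hX' e W θ h₂
  refine SegalShape.pasting hC ((finTriv_pair_one (by decide) (by decide)).2 ?_)
    ((finTriv_pair_one (by decide) (by decide)).2 ?_)
    ((finTriv_pair_zero (by decide) (by decide)).2 ?_)
    ((finTriv_pair_zero (by decide) (by decide)).2 ?_) ?_
  · exact key (n := 1) _ _ _ rfl (by clear key; revert m; decide)
  · exact key (n := 0) _ _ _ rfl (by clear key; revert m; decide)
  · exact key (n := 1) _ _ _ rfl (by clear key; revert m; decide)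
  · exact key (n := 0) _ _ _ rfl (by clear key; revert m; decide)
  · exact hW.finTriv hX hX' le_rfl (SegalShape.shape m) (interval m)
      (by clear key; revert m; decide)
      (by clear key; revert m; decide) (by clear key; revert m; decide) (by clear key; revert m; decide) (by clear key; revert m; decide)

end SimplicialObj

end

/-! ### The comparison of the objects of 3-simplices and of zigzags, and the degeneracy -/

/-- The faces of a tetrahedron that occur in the definition of the object of equivalences, or in the
spine, or between them. -/
inductive TetraShape : Type
  | f₀₁₂₃ | f₀₁₂ | f₁₂₃ | e₀₁ | e₁₂ | e₂₃ | e₀₂ | e₁₃ | v₁ | v₂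
  deriving DecidableEq

namespace TetraShape

instance : Fintype TetraShape where
  elems := {f₀₁₂₃, f₀₁₂, f₁₂₃, e₀₁, e₁₂, e₂₃, e₀₂, e₁₃, v₁, v₂}
  complete q := by cases q <;> decide

/-- The vertices. -/
def vertices : TetraShape → Finset (Fin 4)
  | f₀₁₂₃ => {0, 1, 2, 3}
  | f₀₁₂ => {0, 1, 2}
  | f₁₂₃ => {1, 2, 3}
  | e₀₁ => {0, 1}
  | e₁₂ => {1, 2}
  | e₂₃ => {2, 3}
  | e₀₂ => {0, 2}
  | e₁₃ => {1, 3}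
  | v₁ => {1}
  | v₂ => {2}

instance : PartialOrder TetraShape where
  le p q := vertices q ⊆ vertices p
  le_refl _ := subset_rfl
  le_trans _ _ _ h h' := h'.trans h
  le_antisymm := by decide

instance : DecidableLE TetraShape :=
  fun p q ↦ inferInstanceAs (Decidable (vertices q ⊆ vertices p))

/-- The object `q` is sent to the simplex `[dim q]`. -/
def dim : TetraShape → ℕ
  | f₀₁₂₃ => 3
  | f₀₁₂ | f₁₂₃ => 2
  | e₀₁ | e₁₂ | e₂₃ | e₀₂ | e₁₃ => 1
  | v₁ | v₂ => 0

/-- The vertices of `[dim q]` as vertices of `[3]`. -/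
def toThree : (q : TetraShape) → Fin (dim q + 1) → Fin 4
  | f₀₁₂₃ => ![0, 1, 2, 3]
  | f₀₁₂ => ![0, 1, 2]
  | f₁₂₃ => ![1, 2, 3]
  | e₀₁ => ![0, 1]
  | e₁₂ => ![1, 2]
  | e₂₃ => ![2, 3]
  | e₀₂ => ![0, 2]
  | e₁₃ => ![1, 3]
  | v₁ => ![1]
  | v₂ => ![2]

/-- Maps backwards. -/
def ofThree : (q : TetraShape) → Fin 4 → Fin (dim q + 1)
  | f₀₁₂₃ => ![0, 1, 2, 3]
  | f₀₁₂ => ![0, 1, 2, 2]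
  | f₁₂₃ => ![0, 0, 1, 2]
  | e₀₁ => ![0, 1, 1, 1]
  | e₁₂ | e₀₂ => ![0, 0, 1, 1]
  | e₂₃ | e₁₃ => ![0, 0, 0, 1]
  | v₁ | v₂ => fun _ ↦ 0

/-- The simplices in `TetraShape`. -/
def shape : Shape TetraShape where
  dim := dim
  map p q i := ofThree p (toThree q i)
  monotone := by decide
  map_self := by decide
  map_comp := by decide

/-- The spine of `[3]`, as intervals. -/
def interval₃ (q : TetraShape) : ConeG 3 :=
  if q = e₀₁ then ⟨0, 1, by decide⟩
  else if q = v₁ then ⟨1, 1, by decide⟩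
  else if q = e₁₂ then ⟨1, 2, by decide⟩
  else if q = v₂ then ⟨2, 2, by decide⟩
  else if q = e₂₃ then ⟨2, 3, by decide⟩
  else ⟨0, 3, by decide⟩

/-- The spine of a triangle, as intervals. -/
def interval₂ (m : Bool) (q : TetraShape) : ConeG 2 :=
  if q = (if m then e₁₂ else e₀₁) then ⟨0, 1, by decide⟩
  else if q = (if m then v₂ else v₁) then ⟨1, 1, by decide⟩
  else if q = (if m then e₂₃ else e₁₂) then ⟨1, 2, by decide⟩
  else ⟨0, 2, by decide⟩

/-- The triangles `02 → 2 ← 12` and `13 → 1 ← 12`. -/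
def triangle (m : Bool) (q : SegalShape) : TetraShape :=
  if q = .e₁₂ then e₁₂
  else if q = .e₀₂ then (if m then e₁₃ else e₀₂)
  else if q = .v₂ then (if m then v₁ else v₂)
  else (if m then f₁₂₃ else f₀₁₂)

end TetraShape

namespace EquivShape

/-- The simplices in `Core`. -/
def coreShape : Shape Core where
  dim q := dim q.1
  map p q := vertexMap p.1 q.1
  monotone p q := vertexMap_monotone p.1 q.1
  map_self q := vertexMap_self q.1
  map_comp p q r h h' := vertexMap_comp p.1 q.1 r.1 h h' q.2

/-- The zigzag as part of a tetrahedron. -/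
def toTetra (q : Core) : TetraShape :=
  if q.1 = e₀₂ then .e₀₂
  else if q.1 = e₁₂ then .e₁₂
  else if q.1 = e₁₃ then .e₁₃
  else if q.1 = v₂ then .v₂
  else if q.1 = v₁ then .v₁
  else .f₀₁₂₃

/-- Some objects of `Core`. -/
def coreSet (s : Finset EquivShape) : Finset Core := Finset.univ.filter (fun q ↦ q.1 ∈ s)

end EquivShape

noncomputable section

open CategoryTheory Simplicial Opposite MonoidalCategory CartesianMonoidalCategory

variable {X : SimplicialSpace.{u}}

/-- A single deformation `r` retracts the enlarged sets onto the original ones, so elements can be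
added to both sides at once. -/
lemma FinTriv.extend {Q : Type} [PartialOrder Q] {D : N.{u} Q ⟶ X.base} {s t s' t' : Finset Q}
    (hX : X.IsReedyFibrant) (hX' : X.IsSegal) (h : FinTriv 1 D s t) (r : Q → Q) (hst : t' ⊆ s')
    (hs : s ⊆ s' ∧ (∀ a ∈ s', r a ∈ s) ∧ (∀ a ∈ s', ∀ b ∈ s', a ≤ b → r a ≤ r b) ∧ ∀ a ∈ s', r a ≤ a)
    (ht : t ⊆ t' ∧ ∀ a ∈ t', r a ∈ t) : FinTriv 1 D s' t' :=
  FinTriv.drop_right hX (finTriv_of_le hX hX' r ⟨ht.1, ht.2, fun a ha b hb ↦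
    hs.2.2.1 a (hst ha) b (hst hb), fun a ha ↦ hs.2.2.2 a (hst ha)⟩)
    ((finTriv_of_le hX hX' r hs).trans h) hst

namespace SimplicialObj

variable {W : X.SimplicialObj}

section

open TetraShape

/-- The objects of `3`-simplices is the limit of the zigzag. -/
lemma IsSegalObject.finTriv_zigzag (hC : X.IsStable) (hW : W.IsSegalObject) :
    FinTriv 1 (W.diagram TetraShape.shape) {f₀₁₂₃, e₀₂, e₁₂, e₁₃, v₂, v₁}
      {e₀₂, e₁₂, e₁₃, v₂, v₁} := by
  have hX := hC.1.1
  have hX' := hC.1.2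
  have a₁ : FinTriv 1 (W.diagram TetraShape.shape) {f₀₁₂₃, e₀₁, v₁, e₁₂, v₂, e₂₃}
      {e₀₁, v₁, e₁₂, v₂, e₂₃} :=
    hW.finTriv hX hX' (by decide) TetraShape.shape interval₃ (by decide) (by decide) (by decide)
      (by decide) (by decide)
  have a₂ : FinTriv 1 (W.diagram TetraShape.shape) {f₀₁₂, e₀₁, v₁, e₁₂} {e₀₁, v₁, e₁₂} :=
    hW.finTriv hX hX' le_rfl TetraShape.shape (interval₂ false) (by decide) (by decide) (by decide)
      (by decide) (by decide)
  have a₃ : FinTriv 1 (W.diagram TetraShape.shape) {f₁₂₃, e₁₂, v₂, e₂₃} {e₁₂, v₂, e₂₃} :=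
    hW.finTriv hX hX' le_rfl TetraShape.shape (interval₂ true) (by decide) (by decide) (by decide)
      (by decide) (by decide)
  have a₄ : FinTriv 1 (W.diagram TetraShape.shape) {f₀₁₂, e₁₂, e₀₂, v₂} {e₁₂, e₀₂, v₂} :=
    (W.finTriv_diagram_iff (triangle false) (by decide) (by decide) (by decide) (by decide)
      (by decide) (by decide)).2 (hW.finTriv_outer hC false)
  have a₅ : FinTriv 1 (W.diagram TetraShape.shape) {f₁₂₃, e₁₂, e₁₃, v₁} {e₁₂, e₁₃, v₁} :=
    (W.finTriv_diagram_iff (triangle true) (by decide) (by decide) (by decide) (by decide)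
      (by decide) (by decide)).2 (hW.finTriv_outer hC true)
  generalize W.diagram TetraShape.shape = D at *
  have b₂ : FinTriv 1 D {f₀₁₂, e₀₁, v₁, e₁₂, v₂} {e₀₁, v₁, e₁₂, v₂} :=
    a₂.extend hX hX' (fun q ↦ if q = v₂ then e₁₂ else q) (by decide) (by decide) (by decide)
  have b₃ : FinTriv 1 D {f₁₂₃, e₁₂, v₂, e₂₃, v₁} {e₁₂, v₂, e₂₃, v₁} :=
    a₃.extend hX hX' (fun q ↦ if q = v₁ then e₁₂ else q) (by decide) (by decide) (by decide)
  have b₄ : FinTriv 1 D {f₀₁₂, e₁₂, e₀₂, v₂, v₁} {e₁₂, e₀₂, v₂, v₁} :=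
    a₄.extend hX hX' (fun q ↦ if q = v₁ then e₁₂ else q) (by decide) (by decide) (by decide)
  have b₅ : FinTriv 1 D {f₁₂₃, e₁₂, e₁₃, v₁, v₂} {e₁₂, e₁₃, v₁, v₂} :=
    a₅.extend hX hX' (fun q ↦ if q = v₂ then e₁₂ else q) (by decide) (by decide) (by decide)
  -- The triangles `012` and `123` are attached to the spine, without changing the limit.
  have c₁ : FinTriv 1 D {f₀₁₂, e₀₁, v₁, e₁₂, v₂, e₂₃} {e₀₁, v₁, e₁₂, v₂, e₂₃} :=
    b₂.excision (by decide) (by decide) (by decide)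
  have c₂ : FinTriv 1 D {f₀₁₂, f₁₂₃, e₀₁, v₁, e₁₂, v₂, e₂₃} {f₀₁₂, e₀₁, v₁, e₁₂, v₂, e₂₃} :=
    b₃.excision (by decide) (by decide) (by decide)
  have c₃ : FinTriv 1 D {f₀₁₂₃, f₀₁₂, f₁₂₃, e₀₁, v₁, e₁₂, v₂, e₂₃}
      {f₀₁₂, f₁₂₃, e₀₁, v₁, e₁₂, v₂, e₂₃} :=
    FinTriv.drop_right hX (c₂.trans c₁) ((finTriv_of_le hX hX'
      (fun q ↦ if q = f₀₁₂ then f₀₁₂₃ else if q = f₁₂₃ then f₀₁₂₃ else q) (by decide)).trans a₁)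
      (by decide)
  have c₄ : FinTriv 1 D {f₀₁₂, f₁₂₃, e₀₁, v₁, e₁₂, v₂, e₂₃} {f₀₁₂, f₁₂₃, e₁₂, v₁, v₂} :=
    finTriv_of_le hX hX' (fun q ↦ if q = e₀₁ then f₀₁₂ else if q = e₂₃ then f₁₂₃ else q) (by decide)
  have c₅ : FinTriv 1 D {f₀₁₂₃, f₀₁₂, f₁₂₃, e₀₁, v₁, e₁₂, v₂, e₂₃}
      {f₀₁₂₃, f₀₁₂, f₁₂₃, e₁₂, v₁, v₂} :=
    finTriv_of_le hX hX' (fun q ↦ if q = e₀₁ then f₀₁₂ else if q = e₂₃ then f₁₂₃ else q) (by decide)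
  -- The edges `01` and `23` are implied by the triangles; what is left is `W_3` as the fibre
  -- product of two copies of `W_2` over the edge `12`.
  have c₆ : FinTriv 1 D {f₀₁₂₃, f₀₁₂, f₁₂₃, e₁₂, v₁, v₂} {f₀₁₂, f₁₂₃, e₁₂, v₁, v₂} :=
    FinTriv.drop_left c₅ (c₃.trans c₄) (by decide)
  have d₁ : FinTriv 1 D {f₀₁₂₃, f₀₁₂, f₁₂₃, e₁₂, v₁, v₂, e₀₂, e₁₃}
      {f₀₁₂, f₁₂₃, e₁₂, v₁, v₂, e₀₂, e₁₃} :=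
    c₆.extend hX hX' (fun q ↦ if q = e₀₂ then f₀₁₂ else if q = e₁₃ then f₁₂₃ else q)
      (by decide) (by decide) (by decide)
  -- The outer Segal squares now allow each triangle to be replaced by its edge `13` or `02`, which
  -- leaves the zigzag.
  have d₂ : FinTriv 1 D {f₀₁₂, f₁₂₃, e₁₂, v₁, v₂, e₀₂, e₁₃} {f₀₁₂, e₁₂, v₁, v₂, e₀₂, e₁₃} :=
    b₅.excision (by decide) (by decide) (by decide)
  have d₃ : FinTriv 1 D {f₀₁₂, e₁₂, v₁, v₂, e₀₂, e₁₃} {e₀₂, e₁₂, e₁₃, v₂, v₁} :=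
    b₄.excision (by decide) (by decide) (by decide)
  exact FinTriv.drop_left (finTriv_of_le hX hX'
    (fun q ↦ if q = f₀₁₂ then f₀₁₂₃ else if q = f₁₂₃ then f₀₁₂₃ else q) (by decide))
    (d₁.trans (d₂.trans d₃)) (by decide)

end

section

open EquivShape

variable {G : posetN.{u} EquivShape ⟶ X.base}

lemma IsEquivalencesDiagram.finTriv_core (hG : W.IsEquivalencesDiagram G) {s t : Finset EquivShape}
    (hs : ((coreSet s).image fun q ↦ q.1) = s) (ht : ((coreSet t).image fun q ↦ q.1) = t)
    (hts : coreSet t ⊆ coreSet s) :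
    FinTriv 1 G s t ↔ FinTriv 1 (W.diagram coreShape) (coreSet s) (coreSet t) := by
  rw [finTriv_image_iff ⟨Subtype.val, Subtype.mono_coe _⟩ (fun _ _ h ↦ h) hs ht hts]
  exact iff_of_eq (congrArg (fun D ↦ FinTriv 1 D _ _) hG.core)

lemma IsEquivalencesDiagram.finTriv_three (hC : X.IsStable) (hW : W.IsSegalObject)
    (hG : W.IsEquivalencesDiagram G) :
    FinTriv 1 G {T₃, e₀₂, e₁₂, e₁₃, v₂, v₁} {e₀₂, e₁₂, e₁₃, v₂, v₁} :=
  (hG.finTriv_core (by decide) (by decide) (by decide)).2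
    ((W.finTriv_diagram_iff toTetra (by decide) (by decide) (by decide) (by decide) (by decide)
      (by decide)).1 (hW.finTriv_zigzag hC))

lemma IsEquivalencesDiagram.finTriv_limit (hC : X.IsStable) (hG : W.IsEquivalencesDiagram G) :
    FinTriv 1 G {Z₃, e₀₂, e₁₂, e₁₃, v₂, v₁} {e₀₂, e₁₂, e₁₃, v₂, v₁} := by
  have h := (isLimitCone_iff hC.1.1 hC.1.2 _).1 hG.limit
  let p : Set.Ici Z₃ →o EquivShape := ⟨Subtype.val, Subtype.mono_coe _⟩
  have h' := (trivOn_image_iff p (fun _ _ h ↦ h) (Set.subset_univ _)).2 h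
  have e₁ : p '' Set.univ = ({Z₃, e₀₂, e₁₂, e₁₃, v₂, v₁} : Finset EquivShape) := by
    ext x
    have : x ∈ p '' Set.univ ↔ Z₃ ≤ x := ⟨by rintro ⟨y, -, rfl⟩; exact y.2, fun h ↦ ⟨⟨x, h⟩, trivial, rfl⟩⟩
    rw [this, Finset.mem_coe]
    clear this
    revert x
    decide
  have e₂ : p '' {q | q ≠ ⊥} = ({e₀₂, e₁₂, e₁₃, v₂, v₁} : Finset EquivShape) := by
    ext x
    have : x ∈ p '' {q | q ≠ ⊥} ↔ Z₃ ≤ x ∧ x ≠ Z₃ :=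
      ⟨by rintro ⟨y, hy, rfl⟩; exact ⟨y.2, fun h ↦ hy (Subtype.ext h)⟩,
        fun h ↦ ⟨⟨x, h.1⟩, fun h' ↦ h.2 (congrArg Subtype.val h'), rfl⟩⟩
    rw [this, Finset.mem_coe]
    clear this
    revert x
    decide
  rw [FinTriv, ← e₁, ← e₂]
  exact h'

lemma IsEquivalencesDiagram.finTriv_square (hC : X.IsStable) (hG : W.IsEquivalencesDiagram G) :
    FinTriv 1 G {hoequiv, T₃, T₁, Z₃} {T₃, T₁, Z₃} := by
  refine (finTriv_image_iff square (by decide) (s' := Finset.univ)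
    (t' := {(0, 1), (1, 0), (1, 1)}) (by decide) (by decide) (by decide)).2 ?_
  have h := (isLimitCone_iff hC.1.1 hC.1.2 _).1 hG.pullback
  rw [FinTriv, Finset.coe_univ, ← square_ne_bot]
  exact h

/-- Both `T₃` and `Z₃` are limits of the same zigzag, so `T₃ → Z₃` is an equivalence. Its base
change `hoequiv → T₁` is one too, and composing with the completeness equivalence from `W₀` gives
the degeneracy. -/
lemma IsEquivalencesDiagram.equivTriv_s₀ (hC : X.IsStable) (hW : W.IsSegalObject)
    (hG : W.IsEquivalencesDiagram G)
    (h : X.IsEquivalence (G.app _ (arrow (homOfLE (by decide : W₀ ≤ hoequiv))))) :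
    EquivTriv 1 W.s₀ := by
  have hX := hC.1.1
  have hX' := hC.1.2
  have h₁ : FinTriv 1 G {T₃, Z₃, e₀₂, e₁₂, e₁₃, v₂, v₁} {T₃, e₀₂, e₁₂, e₁₃, v₂, v₁} :=
    finTriv_of_le hX hX' (fun q ↦ if q = Z₃ then T₃ else q) (by decide)
  have h₂ : FinTriv 1 G {T₃, Z₃, e₀₂, e₁₂, e₁₃, v₂, v₁} {Z₃, e₀₂, e₁₂, e₁₃, v₂, v₁} :=
    FinTriv.drop_right hX (hG.finTriv_limit hC) (h₁.trans (hG.finTriv_three hC hW)) (by decide)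
  have h₃ : FinTriv 1 G {Z₃, e₀₂, e₁₂, e₁₃, v₂, v₁} {Z₃} :=
    finTriv_least hX hX' (by decide) (by decide)
  have h₄ : FinTriv 1 G {T₃, Z₃} {Z₃} :=
    finTriv_pair_one_of_greatest hX hX' (h₂.trans h₃) (by decide) (by decide) (by decide)
  have h₅ : FinTriv 1 G {T₃, T₁, Z₃} {T₁, Z₃} := h₄.excision (by decide) (by decide) (by decide)
  have h₆ : FinTriv 1 G {T₁, Z₃} {T₁} := finTriv_least hX hX' (by decide) (by decide)
  have h₇ : FinTriv 1 G {hoequiv, T₁} {T₁} :=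
    finTriv_pair_one_of_greatest hX hX' ((hG.finTriv_square hC).trans (h₅.trans h₆)) (by decide)
      (by decide) (by decide)
  have h₈ : FinTriv 1 G {W₀, hoequiv} {hoequiv} :=
    (finTriv_pair_one (by decide) (by decide)).2 (h.equivTriv hX hX')
  have h₉ : FinTriv 1 G {W₀, hoequiv, T₁} {W₀, hoequiv} :=
    finTriv_of_le hX hX' (fun q ↦ if q = T₁ then hoequiv else q) (by decide)
  have h₁₀ : FinTriv 1 G {hoequiv, T₁} {hoequiv} := finTriv_least hX hX' (by decide) (by decide)
  have h₁₁ : FinTriv 1 G {W₀, hoequiv, T₁} {hoequiv, T₁} :=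
    FinTriv.drop_right hX h₁₀ (h₉.trans h₈) (by decide)
  have h₁₂ : FinTriv 1 G {W₀, T₁} {T₁} :=
    finTriv_pair_one_of_greatest hX hX' (h₁₁.trans h₇) (by decide) (by decide) (by decide)
  rw [hG.finTriv_core (by decide) (by decide) (by decide)] at h₁₂
  have := (finTriv_pair_one (a := (⟨W₀, by decide⟩ : Core)) (b := ⟨T₁, by decide⟩) (by decide)
    (by decide)).1 h₁₂
  rw [diagram_arrow] at this
  -- The diagram contains some map `[1] → [0]`, and there is only one.
  have e : coreShape.hom (p := ⟨W₀, by decide⟩) (q := ⟨T₁, by decide⟩) (by decide) =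
      (SimplexCategory.σ 0 : ⦋1⦌ ⟶ ⦋0⦌) := SimplexCategory.isTerminalZero.hom_ext _ _
  exact (congrArg (fun θ : ⦋1⦌ ⟶ ⦋0⦌ ↦ EquivTriv 1 (W.structureMap θ)) e).mp this

end

end SimplicialObj

end

/-! ### Triviality of complete Segal objects -/

noncomputable section

open CategoryTheory Simplicial Opposite MonoidalCategory CartesianMonoidalCategory

variable {X : SimplicialSpace.{u}}

section Chain

variable {D : N.{u} (Fin 3) ⟶ X.base} (hX : X.IsReedyFibrant) (hX' : X.IsSegal)

include hX hX'

lemma equivTriv_two_of_three_right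
    (h₀₁ : EquivTriv 1 (D.app _ (arrow (homOfLE (by decide : (0 : Fin 3) ≤ 1)))))
    (h₀₂ : EquivTriv 1 (D.app _ (arrow (homOfLE (by decide : (0 : Fin 3) ≤ 2))))) :
    EquivTriv 1 (D.app _ (arrow (homOfLE (by decide : (1 : Fin 3) ≤ 2)))) := by
  have h₁ : FinTriv 1 D Finset.univ {1} := finTriv_of_pair_one hX hX'
    ((finTriv_pair_one _ (by decide)).2 h₀₁) (by decide) (by decide) (by decide)
  have h₂ : FinTriv 1 D Finset.univ {2} := finTriv_of_pair_one hX hX'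
    ((finTriv_pair_one _ (by decide)).2 h₀₂) (by decide) (by decide) (by decide)
  have h₃ : FinTriv 1 D {1, 2} {1} := finTriv_least hX hX' (by decide) (by decide)
  exact (finTriv_pair_one _ (by decide)).1
    (FinTriv.drop_left (FinTriv.drop_right hX h₃ h₁ (by decide)) h₂ (by decide))

lemma equivTriv_two_of_three_left
    (h₁₂ : EquivTriv 1 (D.app _ (arrow (homOfLE (by decide : (1 : Fin 3) ≤ 2)))))
    (h₀₂ : EquivTriv 1 (D.app _ (arrow (homOfLE (by decide : (0 : Fin 3) ≤ 2))))) :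
    EquivTriv 1 (D.app _ (arrow (homOfLE (by decide : (0 : Fin 3) ≤ 1)))) := by
  have h₁ : FinTriv 1 D {1, 2} {2} := (finTriv_pair_one _ (by decide)).2 h₁₂
  have h₂ : FinTriv 1 D Finset.univ {2} := finTriv_of_pair_one hX hX'
    ((finTriv_pair_one _ (by decide)).2 h₀₂) (by decide) (by decide) (by decide)
  have h₃ : FinTriv 1 D {1, 2} {1} := finTriv_least hX hX' (by decide) (by decide)
  exact (finTriv_pair_one _ (by decide)).1 (finTriv_pair_one_of_greatest hX hX'
    ((FinTriv.drop_right hX h₁ h₂ (by decide)).trans h₃) (by decide) (by decide) (by decide))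

lemma equivTriv_two_of_three_comp
    (h₀₁ : EquivTriv 1 (D.app _ (arrow (homOfLE (by decide : (0 : Fin 3) ≤ 1)))))
    (h₁₂ : EquivTriv 1 (D.app _ (arrow (homOfLE (by decide : (1 : Fin 3) ≤ 2))))) :
    EquivTriv 1 (D.app _ (arrow (homOfLE (by decide : (0 : Fin 3) ≤ 2)))) := by
  have h₁ : FinTriv 1 D Finset.univ {1} := finTriv_of_pair_one hX hX'
    ((finTriv_pair_one _ (by decide)).2 h₀₁) (by decide) (by decide) (by decide)
  have h₂ : FinTriv 1 D {1, 2} {2} := (finTriv_pair_one _ (by decide)).2 h₁₂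
  have h₃ : FinTriv 1 D {1, 2} {1} := finTriv_least hX hX' (by decide) (by decide)
  exact (finTriv_pair_one _ (by decide)).1 (finTriv_pair_one_of_greatest hX hX'
    ((FinTriv.drop_right hX h₃ h₁ (by decide)).trans h₂) (by decide) (by decide) (by decide))

end Chain

namespace SimplicialObj

variable {W : X.SimplicialObj}

lemma exists_chain (W : X.SimplicialObj) {k m n : SimplexCategory} (θ : n ⟶ m) (φ : m ⟶ k) :
    ∃ D : N.{u} (Fin 3) ⟶ X.base,
      D.app _ (arrow (homOfLE (by decide : (0 : Fin 3) ≤ 1))) = W.structureMap φ ∧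
      D.app _ (arrow (homOfLE (by decide : (1 : Fin 3) ≤ 2))) = W.structureMap θ ∧
      D.app _ (arrow (homOfLE (by decide : (0 : Fin 3) ≤ 2))) = W.structureMap (θ ≫ φ) := by
  refine ⟨Nmap (ComposableArrows.mk₂ φ.op θ.op) ≫ W, ?_, ?_, ?_⟩ <;>
  exact congrArg (fun z ↦ W.app _ (ULift.up z))
    (ComposableArrows.ext₁ rfl rfl ((Category.id_comp _).trans (Category.comp_id _)).symm)

section

variable (hX : X.IsReedyFibrant) (hX' : X.IsSegal)

include hX hX'

lemma equivTriv_comp {k m n : SimplexCategory} {θ : n ⟶ m} {φ : m ⟶ k}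
    (h : EquivTriv 1 (W.structureMap θ)) (h' : EquivTriv 1 (W.structureMap φ)) :
    EquivTriv 1 (W.structureMap (θ ≫ φ)) := by
  obtain ⟨D, h₁, h₂, h₃⟩ := W.exists_chain θ φ
  rw [← h₃]
  exact equivTriv_two_of_three_comp hX hX' (h₁ ▸ h') (h₂ ▸ h)

lemma equivTriv_of_comp_left {k m n : SimplexCategory} {θ : n ⟶ m} {φ : m ⟶ k}
    (h : EquivTriv 1 (W.structureMap θ)) (h' : EquivTriv 1 (W.structureMap (θ ≫ φ))) :
    EquivTriv 1 (W.structureMap φ) := by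
  obtain ⟨D, h₁, h₂, h₃⟩ := W.exists_chain θ φ
  rw [← h₁]
  exact equivTriv_two_of_three_left hX hX' (h₂ ▸ h) (h₃ ▸ h')

lemma equivTriv_of_comp_right {k m n : SimplexCategory} {θ : n ⟶ m} {φ : m ⟶ k}
    (h : EquivTriv 1 (W.structureMap φ)) (h' : EquivTriv 1 (W.structureMap (θ ≫ φ))) :
    EquivTriv 1 (W.structureMap θ) := by
  obtain ⟨D, h₁, h₂, h₃⟩ := W.exists_chain θ φ
  rw [← h₂]
  exact equivTriv_two_of_three_right hX hX' (h₁ ▸ h) (h₃ ▸ h')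

lemma equivTriv_id (n : SimplexCategory) : EquivTriv 1 (W.structureMap (𝟙 n)) := by
  rw [structureMap_id]
  exact equivTriv_σ hX hX' 1 _

/-- Each vertex of `[1]` is a section of the map to `[0]`, so cancellation with `s₀` applies. The
dimensions enter as equations because those of `ConeG.shape` are known only propositionally. -/
lemma equivTriv_vertex (hs : EquivTriv 1 W.s₀) {m n : ℕ} (hm : m = 0) (hn : n = 1)
    (θ : ⦋m⦌ ⟶ ⦋n⦌) : EquivTriv 1 (W.structureMap θ) := by
  subst hm hn
  refine equivTriv_of_comp_right hX hX' hs ?_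
  rw [SimplexCategory.isTerminalZero.hom_ext (θ ≫ SimplexCategory.σ 0) (𝟙 _)]
  exact equivTriv_id hX hX' _

end

end SimplicialObj

namespace ConeG

variable {n : ℕ}

/-- The edges of the spine. -/
def edge (k : ℕ) (h : k + 1 ≤ n) : ConeG n where
  fst := ⟨k, by omega⟩
  snd := ⟨k + 1, by omega⟩
  mem := Or.inr ⟨k.le_succ, le_rfl, k.succ_ne_zero, by change ¬ k = n; omega⟩

/-- The inner vertices of the spine. -/
def inner (k : ℕ) (h : k + 2 ≤ n) : ConeG n where
  fst := ⟨k + 1, by omega⟩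
  snd := ⟨k + 1, by omega⟩
  mem := Or.inr ⟨le_rfl, (k + 1).le_succ, k.succ_ne_zero, by change ¬ k + 1 = n; omega⟩

lemma eq_iff (p q : ConeG n) : p = q ↔ (p.fst : ℕ) = q.fst ∧ (p.snd : ℕ) = q.snd := by
  obtain ⟨i, j, _⟩ := p
  obtain ⟨i', j', _⟩ := q
  simp [Fin.ext_iff]

lemma le_iff (p q : ConeG n) : p ≤ q ↔ (p.fst : ℕ) ≤ q.fst ∧ (q.snd : ℕ) ≤ p.snd := Iff.rfl

lemma eq_edge {k : ℕ} (h : k + 1 ≤ n) (p : ConeG n) :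
    p = edge k h ↔ (p.fst : ℕ) = k ∧ (p.snd : ℕ) = k + 1 := eq_iff _ _

lemma eq_inner {k : ℕ} (h : k + 2 ≤ n) (p : ConeG n) :
    p = inner k h ↔ (p.fst : ℕ) = k + 1 ∧ (p.snd : ℕ) = k + 1 := eq_iff _ _

lemma edge_le_inner {k : ℕ} (h : k + 2 ≤ n) : edge (k + 1) h ≤ inner k h :=
  (le_iff _ _).2 ⟨le_rfl, (k + 1).le_succ⟩

lemma not_inner_le_edge {k : ℕ} (h : k + 2 ≤ n) : ¬ inner k h ≤ edge (k + 1) h :=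
  fun h' ↦ (k + 1).not_succ_le_self ((le_iff _ _).1 h').2

lemma dim_edge {k : ℕ} (h : k + 1 ≤ n) : (shape n).dim (edge k h) = 1 :=
  Nat.add_sub_cancel_left (n := k) (m := 1)

lemma dim_inner {k : ℕ} (h : k + 2 ≤ n) : (shape n).dim (inner k h) = 0 := Nat.sub_self (k + 1)

lemma eq_bot (p : ConeG n) : p = ⊥ ↔ (p.fst : ℕ) = 0 ∧ (p.snd : ℕ) = n := eq_iff _ _

lemma mem_iff (p : ConeG n) : ((p.fst : ℕ) = 0 ∧ (p.snd : ℕ) = n) ∨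
    ((p.fst : ℕ) ≤ p.snd ∧ (p.snd : ℕ) ≤ p.fst + 1 ∧ ¬ (p.snd : ℕ) = 0 ∧ ¬ (p.fst : ℕ) = n) :=
  p.mem.imp (fun h ↦ ⟨congrArg Fin.val h.1, congrArg Fin.val h.2⟩) id

/-- The first edges of the spine, and the vertices between them. -/
def initial (n k : ℕ) : Set (ConeG n) := {p | p ≠ ⊥ ∧ (p.fst : ℕ) ≤ k ∧ (p.snd : ℕ) ≤ k + 1}

/-- The inner vertex lies above the preceding edge, so attaching it is a deformation; the next edge
is then attached at this vertex by excision, where `hD` applies. -/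
lemma trivOn_initial_succ (hX : X.IsReedyFibrant) (hX' : X.IsSegal) (hn : 2 ≤ n)
    (D : N.{u} (ConeG n) ⟶ X.base) {k : ℕ} (h : k + 2 ≤ n)
    (hD : TrivOn 1 D {edge (k + 1) h, inner k h} {inner k h}) :
    TrivOn 1 D (initial n (k + 1)) (initial n k) := by
  have h₁ : TrivOn 1 D ({edge k (by omega), inner k h} ∪ initial n k) (initial n k) := by
    refine trivOn_sup ?_ ?_
    · have : ({edge k (by omega), inner k h} ∩ initial n k : Set (ConeG n)) =
          {edge k (by omega)} := by
        ext p
        simp only [Set.mem_inter_iff, Set.mem_insert_iff, Set.mem_singleton_iff, initial,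
          Set.mem_ofPred_eq, ne_eq, eq_edge, eq_inner, eq_bot]
        omega
      rw [this]
      refine trivOn_of_isExtremal hX hX' ⟨by simp, fun q hq ↦ ⟨fun _ ↦ ?_, fun h ↦ by simp at h⟩⟩
      simp only [Set.mem_insert_iff, Set.mem_singleton_iff, eq_edge, eq_inner] at hq
      refine (le_iff _ _).2 ?_
      change k ≤ _ ∧ _ ≤ k + 1
      omega
    · intro p hp hp' q hq hq'
      simp only [Set.mem_insert_iff, Set.mem_singleton_iff, initial,
          Set.mem_ofPred_eq, ne_eq, eq_edge, eq_inner, eq_bot, le_iff] at *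
      have := p.mem_iff
      have := q.mem_iff
      omega
  have h₂ : TrivOn 1 D ({edge (k + 1) h, inner k h} ∪
      ({edge k (by omega), inner k h} ∪ initial n k))
      ({edge k (by omega), inner k h} ∪ initial n k) := by
    refine trivOn_sup ?_ ?_
    · have : ({edge (k + 1) h, inner k h} ∩ ({edge k (by omega), inner k h} ∪ initial n k) :
          Set (ConeG n)) = {inner k h} := by
        ext p
        simp only [Set.mem_inter_iff, Set.mem_union, Set.mem_insert_iff, Set.mem_singleton_iff,
          initial, Set.mem_ofPred_eq, ne_eq, eq_edge, eq_inner, eq_bot]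
        omega
      rw [this]
      exact hD
    · intro p hp hp' q hq hq'
      simp only [Set.mem_union, Set.mem_insert_iff, Set.mem_singleton_iff, initial,
          Set.mem_ofPred_eq, ne_eq, eq_edge, eq_inner, eq_bot, le_iff] at *
      have := p.mem_iff
      have := q.mem_iff
      omega
  have h₃ : initial n (k + 1) = {edge (k + 1) h, inner k h} ∪
      ({edge k (by omega), inner k h} ∪ initial n k) := by
    ext p
    simp only [Set.mem_union, Set.mem_insert_iff, Set.mem_singleton_iff, initial,
      Set.mem_ofPred_eq, ne_eq, eq_edge, eq_inner, eq_bot]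
    have := p.mem_iff
    omega
  rw [h₃]
  exact h₂.trans h₁

/-- When all later edges restrict trivially to their first vertices, the spine collapses edge by
edge onto its first edge, so the limit is the value at that edge. -/
lemma equivTriv_edge (hX : X.IsReedyFibrant) (hX' : X.IsSegal) (hn : 2 ≤ n)
    (D : N.{u} (ConeG n) ⟶ X.base) (h : TrivOn 1 D Set.univ {q | q ≠ ⊥})
    (hD : ∀ k (h : k + 2 ≤ n), TrivOn 1 D {edge (k + 1) h, inner k h} {inner k h}) :
    EquivTriv 1 (D.app _ (arrow (homOfLE (bot_le : ⊥ ≤ edge 0 (by omega : 0 + 1 ≤ n))))) := by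
  have h₁ (k : ℕ) (hk : k + 1 ≤ n) : TrivOn 1 D (initial n k) (initial n 0) := by
    induction k with
    | zero => exact TrivPair.refl _
    | succ k ih => exact (trivOn_initial_succ hX hX' hn D hk (hD k hk)).trans (ih (by omega))
  have h₂ : initial n (n - 1) = {q | q ≠ ⊥} := by
    ext p
    simp only [initial, Set.mem_ofPred_eq, ne_eq, eq_bot]
    have := p.mem_iff
    omega
  have h₃ : initial n 0 = {edge 0 (by omega)} := by
    ext p
    simp only [initial, Set.mem_ofPred_eq, ne_eq, eq_bot, Set.mem_singleton_iff, eq_edge]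
    have := p.mem_iff
    omega
  have h₄ := h₁ (n - 1) (by omega)
  rw [h₂, h₃] at h₄
  have h₅ : ∀ R : Set (ConeG n), ⊥ ∈ R → TrivOn 1 D R {⊥} := fun R hR ↦
    trivOn_of_isExtremal hX hX' ⟨hR, fun q _ ↦ ⟨fun _ ↦ bot_le, fun h ↦ by simp at h⟩⟩
  refine (trivOn_pair_one bot_le ?_).1 (TrivPair.of_trans_left (TrivPair.of_trans_right hX
    (h₅ {⊥, edge 0 (by omega)} (by simp)) (h₅ Set.univ trivial) (NS_mono (Set.subset_univ _)))
    (h.trans h₄) (NS_mono (by simp)))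
  rw [le_bot_iff, eq_bot]
  change ¬ (_ ∧ 0 + 1 = n)
  omega

end ConeG

namespace SimplicialObj

variable {W : X.SimplicialObj} (hX : X.IsReedyFibrant) (hX' : X.IsSegal)

include hX hX'

lemma trivOn_inner (hs : EquivTriv 1 W.s₀) {n k : ℕ} (h : k + 2 ≤ n) :
    TrivOn 1 (W.diagram (ConeG.shape n)) {ConeG.edge (k + 1) h, ConeG.inner k h}
      {ConeG.inner k h} := by
  refine (trivOn_pair_one (ConeG.edge_le_inner h) (ConeG.not_inner_le_edge h)).2 ?_
  rw [diagram_arrow]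
  exact equivTriv_vertex hX hX' hs (ConeG.dim_inner h) (ConeG.dim_edge h) _

lemma IsSegalObject.equivTriv (hW : W.IsSegalObject) (hs : EquivTriv 1 W.s₀) (n : SimplexCategory) :
    EquivTriv 1 (W.structureMap (SimplexCategory.const n ⦋0⦌ 0)) := by
  induction n using SimplexCategory.rec with | _ n =>
  obtain _ | _ | n := n
  · rw [SimplexCategory.isTerminalZero.hom_ext (SimplexCategory.const ⦋0⦌ ⦋0⦌ 0) (𝟙 _)]
    exact equivTriv_id hX hX' _
  · rw [SimplexCategory.isTerminalZero.hom_ext (SimplexCategory.const ⦋0 + 1⦌ ⦋0⦌ 0)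
      (SimplexCategory.σ 0 : ⦋1⦌ ⟶ ⦋0⦌)]
    exact hs
  · have h := ConeG.equivTriv_edge hX hX' (by omega) _ (hW.trivOn hX hX' (n := n + 2) (by omega))
      fun k hk ↦ trivOn_inner hX hX' hs hk
    rw [diagram_arrow] at h
    -- The composite `W_n → W_1 → W_0` is an equivalence, and preceding it by the degeneracy `W_0 →
    -- W_n` gives an identity; two-out-of-three leaves the degeneracy.
    have h₁ : EquivTriv 1 (W.structureMap (SimplexCategory.const ⦋0⦌ ⦋1⦌ 0)) :=
      equivTriv_vertex hX hX' hs rfl rfl _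
    have h₂ := equivTriv_comp hX hX' h₁ h
    refine equivTriv_of_comp_left hX hX' h₂ ?_
    have key : ∀ θ : ⦋0⦌ ⟶ ⦋0⦌, EquivTriv 1 (W.structureMap θ) := fun θ ↦ by
      rw [SimplexCategory.isTerminalZero.hom_ext θ (𝟙 _)]
      exact equivTriv_id hX hX' _
    exact key _

end SimplicialObj

/-- The transformation from the constant functor `[0]` to the identity of the opposite simplex
category. -/
def fromZeroTrans : (Functor.const SimplexCategoryᵒᵖ).obj (op ⦋0⦌) ⟶ 𝟭 SimplexCategoryᵒᵖ where
  app l := fromZero l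
  naturality _ _ g := (Category.id_comp _).trans (fromZero_comp g).symm

/-- The homotopy given by `fromZeroTrans`. -/
def fromZeroHomotopy : N.{u} SimplexCategoryᵒᵖ ⊗ Δ[1] ⟶ N.{u} SimplexCategoryᵒᵖ where
  app _ := ↾fun x ↦ ULift.up (Functor.prod' (SSet.stdSimplex.objEquiv x.2).toOrderHom.monotone.functor
    x.1.down ⋙ Functor.uncurry.obj (ComposableArrows.mk₁ fromZeroTrans))
  naturality _ _ _ := ConcreteCategory.hom_ext _ _ fun _ ↦ rfl

namespace SimplicialObj

variable {W : X.SimplicialObj}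

/-- As `[0]` is terminal in the simplex category, the degeneracies from `W_0` are natural and
assemble to a transformation from a constant object to `W`. -/
lemma isTrivial_of_equivTriv (hC : X.IsStable)
    (h : ∀ n, EquivTriv 1 (W.structureMap (SimplexCategory.const n ⦋0⦌ 0))) : W.IsTrivial := by
  refine ⟨W.app _ (vertex (op ⦋0⦌)), fromZeroHomotopy ≫ W, ?_, ?_, fun n ↦ ?_⟩
  · rw [← SSet.const_comp, ← Category.assoc]
    refine congrArg (· ≫ W) (ext_app fun n x ↦ congrArg ULift.up
      (CategoryTheory.Functor.ext (fun _ ↦ rfl) fun i j f ↦ ?_))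
    exact (Category.id_comp (𝟙 (op ⦋0⦌))).trans
      ((Category.id_comp _).trans (Category.comp_id (𝟙 (op ⦋0⦌)))).symm
  · refine Eq.trans ?_ (Category.id_comp W)
    rw [← Category.assoc]
    refine congrArg (· ≫ W) (ext_app fun n x ↦ congrArg ULift.up
      (CategoryTheory.Functor.ext (fun _ ↦ rfl) fun i j f ↦ ?_))
    exact (Category.id_comp (x.down.map f)).trans
      ((Category.id_comp _).trans (Category.comp_id (x.down.map f))).symm
  · have e : (fromZeroHomotopy ≫ W).app _ ((arrow (𝟙 n), SSet.stdSimplex.objEquiv.symm (𝟙 _)) :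
        (N.{u} SimplexCategoryᵒᵖ ⊗ Δ[1] : SSet.{u}) _⦋1⦌) =
        W.structureMap (SimplexCategory.const n.unop ⦋0⦌ 0) :=
      congrArg (fun z ↦ W.app _ (ULift.up z)) (ComposableArrows.ext₁ rfl rfl
        ((Category.comp_id (fromZero n)).trans
          ((Category.id_comp _).trans (Category.comp_id (fromZero n))).symm))
    rw [e]
    -- A map with `EquivTriv 1` is (-1)-truncated, and the result on (-1)-truncated maps supplies
    -- both inverses.
    exact ((h n.unop).isNegOneTruncated hC).isEquivalence hC

end SimplicialObj

end

end SimplicialSpace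

theorem mainTheorem6 (C : SimplicialSpace.{u}) (hC : C.IsStable) :
    (∀ f : C.Arr, C.IsNegOneTruncated f → C.IsEquivalence f) ∧
    ∀ W : C.SimplicialObj, W.IsCompleteSegalObject →
      C.IsNegOneTruncated W.s₀ ∧ C.IsEquivalence W.s₀ ∧ W.IsTrivial := by
  refine ⟨fun f hf ↦ hf.isEquivalence hC, fun W ⟨hW, G, hG, hG'⟩ ↦ ?_⟩
  have hs := hG.equivTriv_s₀ hC hW hG'
  -- The first assertion, applied to `s₀`, turns the cone condition `hs` into an equivalence in the
  -- sense of 2-simplices.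
  have hs' := hs.isNegOneTruncated hC
  exact ⟨hs', hs'.isEquivalence hC, SimplicialSpace.SimplicialObj.isTrivial_of_equivTriv hC
    (hW.equivTriv hC.1.1 hC.1.2 hs)⟩
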